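/- Consider a periodic chain of $L$ unit cells with $q$ spin-$\frac12$'s per cell and a translation-invariant Hamiltonian $H=-\sum_{r\in\mathbb Z/L}\sum_{\alpha=1}^m \mathcal O^r_\alpha$, where $\mathcal O^r_\alpha=\prod_{\mu=1}^{P_\alpha}o^r_{\alpha,\mu}$ with $P_\alpha\ge 1$, and $o^r_{\alpha,\mu}$ is $\pm$ a tensor product of Pauli matrices $I,X,Y,Z$ acting on the cell $r+\mu-1$, the same for all $r$. Assume that for all sufficiently large $L$ all the terms commute, the lowest eigenvalue of $H$ is nondegenerate, and the ground state satisfies $\mathcal O^r_\alpha|\mathrm{GS}\rangle=|\mathrm{GS}\rangle$ for all $r,\alpha$. For a cut $c=(\alpha,\tau)$, $1\le\tau\le P_\alpha-1$, and a bond between the cells $r$ and $r+1$, let $\mathcal L_c=\prod_{\mu\le\tau}o^{r-\tau+1}_{\alpha,\mu}$ and $\mathcal R_c=\prod_{\mu>\tau}o^{r-\tau+1}_{\alpha,\mu}$. Let $\mathbf t$ be the matrix over $\mathbb F_2$, indexed by the cuts, whose entry $\mathbf t_{c,d}$ is the number modulo 2 of positions at which the Pauli strings $\mathcal L_c$ and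 $\mathcal L_d$ have different non-identity Pauli matrices, and let $\operatorname{rank}(\mathbf t)$ be its rank over $\mathbb F_2$. For matrices $T^{g}\in M_{D'}(\mathbb C)$, $g\in\{0,1\}^q$, say that $T$ generates the ground state at length $L$ if $\sum_{g^0,\dots,g^{L-1}}\operatorname{Tr}(T^{g^0}\cdots T^{g^{L-1}})|g^0\dots g^{L-1}\rangle$ is a nonzero multiple of $|\mathrm{GS}\rangle$. Call $T$ canonical if $\sum_g T^g(T^g)^\dagger=\sum_g (T^g)^\dagger T^g=1$, and say that $T$ has a canonical form if $T^g=\lambda\, S\breve T^gS^{-1}$ for all $g$, with a scalar $\lambda\neq0$, an invertible $S$ and a canonical $\breve T$. Virtual operators of $T$ are invertible matrices $U_c$ such that, for every $c=(\alpha,\tau)$, $\mathcal L_c\circ(T^{g^1}\cdots T^{g^\tau})=T^{g^1}\cdots T^{g^\tau}\,U_c$ and $\mathcal R_c\circ(T^{g^{1}}\cdots T^{g^{P_\alpha-\tau}})=U_c^{-1}\,T^{g^{1}}\cdots T^{g^{P_\alpha-\tau}}$, where $\circ$ is the action on the physical indices ($X\circ T^g=T^{1-g}$, $Z\circ T^g=(-1)^gT^g$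 for one spin). Then: 1. $\mathbf t$ is antisymmetric with zero diagonal, and $\operatorname{rank}(\mathbf t)$ is even. For every $L\ge\max_\alpha P_\alpha$ and every bond, $\mathcal L_c\mathcal L_d=(-1)^{\mathbf t_{c,d}}\mathcal L_d\mathcal L_c$ and $\mathcal R_c\mathcal R_d=(-1)^{\mathbf t_{c,d}}\mathcal R_d\mathcal R_c$. 2. If $T$ has a canonical form and generates the ground state for all sufficiently large $L$, then its virtual operators exist, are unique, and satisfy $U_cU_d=(-1)^{\mathbf t_{c,d}}U_dU_c$. 3. The relations $U_cU_d=(-1)^{\mathbf t_{c,d}}U_dU_c$ have an irreducible representation by invertible complex matrices of size $D=2^{\operatorname{rank}(\mathbf t)/2}$, and every (finite-dimensional) irreducible representation by invertible complex matrices has this dimension. 4. $D=2^{\operatorname{rank}(\mathbf t)/2}$ is the minimal MPS bond dimension: there are $D\times D$ matrices $T^g$, independent of $L$, that generate the ground state for all sufficiently large $L$; and for every sufficiently large $L$, matrices of size $D'\times D'$ that generate the ground state at length $L$ have $D'\ge D$. 5. If $D\times D$ matrices $T^g$ with $D=2^{\operatorname{rank}(\mathbf t)/2}$ generate the ground state for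 all sufficiently large $L$, then $T$ has a canonical form and its virtual operators act irreducibly on $\mathbb C^{D}$. -/

import Mathlib

open Filter

namespace StabMPS

/-- Configurations of the `q` spins of one unit cell. -/
abbrev Spin (q : ℕ) := Fin q → ZMod 2

/-- A Hermitian Pauli string on one unit cell: `± σ_1 ⊗ ⋯ ⊗ σ_q`, where `σ_i` is `I`, `X`, `Z`, `Y`
according to `(x i, z i) = (0,0), (1,0), (0,1), (1,1)`. -/
structure PauliString (q : ℕ) where
  sign : ℤˣ
  x : Spin q
  z : Spin q

namespace PauliString

variable {q : ℕ}

/-- The identity operator of a unit cell. -/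
def one : PauliString q := ⟨1, 0, 0⟩

/-- The scalar in `p |g⟩ = p.phase g • |g + x⟩` (with `Y = i X Z`). -/
noncomputable def phase (p : PauliString q) (g : Spin q) : ℂ :=
  ((p.sign : ℤ) : ℂ) *
    ∏ i, (Complex.I ^ (p.x i * p.z i).val * (-1) ^ (p.z i * g i).val)

/-- The symplectic form: `0` if the two strings commute, `1` if they anticommute. -/
def symp (p p' : PauliString q) : ZMod 2 :=
  ∑ i, (p.x i * p'.z i + p.z i * p'.x i)

end PauliString

/-- The operator `⊗_{k : κ} p k` acting on families indexed by spin configurations. For `V = ℂ`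
this is the action on the amplitudes of a state of the cells `κ`; for `V` a space of matrices it is
the action `∘` on the physical indices of (products of) MPS matrices. -/
noncomputable def pauliOp {q : ℕ} {κ : Type} [Fintype κ] {V : Type} [AddCommGroup V] [Module ℂ V]
    (p : κ → PauliString q) : Module.End ℂ ((κ → Spin q) → V) where
  toFun F := fun g => (∏ k, (p k).phase (g k + (p k).x)) • F (fun k => g k + (p k).x)
  map_add' F G := by
    funext g
    simp
  map_smul' c F := by
    funext g
    simp only [Pi.smul_apply, RingHom.id_apply]
    exact smul_comm _ _ _

/-- The data of a translation-invariant stabilizer Hamiltonian with `q` spins per unit cell and `m`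
types of interactions. The term of type `α` starting at cell `r` acts on cell `r + μ`, `μ < P α`,
by the Pauli string `o α μ`; the values `o α μ` with `P α ≤ μ` are never used. -/
structure Code (q m : ℕ) where
  P : Fin m → ℕ
  P_pos : ∀ α, 0 < P α
  o : Fin m → ℕ → PauliString q

/-- States of a periodic chain of `L` unit cells. -/
abbrev Hilb (q L : ℕ) := (ZMod L → Spin q) → ℂ

namespace Code

variable {q m : ℕ} (C : Code q m)

/-- The part of the term of type `α` starting at cell `r` made of its factors `a ≤ μ < b`. -/
noncomputable def seg (L : ℕ) [NeZero L] (α : Fin m) (a b : ℕ) (r : ZMod L) :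
    Module.End ℂ (Hilb q L) :=
  pauliOp fun c : ZMod L =>
    if a ≤ (c - r).val ∧ (c - r).val < b then C.o α (c - r).val else PauliString.one

/-- The Hamiltonian term `𝒪^r_α` on the periodic chain. -/
noncomputable def term (L : ℕ) [NeZero L] (α : Fin m) (r : ZMod L) : Module.End ℂ (Hilb q L) :=
  C.seg L α 0 (C.P α) r

/-- The Hamiltonian `H = - ∑_{r,α} 𝒪^r_α`. -/
noncomputable def hamiltonian (L : ℕ) [NeZero L] : Module.End ℂ (Hilb q L) :=
  - ∑ r : ZMod L, ∑ α : Fin m, C.term L α r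

/-- The Hamiltonian terms commute. -/
def Commuting (L : ℕ) [NeZero L] : Prop :=
  ∀ (α β : Fin m) (r s : ZMod L), Commute (C.term L α r) (C.term L β s)

/-- The stabilizer condition for a (not necessarily normalized) ground state. -/
def IsGroundState (L : ℕ) [NeZero L] (ψ : Hilb q L) : Prop :=
  ψ ≠ 0 ∧ ∀ (α : Fin m) (r : ZMod L), C.term L α r ψ = ψ

/-- The lowest eigenvalue of `H` is nondegenerate, and its eigenvectors satisfy the stabilizer
condition. -/
def HasUniqueGroundState (L : ℕ) [NeZero L] : Prop :=
  ∃ E : ℝ, (∀ E' : ℝ, (C.hamiltonian L).HasEigenvalue (E' : ℂ) → E ≤ E') ∧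
    Module.finrank ℂ ((C.hamiltonian L).eigenspace (E : ℂ)) = 1 ∧
    ∀ ψ ∈ (C.hamiltonian L).eigenspace (E : ℂ), ∀ (α : Fin m) (r : ZMod L),
      C.term L α r ψ = ψ

/-- The cuts `(α, τ)`, `1 ≤ τ ≤ P α - 1`, of the Hamiltonian terms. -/
abbrev Cut := Σ α : Fin m, Fin (C.P α - 1)

/-- The position `τ` of a cut. -/
def pos (c : C.Cut) : ℕ := c.2.val + 1

/-- The left part `ℒ^{r-τ+1}_{α,τ}` of a term cut at the bond between the cells `r` and `r + 1`. -/
noncomputable def leftOp (L : ℕ) [NeZero L] (c : C.Cut) (r : ZMod L) : Module.End ℂ (Hilb q L) :=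
  C.seg L c.1 0 (C.pos c) (r - (C.pos c : ZMod L) + 1)

/-- The right part `ℛ^{r-τ+1}_{α,τ}` of a term cut at the bond between the cells `r` and `r + 1`. -/
noncomputable def rightOp (L : ℕ) [NeZero L] (c : C.Cut) (r : ZMod L) : Module.End ℂ (Hilb q L) :=
  C.seg L c.1 (C.pos c) (C.P c.1) (r - (C.pos c : ZMod L) + 1)

/-- The matrix `𝐭` with values modulo 2. In the cell `r - k` the operator `ℒ^{r-τ+1}_{α,τ}` acts by
the factor number `τ - 1 - k` (counted from 0) of the term, if `k < τ`. -/
def tMatrix : Matrix C.Cut C.Cut (ZMod 2) := fun c d =>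
  ∑ k ∈ Finset.range (min (C.pos c) (C.pos d)),
    (C.o c.1 (C.pos c - 1 - k)).symp (C.o d.1 (C.pos d - 1 - k))

end Code

/-- A translation-invariant MPS tensor of bond dimension `D`. -/
abbrev Tensor (q D : ℕ) := Spin q → Matrix (Fin D) (Fin D) ℂ

namespace Tensor

variable {q D : ℕ} (T : Tensor q D)

/-- The product of `n` consecutive MPS matrices. -/
noncomputable def block (n : ℕ) (g : Fin n → Spin q) : Matrix (Fin D) (Fin D) ℂ :=
  (List.ofFn fun k => T (g k)).prod

/-- The periodic matrix product state `∑_g Tr(T^{g^0} ⋯ T^{g^{L-1}}) |g⟩`. -/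
noncomputable def mps (L : ℕ) : Hilb q L := fun g =>
  ((List.range L).map fun n => T (g (n : ZMod L))).prod.trace

/-- `T` generates the periodic ground state for all sufficiently large system sizes. -/
def Generates {m : ℕ} (C : Code q m) : Prop :=
  ∀ᶠ L : ℕ in atTop, ∀ [NeZero L], C.IsGroundState L (T.mps L)

/-- The canonical form of an MPS with flat entanglement spectrum. -/
def IsCanonical : Prop :=
  ∑ g, T g * (T g).conjTranspose = 1 ∧ ∑ g, (T g).conjTranspose * T g = 1

/-- `T` is, up to normalization, related to a canonical MPS by a similarity transformation. -/
def HasCanonicalForm : Prop :=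
  ∃ (c : ℂ) (S : (Matrix (Fin D) (Fin D) ℂ)ˣ) (T' : Tensor q D),
    c ≠ 0 ∧ T'.IsCanonical ∧
      ∀ g, T g = c • ((S : Matrix (Fin D) (Fin D) ℂ) * T' g *
        ((S⁻¹ : (Matrix (Fin D) (Fin D) ℂ)ˣ) : Matrix (Fin D) (Fin D) ℂ))

/-- The `U c` are the virtual operators of `T`: on the physical indices, the left part of a cut
term acts on the MPS matrices as multiplication by `U` from the right, and the right part as
multiplication by `U⁻¹` from the left. -/
def IsVirtual {m : ℕ} (C : Code q m) (U : C.Cut → (Matrix (Fin D) (Fin D) ℂ)ˣ) : Prop :=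
  ∀ c : C.Cut,
    (∀ g, pauliOp (fun k : Fin (C.pos c) => C.o c.1 k) (T.block (C.pos c)) g =
      T.block (C.pos c) g * (U c : Matrix (Fin D) (Fin D) ℂ)) ∧
    (∀ g, pauliOp (fun k : Fin (C.P c.1 - C.pos c) => C.o c.1 (C.pos c + k))
        (T.block (C.P c.1 - C.pos c)) g =
      (((U c)⁻¹ : (Matrix (Fin D) (Fin D) ℂ)ˣ) : Matrix (Fin D) (Fin D) ℂ) *
        T.block (C.P c.1 - C.pos c) g)

end Tensor

/-- The relations `A_i A_j = (-1)^{t_ij} A_j A_i` of the generalized Clifford algebra of `t`. -/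
def CliffordRel {ι R : Type} [Ring R] (t : Matrix ι ι (ZMod 2)) (A : ι → R) : Prop :=
  ∀ i j, A i * A j = (-1) ^ (t i j).val * (A j * A i)

/-- A `D`-dimensional representation, by invertible matrices, of the generalized Clifford algebra
of `t`. -/
def IsCliffordRep {ι : Type} {D : ℕ} (t : Matrix ι ι (ZMod 2))
    (U : ι → (Matrix (Fin D) (Fin D) ℂ)ˣ) : Prop :=
  CliffordRel t fun i => (U i : Matrix (Fin D) (Fin D) ℂ)

/-- The matrices `U i` act irreducibly on `ℂ^D`. -/
def IsIrreducible {ι : Type} {D : ℕ} (U : ι → (Matrix (Fin D) (Fin D) ℂ)ˣ) : Prop :=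
  0 < D ∧ ∀ W : Submodule ℂ (Fin D → ℂ),
    (∀ i, ∀ w ∈ W, (U i : Matrix (Fin D) (Fin D) ℂ).mulVec w ∈ W) → W = ⊥ ∨ W = ⊤

end StabMPS

/-! Representation theory and lower bound both rest on one counting argument. If invertible `A i`
satisfy the relations of `t`, the product of the `A j` with `v j = 1` commutes with each `A i` up to
the sign given by `(t v) i`. Invertible elements with different commutation characters are linearly
independent, so the algebra has dimension at least `2 ^ rank t` (`two_pow_rank_le_finrank`), with
equality if the `A i` generate it and only scalars commute with all of them
(`finrank_eq_two_pow_rank`). By Burnside and Schur an irreducible representation has `D ^ 2 = 2 ^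
rank t`; the parity of the rank then follows from the existence of one such representation.

Existence of the tensor. Open a long ring into a chain. The terms truncated at its right end
generate a module from the ground state `ψ`, and an irreducible submodule gives matrices `U`. The
states that are fixed by the bulk terms and killed by all relations of `U` form a subspace stable
under every truncated term, and so is its orthogonal complement; uniqueness of the ground state
forces `ψ` into that subspace (`exists_virtual_relations`). Hence matrices act on `ψ`, and trace
duality writes `ψ` as the trace of a family `Φ` on which truncated terms act by `U` at the ends
(`exists_good_of_relations`). Such families are unique up to scalars, and comparing `Φ Ψ` with `Ψ Φ`
for lengths `n` and `n + 1` extracts a one-site tensor (`exists_tensor_of_good`).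

Lower bound. The states of an interval obtained by fixing the spins outside it carry the commuting
relations of both ends, that is, those of `t ⊕ t`. The counting argument makes their span at least
`2 ^ rank t` dimensional, while an MPS bounds it by `D ^ 2`.

Virtual operators. For a canonical tensor the span of the long blocks is stable under the adjoint
matrices, so the stabilizer condition becomes an identity between blocks, and one-sided inverses
split it at each cut into `U` and `U⁻¹`. At minimal `D` the blocks span all matrices, the counting
bound leaves no room for a proper invariant subspace, and Schur's lemma makes the Gram matrices of
the blocks eigenvectors of the transfer operator and its adjoint, inverse to each other up to a
scalar. This gives the canonical form. -/

namespace StabMPS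

/-! ### Generalized Clifford relations and the dimension of the algebra they generate -/

/-- The character `a ↦ (-1) ^ a` of `ZMod 2`. -/
noncomputable def sgn (a : ZMod 2) : ℂ := (-1) ^ a.val

theorem sgn_zero : sgn 0 = 1 := by simp [sgn]

theorem sgn_add (a b : ZMod 2) : sgn (a + b) = sgn a * sgn b := by
  revert a b
  have h : ∀ a : ZMod 2, a = 0 ∨ a = 1 := by decide
  intro a b
  rcases h a with rfl | rfl <;> rcases h b with rfl | rfl <;>
    simp [sgn, show (1 : ZMod 2) + 1 = 0 from rfl, ZMod.val_one]

theorem sgn_sum {κ : Type*} (s : Finset κ) (f : κ → ZMod 2) :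
    sgn (∑ k ∈ s, f k) = ∏ k ∈ s, sgn (f k) := by
  classical
  induction s using Finset.induction_on with
  | empty => simp [sgn_zero]
  | insert a s ha ih => rw [Finset.sum_insert ha, Finset.prod_insert ha, sgn_add, ih]

theorem sgn_injective : Function.Injective sgn := by
  have h : ∀ a : ZMod 2, a = 0 ∨ a = 1 := by decide
  intro a b hab
  rcases h a with rfl | rfl <;> rcases h b with rfl | rfl <;>
    simp [sgn, ZMod.val_one] at hab ⊢ <;> norm_num at hab

theorem sgn_mul_self (a : ZMod 2) : sgn a * sgn a = 1 := by
  rw [← sgn_add, CharTwo.add_self_eq_zero, sgn_zero]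

theorem neg_one_pow_val_mul {R : Type*} [Ring R] [Algebra ℂ R] (a : ZMod 2) (x : R) :
    (-1) ^ a.val * x = sgn a • x := by
  rw [sgn, Algebra.smul_def, map_pow, map_neg, map_one]

theorem cliffordRel_iff {ι R : Type} [Ring R] [Algebra ℂ R] (t : Matrix ι ι (ZMod 2))
    (A : ι → R) : CliffordRel t A ↔ ∀ i j, A i * A j = sgn (t i j) • (A j * A i) := by
  simp only [CliffordRel, neg_one_pow_val_mul]

section Homogeneous

variable {ι R : Type} [Ring R] [Algebra ℂ R]

/-- The elements `X` with `A i * X = (-1) ^ χ i • (X * A i)` for all `i`. -/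
def homog (A : ι → R) (χ : ι → ZMod 2) : Submodule ℂ R where
  carrier := {X | ∀ i, A i * X = sgn (χ i) • (X * A i)}
  add_mem' hx hy i := by rw [mul_add, hx i, hy i, add_mul, smul_add]
  zero_mem' i := by simp
  smul_mem' c x hx i := by rw [mul_smul_comm, hx i, smul_mul_assoc, smul_comm]

theorem one_mem_homog (A : ι → R) : (1 : R) ∈ homog A 0 := by
  intro i; simp [sgn_zero]

theorem mul_mem_homog {A : ι → R} {χ χ' : ι → ZMod 2} {X Y : R} (hX : X ∈ homog A χ)
    (hY : Y ∈ homog A χ') : X * Y ∈ homog A (χ + χ') := by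
  intro i
  rw [← mul_assoc, hX i, smul_mul_assoc, mul_assoc, hY i, mul_smul_comm, smul_smul, Pi.add_apply,
    sgn_add, mul_assoc]

theorem generator_mem_homog {t : Matrix ι ι (ZMod 2)} {A : ι → R} (h : CliffordRel t A) (j : ι) :
    A j ∈ homog A (t.col j) := fun i => (cliffordRel_iff t A).1 h i j

/-- Multiply together the generators `A j` with `v j = 1`: characters add under products. -/
theorem exists_unit_mem_homog [Fintype ι] {t : Matrix ι ι (ZMod 2)} {A : ι → R}
    (h : CliffordRel t A) (hA : ∀ i, IsUnit (A i)) (v : ι → ZMod 2) :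
    ∃ X ∈ homog A (t.mulVec v), IsUnit X := by
  have hv : t.mulVec v = ∑ j, v j • t.col j := by
    ext i
    simp [Matrix.mulVec, dotProduct, mul_comm]
  rw [hv]
  refine Finset.sum_induction (fun j => v j • t.col j)
    (fun χ => ∃ X ∈ homog A χ, IsUnit X) ?_ ?_ ?_
  · rintro χ χ' ⟨X, hX, hX'⟩ ⟨Y, hY, hY'⟩
    exact ⟨X * Y, mul_mem_homog hX hY, hX'.mul hY'⟩
  · exact ⟨1, one_mem_homog A, isUnit_one⟩
  · intro j _
    have h2 : ∀ a : ZMod 2, a = 0 ∨ a = 1 := by decide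
    rcases h2 (v j) with h0 | h0
    · exact ⟨1, by rw [h0, zero_smul]; exact one_mem_homog A, isUnit_one⟩
    · exact ⟨A j, by rw [h0, one_smul]; exact generator_mem_homog h j, hA j⟩

/-- Conjugations by the `A i` commute, since the signs from the two sides cancel, and `homog A χ`
lies in their joint eigenspace with eigenvalues `sgn (χ i)`. Distinct `χ` give distinct eigenvalues.
-/
theorem iSupIndep_homog {t : Matrix ι ι (ZMod 2)} {A : ι → R} (h : CliffordRel t A)
    (hA : ∀ i, IsUnit (A i)) : iSupIndep (homog A) := by
  choose u hu using hA
  let f : ι → Module.End ℂ R := fun i =>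
    LinearMap.mulLeft ℂ (A i) * LinearMap.mulRight ℂ (((u i)⁻¹ : Rˣ) : R)
  have hf : ∀ i x, f i x = u i * x * ((u i)⁻¹ : Rˣ) := by
    intro i x
    simp [f, hu, mul_assoc]
  have hcomm : ∀ i j, Commute (f i) (f j) := by
    intro i j
    have huu : (u i : R) * u j = sgn (t i j) • (u j * u i) := by
      rw [hu, hu]; exact (cliffordRel_iff t A).1 h i j
    have huu' : ((u j)⁻¹ : Rˣ) * ((u i)⁻¹ : Rˣ) =
        sgn (t i j) • ((((u i)⁻¹ : Rˣ) : R) * ((u j)⁻¹ : Rˣ)) := by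
      have e : (u i : R) * u j * ((((u j)⁻¹ : Rˣ) : R) * ((u i)⁻¹ : Rˣ)) = 1 := by
        simp [mul_assoc]
      have e' : (u i : R) * u j * (sgn (t i j) • ((((u i)⁻¹ : Rˣ) : R) * ((u j)⁻¹ : Rˣ))) = 1 := by
        rw [huu, smul_mul_smul_comm, sgn_mul_self, one_smul]
        simp [mul_assoc]
      exact ((u i).isUnit.mul (u j).isUnit).mul_left_cancel (e.trans e'.symm)
    ext x
    simp only [Module.End.mul_apply, hf]
    calc (u i : R) * (u j * x * ((u j)⁻¹ : Rˣ)) * ((u i)⁻¹ : Rˣ)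
        = (u i * u j) * x * (((u j)⁻¹ : Rˣ) * ((u i)⁻¹ : Rˣ)) := by simp only [mul_assoc]
      _ = (sgn (t i j) * sgn (t i j)) •
          ((u j * u i) * x * (((u i)⁻¹ : Rˣ) * ((u j)⁻¹ : Rˣ))) := by
        rw [huu, huu', smul_mul_assoc, smul_mul_smul_comm]
      _ = _ := by rw [sgn_mul_self, one_smul]; simp only [mul_assoc]
  have hind := Module.End.independent_iInf_maxGenEigenspace_of_forall_mapsTo f
    fun i j φ => Module.End.mapsTo_maxGenEigenspace_of_comm (hcomm j i) φ
  have hinj : Function.Injective fun (χ : ι → ZMod 2) (i : ι) => sgn (χ i) := fun χ χ' hχ =>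
    funext fun i => sgn_injective (congrFun hχ i)
  refine (hind.comp hinj).mono fun χ X hX => ?_
  rw [Function.comp_apply, Submodule.mem_iInf]
  intro i
  refine (Module.End.genEigenspace (f i) _).mono (le_top (a := (1 : ℕ∞))) ?_
  change X ∈ (f i).eigenspace _
  rw [Module.End.mem_eigenspace_iff, hf, hu, hX i, ← hu]
  simp [mul_assoc]

theorem card_range_mulVecLin [Fintype ι] (t : Matrix ι ι (ZMod 2)) :
    Nat.card (LinearMap.range t.mulVecLin) = 2 ^ t.rank := by
  classical
  rw [Module.natCard_eq_pow_finrank (K := ZMod 2), Nat.card_eq_fintype_card, ZMod.card]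
  rfl

theorem exists_homogeneous_family [Fintype ι] {t : Matrix ι ι (ZMod 2)} {A : ι → R}
    [Nontrivial R] (h : CliffordRel t A) (hA : ∀ i, IsUnit (A i)) :
    ∃ X : LinearMap.range t.mulVecLin → R,
      (∀ χ : LinearMap.range t.mulVecLin, X χ ∈ homog A χ ∧ IsUnit (X χ)) ∧ LinearIndependent ℂ X := by
  have hex : ∀ χ : LinearMap.range t.mulVecLin, ∃ X ∈ homog A χ, IsUnit X := by
    rintro ⟨_, v, rfl⟩
    exact exists_unit_mem_homog h hA v
  choose X hX hXu using hex
  refine ⟨X, fun χ => ⟨hX χ, hXu χ⟩, ?_⟩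
  refine ((iSupIndep_homog h hA).comp Subtype.val_injective).linearIndependent _ hX ?_
  exact fun χ => (hXu χ).ne_zero

/-- A finite-dimensional algebra with invertible elements satisfying the relations of `t` has
dimension at least `2 ^ rank t`. -/
theorem two_pow_rank_le_finrank [Fintype ι] {t : Matrix ι ι (ZMod 2)} {A : ι → R} [Nontrivial R]
    [FiniteDimensional ℂ R] (h : CliffordRel t A) (hA : ∀ i, IsUnit (A i)) :
    2 ^ t.rank ≤ Module.finrank ℂ R := by
  classical
  obtain ⟨X, -, hX⟩ := exists_homogeneous_family h hA
  have := hX.fintype_card_le_finrank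
  rwa [← Nat.card_eq_fintype_card, card_range_mulVecLin] at this

/-- A central algebra generated by invertible elements satisfying the relations of `t` has
dimension `2 ^ rank t`. -/
theorem finrank_eq_two_pow_rank [Fintype ι] {t : Matrix ι ι (ZMod 2)} {A : ι → R} [Nontrivial R]
    [FiniteDimensional ℂ R] (h : CliffordRel t A) (hA : ∀ i, IsUnit (A i))
    (hgen : Algebra.adjoin ℂ (Set.range A) = ⊤)
    (hcen : ∀ x : R, (∀ i, Commute (A i) x) → ∃ c : ℂ, x = c • 1) :
    Module.finrank ℂ R = 2 ^ t.rank := by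
  classical
  refine le_antisymm ?_ (two_pow_rank_le_finrank h hA)
  obtain ⟨X, hX, -⟩ := exists_homogeneous_family h hA
  have hmem : ∀ (χ : LinearMap.range t.mulVecLin) (Y : R), Y ∈ homog A χ →
      Y ∈ Submodule.span ℂ (Set.range X) := by
    intro χ Y hY
    obtain ⟨x, hx⟩ := (hX χ).2
    have hx1 := (hX χ).1
    rw [← hx] at hx1
    -- `Y` and the unit `x` have the same character, so `x⁻¹ * Y` commutes with every generator:
    -- each homogeneous space is a line.
    obtain ⟨c, hc⟩ := hcen (((x⁻¹ : Rˣ) : R) * Y) fun i => by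
      have e1 : A i * ((x⁻¹ : Rˣ) : R) = sgn ((χ : ι → ZMod 2) i) • (((x⁻¹ : Rˣ) : R) * A i) := by
        have := hx1 i
        calc A i * ((x⁻¹ : Rˣ) : R) = (sgn ((χ : ι → ZMod 2) i) * sgn ((χ : ι → ZMod 2) i)) •
              (((x⁻¹ : Rˣ) : R) * (x * A i) * ((x⁻¹ : Rˣ) : R)) := by
              rw [sgn_mul_self, one_smul, ← mul_assoc, Units.inv_mul, one_mul]
          _ = sgn ((χ : ι → ZMod 2) i) •
              (((x⁻¹ : Rˣ) : R) * (A i * x) * ((x⁻¹ : Rˣ) : R)) := by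
              rw [this, mul_smul_comm, smul_mul_assoc, smul_smul]
          _ = _ := by rw [mul_assoc, mul_assoc, Units.mul_inv, mul_one]
      change A i * _ = _ * A i
      rw [← mul_assoc, e1, smul_mul_assoc, mul_assoc, hY i, mul_smul_comm, smul_smul,
        sgn_mul_self, one_smul, mul_assoc]
    have : Y = c • X χ := by
      rw [← hx]
      calc Y = x * (((x⁻¹ : Rˣ) : R) * Y) := by rw [← mul_assoc, Units.mul_inv, one_mul]
        _ = _ := by rw [hc, mul_smul_comm, mul_one]
    rw [this]
    exact Submodule.smul_mem _ _ (Submodule.subset_span ⟨χ, rfl⟩)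
  -- A generator shifts characters by a column of `t`, so it does not leave the range of `t`.
  have hS : ∀ a ∈ Algebra.adjoin ℂ (Set.range A), ∀ y ∈ Submodule.span ℂ (Set.range X),
      a * y ∈ Submodule.span ℂ (Set.range X) := by
    intro a ha
    induction ha using Algebra.adjoin_induction with
    | mem a ha =>
      obtain ⟨i, rfl⟩ := ha
      intro y hy
      induction hy using Submodule.span_induction with
      | mem y hy =>
        obtain ⟨χ, rfl⟩ := hy
        have hcol : t.col i ∈ LinearMap.range t.mulVecLin :=
          ⟨Pi.single i 1, by simp⟩
        exact hmem (⟨_, hcol⟩ + χ) _ (mul_mem_homog (generator_mem_homog h i) (hX χ).1)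
      | zero => simp
      | add x y _ _ hx hy => rw [mul_add]; exact add_mem hx hy
      | smul c x _ hx => rw [mul_smul_comm]; exact Submodule.smul_mem _ _ hx
    | algebraMap c =>
      intro y hy
      rw [← Algebra.smul_def]
      exact Submodule.smul_mem _ _ hy
    | add a b _ _ ha hb => intro y hy; rw [add_mul]; exact add_mem (ha y hy) (hb y hy)
    | mul a b _ _ ha hb => intro y hy; rw [mul_assoc]; exact ha _ (hb y hy)
  have htop : Submodule.span ℂ (Set.range X) = ⊤ := by
    refine eq_top_iff.2 fun a _ => ?_
    have := hS a (hgen ▸ Algebra.mem_top) 1 (hmem 0 1 (one_mem_homog A))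
    rwa [mul_one] at this
  have := finrank_range_le_card (R := ℂ) X
  rw [Set.finrank, htop, finrank_top] at this
  rwa [← card_range_mulVecLin, Nat.card_eq_fintype_card]

end Homogeneous

/-! ### Burnside's theorem and irreducible representations -/

/-- Burnside's theorem: a subalgebra acting irreducibly is the full endomorphism algebra. -/
theorem subalgebra_eq_top_of_irreducible {V : Type*} [AddCommGroup V] [Module ℂ V]
    [FiniteDimensional ℂ V] [Nontrivial V] (𝒜 : Subalgebra ℂ (Module.End ℂ V))
    (h : ∀ W : Submodule ℂ V, (∀ a ∈ 𝒜, ∀ w ∈ W, a w ∈ W) → W = ⊥ ∨ W = ⊤) : 𝒜 = ⊤ := by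
  classical
  have hsimple : IsSimpleModule 𝒜 V := by
    rw [isSimpleModule_iff]
    refine { exists_pair_ne := ⟨⊥, ⊤, bot_ne_top⟩, eq_bot_or_eq_top := fun W => ?_ }
    rcases h (W.restrictScalars ℂ) fun a ha w hw => W.smul_mem (⟨a, ha⟩ : 𝒜) hw with hW | hW
    · left; simpa using hW
    · right; simpa using hW
  have hschur := IsSimpleModule.algebraMap_end_bijective_of_isAlgClosed (A := 𝒜) (V := V) ℂ
  refine eq_top_iff.2 fun f _ => ?_
  -- By Schur's lemma the commutant of `𝒜` consists of scalars, so every `f` is linear over it;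
  -- density on a basis then finds `f` in `𝒜`.
  let F : Module.End (Module.End 𝒜 V) V :=
    { toFun := f
      map_add' := f.map_add
      map_smul' := fun φ v => by
        obtain ⟨c, rfl⟩ := hschur.2 φ
        simp }
  obtain ⟨r, hr⟩ := jacobson_density F (Finset.univ.image (Module.finBasis ℂ V))
  have : f = (r : Module.End ℂ V) := (Module.finBasis ℂ V).ext fun i =>
    hr _ (Finset.mem_image_of_mem _ (Finset.mem_univ i))
  rw [this]
  exact r.2

theorem IsIrreducible.adjoin_eq_top {ι : Type} {D : ℕ} {U : ι → (Matrix (Fin D) (Fin D) ℂ)ˣ}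
    (h : IsIrreducible U) :
    Algebra.adjoin ℂ (Set.range fun i => (U i : Matrix (Fin D) (Fin D) ℂ)) = ⊤ := by
  obtain ⟨hD, h⟩ := h
  have : Nonempty (Fin D) := ⟨⟨0, hD⟩⟩
  set 𝒜 := Algebra.adjoin ℂ (Set.range fun i => (U i : Matrix (Fin D) (Fin D) ℂ)) with h𝒜
  let e := (Matrix.toLinAlgEquiv' : Matrix (Fin D) (Fin D) ℂ ≃ₐ[ℂ] _)
  have := subalgebra_eq_top_of_irreducible (𝒜.map e.toAlgHom) fun W hW => h W fun i w hw =>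
    hW (e (U i)) (Subalgebra.mem_map.2 ⟨_, Algebra.subset_adjoin ⟨i, rfl⟩, rfl⟩) w hw
  refine eq_top_iff.2 fun a _ => ?_
  obtain ⟨b, hb, hba⟩ := Subalgebra.mem_map.1 (this ▸ Algebra.mem_top : e a ∈ 𝒜.map e.toAlgHom)
  have : b = a := e.injective hba
  exact this ▸ hb

theorem exists_eq_smul_one_of_commute {D : ℕ} {ι : Type} {A : ι → Matrix (Fin D) (Fin D) ℂ}
    (hA : Algebra.adjoin ℂ (Set.range A) = ⊤) (x : Matrix (Fin D) (Fin D) ℂ)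
    (hx : ∀ i, Commute (A i) x) : ∃ c : ℂ, x = c • 1 := by
  have hc : ∀ a : Matrix (Fin D) (Fin D) ℂ, Commute a x := by
    intro a
    have ha : a ∈ Algebra.adjoin ℂ (Set.range A) := hA ▸ Algebra.mem_top
    induction ha using Algebra.adjoin_induction with
    | mem a ha => obtain ⟨i, rfl⟩ := ha; exact hx i
    | algebraMap c => exact Algebra.commutes c x
    | add a b _ _ ha hb => exact ha.add_left hb
    | mul a b _ _ ha hb => exact ha.mul_left hb
  obtain ⟨c, hc⟩ := Matrix.mem_range_scalar_of_commute_single (M := x) fun i j _ => hc _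
  exact ⟨c, by rw [← hc, Matrix.scalar_apply, Matrix.smul_one_eq_diagonal]⟩

/-- An irreducible representation of the relations of `t` has dimension `D` with
`D ^ 2 = 2 ^ rank t`. -/
theorem IsIrreducible.sq_eq {ι : Type} [Fintype ι] {D : ℕ} {t : Matrix ι ι (ZMod 2)}
    {U : ι → (Matrix (Fin D) (Fin D) ℂ)ˣ} (h : IsIrreducible U) (hU : IsCliffordRep t U) :
    D ^ 2 = 2 ^ t.rank := by
  have : Nonempty (Fin D) := ⟨⟨0, h.1⟩⟩
  rw [← finrank_eq_two_pow_rank hU (fun i => (U i).isUnit) h.adjoin_eq_top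
    (exists_eq_smul_one_of_commute h.adjoin_eq_top), Module.finrank_matrix]
  simp [sq]

/-- Applied to any irreducible representation, this shows that the rank is even. -/
theorem even_and_eq_of_sq_eq_two_pow {D r : ℕ} (h : D ^ 2 = 2 ^ r) : Even r ∧ D = 2 ^ (r / 2) := by
  obtain ⟨k, -, rfl⟩ := (Nat.dvd_prime_pow Nat.prime_two).1 (h ▸ Dvd.intro_left (D ^ 1) (by ring) :
    D ∣ 2 ^ r)
  have : k * 2 = r := Nat.pow_right_injective le_rfl (by simpa [pow_mul] using h)
  subst this
  simp

/-- Every nonzero subspace invariant under a family of involutions contains an irreducible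
representation. -/
theorem exists_irreducible_intertwiner {ι : Type} {V : Type*} [AddCommGroup V] [Module ℂ V]
    [FiniteDimensional ℂ V] (A : ι → Module.End ℂ V) (hA : ∀ i, A i * A i = 1)
    (W : Submodule ℂ V) (hW : W ≠ ⊥) (hinv : ∀ i, ∀ w ∈ W, A i w ∈ W) :
    ∃ (D : ℕ) (U : ι → (Matrix (Fin D) (Fin D) ℂ)ˣ) (j : (Fin D → ℂ) →ₗ[ℂ] V),
      IsIrreducible U ∧ (∀ i, (U i : Matrix (Fin D) (Fin D) ℂ) * U i = 1) ∧
      Function.Injective j ∧ (∀ v, j v ∈ W) ∧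
      ∀ i v, A i (j v) = j ((U i : Matrix (Fin D) (Fin D) ℂ).mulVec v) := by
  -- A minimal nonzero invariant subspace is irreducible; a basis of it turns the operators into
  -- matrices.
  obtain ⟨K, ⟨⟨hK0, hKW, hKinv⟩, hKmin⟩⟩ := exists_minimal_of_wellFoundedLT
    (fun K : Submodule ℂ V => K ≠ ⊥ ∧ K ≤ W ∧ ∀ i, ∀ w ∈ K, A i w ∈ K) ⟨W, hW, le_rfl, hinv⟩
  let D := Module.finrank ℂ K
  let b := (Module.finBasis ℂ K).equivFun
  let j : (Fin D → ℂ) →ₗ[ℂ] V := K.subtype ∘ₗ b.symm.toLinearMap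
  have hj : Function.Injective j := K.injective_subtype.comp b.symm.injective
  have hjK : ∀ v, j v ∈ K := fun v => (b.symm v).2
  let B : ι → Module.End ℂ (Fin D → ℂ) := fun i =>
    b.toLinearMap ∘ₗ ((A i).restrict (hKinv i)) ∘ₗ b.symm.toLinearMap
  have hB : ∀ i v, A i (j v) = j (B i v) := fun i v => by simp [j, B]
  let M : ι → Matrix (Fin D) (Fin D) ℂ := fun i => LinearMap.toMatrix' (B i)
  have hM : ∀ i v, A i (j v) = j ((M i).mulVec v) := fun i v => by
    rw [hB, ← Matrix.toLin'_apply, Matrix.toLin'_toMatrix']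
  have hMM : ∀ i, M i * M i = 1 := fun i => by
    refine Matrix.ext_of_mulVec_single fun k => ?_
    apply hj
    rw [← Matrix.mulVec_mulVec, ← hM, ← hM, ← Module.End.mul_apply, hA, Matrix.one_mulVec]
    rfl
  refine ⟨D, fun i => ⟨M i, M i, hMM i, hMM i⟩, j, ⟨?_, fun W' hW' => ?_⟩, hMM, hj,
    fun v => hKW (hjK v), hM⟩
  · exact Nat.pos_of_ne_zero fun h => hK0 (Submodule.finrank_eq_zero.1 h)
  · by_cases h0 : W' = ⊥
    · exact Or.inl h0
    right
    have hle : W'.map j ≤ K := by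
      rintro _ ⟨v, -, rfl⟩; exact hjK v
    have := hKmin (y := W'.map j) ⟨?_, hle.trans hKW, ?_⟩ hle
    · refine eq_top_iff.2 fun v _ => ?_
      obtain ⟨w, hw, hwv⟩ := this (hjK v)
      exact hj hwv ▸ hw
    · intro h
      apply h0
      exact Submodule.map_injective_of_injective hj (h.trans (Submodule.map_bot j).symm)
    · rintro i _ ⟨v, hv, rfl⟩
      exact ⟨_, hW' i v hv, (hM i v).symm⟩

end StabMPS

/-! ### Pauli strings and their operators -/

namespace StabMPS

namespace PauliString

variable {q : ℕ}

theorem phase_eq (p : PauliString q) (g : Spin q) :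
    p.phase g = ((p.sign : ℤ) : ℂ) * (∏ i, Complex.I ^ (p.x i * p.z i).val) *
      sgn (∑ i, p.z i * g i) := by
  rw [phase, Finset.prod_mul_distrib, sgn_sum, mul_assoc]
  rfl

theorem phase_one (g : Spin q) : (one : PauliString q).phase g = 1 := by
  simp [phase, one]

theorem one_x : (one : PauliString q).x = 0 := rfl

theorem phase_mul_phase (p : PauliString q) (g : Spin q) :
    p.phase (g + p.x) * p.phase g = 1 := by
  have h2 : ∀ a : ZMod 2, a = 0 ∨ a = 1 := by decide
  have hs : ((p.sign : ℤ) : ℂ) * ((p.sign : ℤ) : ℂ) = 1 := by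
    rcases Int.units_eq_one_or p.sign with h | h <;> simp [h]
  -- The factor `i ^ 2 = -1` of each `Y` cancels the sign from moving `Z` past `X`.
  have hI : (∏ i, Complex.I ^ (p.x i * p.z i).val) * (∏ i, Complex.I ^ (p.x i * p.z i).val) *
      sgn (∑ i, p.x i * p.z i) = 1 := by
    rw [sgn_sum, ← Finset.prod_mul_distrib, ← Finset.prod_mul_distrib]
    refine Finset.prod_eq_one fun i _ => ?_
    rcases h2 (p.x i * p.z i) with h | h <;> simp [h, sgn, ZMod.val_one]
  have e : ∑ i, p.z i * (g + p.x) i = ∑ i, p.z i * g i + ∑ i, p.x i * p.z i := by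
    rw [← Finset.sum_add_distrib]
    exact Finset.sum_congr rfl fun i _ => by rw [Pi.add_apply]; ring
  rw [phase_eq, phase_eq, e, sgn_add]
  calc _ = (((p.sign : ℤ) : ℂ) * ((p.sign : ℤ) : ℂ)) *
        ((∏ i, Complex.I ^ (p.x i * p.z i).val) * (∏ i, Complex.I ^ (p.x i * p.z i).val) *
          sgn (∑ i, p.x i * p.z i)) * (sgn (∑ i, p.z i * g i) * sgn (∑ i, p.z i * g i)) := by ring
    _ = 1 := by rw [hs, hI, sgn_mul_self]; norm_num

theorem phase_ne_zero (p : PauliString q) (g : Spin q) : p.phase g ≠ 0 := fun h => by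
  simpa [h] using p.phase_mul_phase g

theorem phase_comm (p p' : PauliString q) (g : Spin q) :
    p.phase (g + p.x) * p'.phase (g + p.x + p'.x) =
      sgn (p.symp p') * (p'.phase (g + p'.x) * p.phase (g + p'.x + p.x)) := by
  have e : ∑ i, p.z i * (g + p.x) i + ∑ i, p'.z i * (g + p.x + p'.x) i =
      p.symp p' + (∑ i, p'.z i * (g + p'.x) i + ∑ i, p.z i * (g + p'.x + p.x) i) := by
    rw [symp, ← Finset.sum_add_distrib, ← Finset.sum_add_distrib, ← Finset.sum_add_distrib]
    refine Finset.sum_congr rfl fun i _ => ?_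
    simp only [Pi.add_apply]
    linear_combination -(CharTwo.add_self_eq_zero (p.z i * p'.x i))
  have e' := congrArg sgn e
  simp only [sgn_add] at e'
  simp only [phase_eq]
  linear_combination ((p.sign : ℤ) : ℂ) * (∏ i, Complex.I ^ (p.x i * p.z i).val) *
    ((p'.sign : ℤ) : ℂ) * (∏ i, Complex.I ^ (p'.x i * p'.z i).val) * e'

theorem norm_phase (p : PauliString q) (g : Spin q) : ‖p.phase g‖ = 1 := by
  have hs : ‖((p.sign : ℤ) : ℂ)‖ = 1 := by
    rcases Int.units_eq_one_or p.sign with h | h <;> simp [h]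
  rw [phase, norm_mul, hs]
  simp

theorem symp_one_left (p : PauliString q) : one.symp p = 0 := by simp [symp, one]

theorem symp_one_right (p : PauliString q) : p.symp one = 0 := by simp [symp, one]

theorem symp_comm (p p' : PauliString q) : p.symp p' = p'.symp p :=
  Finset.sum_congr rfl fun i _ => by ring

theorem symp_self (p : PauliString q) : p.symp p = 0 :=
  Finset.sum_eq_zero fun i _ => by rw [mul_comm (p.z i)]; exact CharTwo.add_self_eq_zero _

end PauliString

section PauliOp

variable {q : ℕ} {κ κ' : Type} [Fintype κ] [Fintype κ'] {V W : Type} [AddCommGroup V] [Module ℂ V]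
  [AddCommGroup W] [Module ℂ W]

theorem pauliOp_apply (p : κ → PauliString q) (F : (κ → Spin q) → V) (g : κ → Spin q) :
    pauliOp p F g = (∏ k, (p k).phase (g k + (p k).x)) • F (fun k => g k + (p k).x) := rfl

theorem pauliOp_mul_self (p : κ → PauliString q) :
    (pauliOp p : Module.End ℂ ((κ → Spin q) → V)) * pauliOp p = 1 := by
  refine LinearMap.ext fun F => funext fun g => ?_
  have h : (fun k => g k + (p k).x + (p k).x) = g := by
    funext k i
    simp only [Pi.add_apply]
    rw [add_assoc, CharTwo.add_self_eq_zero, add_zero]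
  rw [Module.End.mul_apply, pauliOp_apply, pauliOp_apply, smul_smul, h, ← Finset.prod_mul_distrib]
  rw [Finset.prod_eq_one, one_smul, Module.End.one_apply]
  intro k _
  rw [congrFun h k]
  exact (p k).phase_mul_phase (g k)

theorem pauliOp_pauliOp (p : κ → PauliString q) (F : (κ → Spin q) → V) :
    pauliOp p (pauliOp p F) = F := congrArg (fun A => A F) (pauliOp_mul_self p)

theorem pauliOp_comm (p p' : κ → PauliString q) :
    (pauliOp p : Module.End ℂ ((κ → Spin q) → V)) * pauliOp p' =
      sgn (∑ k, (p k).symp (p' k)) • (pauliOp p' * pauliOp p) := by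
  refine LinearMap.ext fun F => funext fun g => ?_
  have h : (fun k => g k + (p k).x + (p' k).x) = fun k => g k + (p' k).x + (p k).x := by
    funext k
    rw [add_right_comm]
  rw [LinearMap.smul_apply, Pi.smul_apply, Module.End.mul_apply, Module.End.mul_apply]
  simp only [pauliOp_apply, smul_smul]
  rw [h, sgn_sum, ← Finset.prod_mul_distrib, ← Finset.prod_mul_distrib, ← Finset.prod_mul_distrib]
  congr 1
  exact Finset.prod_congr rfl fun k _ => (p k).phase_comm (p' k) (g k)

theorem pauliOp_commute {p p' : κ → PauliString q} (h : ∑ k, (p k).symp (p' k) = 0) :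
    Commute (pauliOp p : Module.End ℂ ((κ → Spin q) → V)) (pauliOp p') := by
  have := pauliOp_comm (V := V) p p'
  rwa [h, sgn_zero, one_smul] at this

/-- The operators are involutions that commute up to a sign, and on a nonzero space the sign can be
read off. -/
theorem sum_symp_eq_zero_of_commute [Nontrivial V] {p p' : κ → PauliString q}
    (h : Commute (pauliOp p : Module.End ℂ ((κ → Spin q) → V)) (pauliOp p')) :
    ∑ k, (p k).symp (p' k) = 0 := by
  apply sgn_injective
  rw [sgn_zero]
  have h1 := pauliOp_comm (V := V) p p'
  rw [← h.eq] at h1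
  have h2 := congrArg (fun A => A * (pauliOp p' * pauliOp p)) h1
  simp only [smul_mul_assoc] at h2
  rw [show (pauliOp p : Module.End ℂ ((κ → Spin q) → V)) * pauliOp p' * (pauliOp p' * pauliOp p) = 1
    by rw [mul_assoc, ← mul_assoc (pauliOp p'), pauliOp_mul_self, one_mul, pauliOp_mul_self]] at h2
  obtain ⟨v, hv⟩ := exists_ne (0 : V)
  have h3 := congrFun (congrArg (fun A => A fun _ => v) h2) 0
  simp only [Module.End.one_apply, LinearMap.smul_apply, Pi.smul_apply] at h3
  have h4 : (1 - sgn (∑ k, (p k).symp (p' k))) • v = 0 := by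
    rw [sub_smul, one_smul, sub_eq_zero]; exact h3
  rcases smul_eq_zero.1 h4 with h5 | h5
  · exact (sub_eq_zero.1 h5).symm
  · exact absurd h5 hv

theorem pauliOp_one {p : κ → PauliString q} (h : ∀ k, p k = PauliString.one) :
    (pauliOp p : Module.End ℂ ((κ → Spin q) → V)) = 1 := by
  refine LinearMap.ext fun F => funext fun g => ?_
  simp [pauliOp_apply, h, PauliString.phase_one, PauliString.one_x]

theorem pauliOp_mul_of_disjoint {p p' p'' : κ → PauliString q}
    (h : ∀ k, (p k = PauliString.one ∧ p'' k = p' k) ∨ (p' k = PauliString.one ∧ p'' k = p k)) :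
    (pauliOp p : Module.End ℂ ((κ → Spin q) → V)) * pauliOp p' = pauliOp p'' := by
  refine LinearMap.ext fun F => funext fun g => ?_
  have h1 : (fun k => g k + (p k).x + (p' k).x) = fun k => g k + (p'' k).x := by
    funext k
    rcases h k with ⟨h1, h2⟩ | ⟨h1, h2⟩ <;> simp [h1, h2, PauliString.one_x]
  rw [Module.End.mul_apply]
  simp only [pauliOp_apply, smul_smul]
  rw [h1, ← Finset.prod_mul_distrib]
  congr 1
  refine Finset.prod_congr rfl fun k _ => ?_
  rcases h k with ⟨h1, h2⟩ | ⟨h1, h2⟩ <;>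
    simp [h1, h2, PauliString.one_x, PauliString.phase_one]

theorem pauliOp_map (p : κ → PauliString q) (f : V →ₗ[ℂ] W) (F : (κ → Spin q) → V) :
    pauliOp p (fun g => f (F g)) = fun g => f (pauliOp p F g) := by
  funext g
  simp [pauliOp_apply]

theorem pauliOp_mul_right {D : ℕ} (p : κ → PauliString q)
    (F : (κ → Spin q) → Matrix (Fin D) (Fin D) ℂ) (X : Matrix (Fin D) (Fin D) ℂ) :
    pauliOp p (fun g => F g * X) = fun g => pauliOp p F g * X :=
  pauliOp_map p (LinearMap.mulRight ℂ X) F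

theorem pauliOp_mul_left {D : ℕ} (p : κ → PauliString q)
    (F : (κ → Spin q) → Matrix (Fin D) (Fin D) ℂ) (X : Matrix (Fin D) (Fin D) ℂ) :
    pauliOp p (fun g => X * F g) = fun g => X * pauliOp p F g :=
  pauliOp_map p (LinearMap.mulLeft ℂ X) F

theorem pauliOp_trace_mul {D : ℕ} (p : κ → PauliString q)
    (F : (κ → Spin q) → Matrix (Fin D) (Fin D) ℂ) (X : Matrix (Fin D) (Fin D) ℂ) :
    pauliOp p (fun g => (F g * X).trace) = fun g => (pauliOp p F g * X).trace :=
  pauliOp_map p (Matrix.traceLinearMap (Fin D) ℂ ℂ ∘ₗ LinearMap.mulRight ℂ X) F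

theorem pauliOp_trace {D : ℕ} (p : κ → PauliString q)
    (F : (κ → Spin q) → Matrix (Fin D) (Fin D) ℂ) :
    pauliOp p (fun g => (F g).trace) = fun g => (pauliOp p F g).trace :=
  pauliOp_map p (Matrix.traceLinearMap (Fin D) ℂ ℂ) F

/-- Relabelling of the cells. -/
noncomputable def relabel {κ κ' : Type} (q : ℕ) (V : Type) [AddCommGroup V] [Module ℂ V] (e : κ ≃ κ') :
    ((κ → Spin q) → V) ≃ₗ[ℂ] ((κ' → Spin q) → V) :=
  LinearEquiv.funCongrLeft ℂ V (Equiv.arrowCongr e.symm (Equiv.refl (Spin q)))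

theorem relabel_apply {κ κ' : Type} (e : κ ≃ κ') (F : (κ → Spin q) → V) (g : κ' → Spin q) :
    relabel q V e F g = F (fun k => g (e k)) := rfl

theorem relabel_pauliOp (e : κ ≃ κ') (p : κ' → PauliString q) (F : (κ → Spin q) → V) :
    relabel q V e (pauliOp (fun k => p (e k)) F) = pauliOp p (relabel q V e F) := by
  funext g
  rw [relabel_apply, pauliOp_apply, pauliOp_apply, relabel_apply]
  congr 1
  exact e.prod_comp fun k => (p k).phase (g k + (p k).x)

end PauliOp

end StabMPS

/-! ### Truncated terms on chains, rings opened into chains -/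

namespace StabMPS

namespace Code

variable {q m : ℕ} (C : Code q m)

/-- An upper bound for the ranges of the interactions. -/
def maxRange : ℕ := Finset.univ.sup C.P

theorem P_le_maxRange (α : Fin m) : C.P α ≤ C.maxRange := Finset.le_sup (Finset.mem_univ α)

theorem pos_pos (c : C.Cut) : 0 < C.pos c := Nat.succ_pos _

theorem pos_lt (c : C.Cut) : C.pos c < C.P c.1 := by
  have := c.2.2
  simp only [pos]
  omega

/-- The term of type `α` starting at the cell `a` of an infinite chain, as a Pauli string. -/
def stringAt (α : Fin m) (a k : ℤ) : PauliString q :=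
  if 0 ≤ k - a ∧ k - a < C.P α then C.o α (k - a).toNat else PauliString.one

theorem stringAt_add (α : Fin m) (a k b : ℤ) :
    C.stringAt α (a + b) (k + b) = C.stringAt α a k := by
  rw [stringAt, stringAt, add_sub_add_right_eq_sub]

theorem stringAt_of_lt {α : Fin m} {a k : ℤ} (h : k < a) :
    C.stringAt α a k = PauliString.one := by
  rw [stringAt, if_neg]; omega

theorem stringAt_of_le {α : Fin m} {a k : ℤ} (h : a + C.P α ≤ k) :
    C.stringAt α a k = PauliString.one := by
  rw [stringAt, if_neg]; omega

theorem stringAt_of_mem {α : Fin m} {a k : ℤ} {j : ℕ} (h : k - a = j) (hj : j < C.P α) :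
    C.stringAt α a k = C.o α j := by
  rw [stringAt, if_pos (by omega), h, Int.toNat_natCast]

/-- The restriction to the cells `0, …, n - 1` of the term of type `α` starting at the cell `a`. -/
noncomputable def chainOp {V : Type} [AddCommGroup V] [Module ℂ V] (n : ℕ) (α : Fin m) (a : ℤ) :
    Module.End ℂ ((Fin n → Spin q) → V) :=
  pauliOp fun k : Fin n => C.stringAt α a (k : ℤ)

section ChainOp

variable {V : Type} [AddCommGroup V] [Module ℂ V] {n : ℕ}

theorem chainOp_mul_self (α : Fin m) (a : ℤ) :
    (C.chainOp n α a : Module.End ℂ ((Fin n → Spin q) → V)) * C.chainOp n α a = 1 :=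
  pauliOp_mul_self _

theorem chainOp_chainOp (α : Fin m) (a : ℤ) (F : (Fin n → Spin q) → V) :
    C.chainOp n α a (C.chainOp n α a F) = F := pauliOp_pauliOp _ F

theorem chainOp_of_add_le {α : Fin m} {a : ℤ} (h : a + C.P α ≤ 0) :
    (C.chainOp n α a : Module.End ℂ ((Fin n → Spin q) → V)) = 1 :=
  pauliOp_one fun k => C.stringAt_of_le (by omega)

theorem chainOp_of_le {α : Fin m} {a : ℤ} (h : (n : ℤ) ≤ a) :
    (C.chainOp n α a : Module.End ℂ ((Fin n → Spin q) → V)) = 1 :=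
  pauliOp_one fun k => C.stringAt_of_lt (by omega)

/-- The number modulo 2 of cells among `0, …, n - 1` in which two terms anticommute. -/
def overlap (n : ℕ) (α : Fin m) (a : ℤ) (β : Fin m) (b : ℤ) : ZMod 2 :=
  ∑ k : Fin n, (C.stringAt α a (k : ℤ)).symp (C.stringAt β b (k : ℤ))

theorem chainOp_comm (α β : Fin m) (a b : ℤ) :
    (C.chainOp n α a : Module.End ℂ ((Fin n → Spin q) → V)) * C.chainOp n β b =
      sgn (C.overlap n α a β b) • (C.chainOp n β b * C.chainOp n α a) :=
  pauliOp_comm _ _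

theorem chainOp_commute {α β : Fin m} {a b : ℤ} (h : C.overlap n α a β b = 0) :
    Commute (C.chainOp n α a : Module.End ℂ ((Fin n → Spin q) → V)) (C.chainOp n β b) :=
  pauliOp_commute h

theorem overlap_comm (α β : Fin m) (a b : ℤ) :
    C.overlap n α a β b = C.overlap n β b α a :=
  Finset.sum_congr rfl fun _ _ => PauliString.symp_comm _ _

theorem overlap_eq_zero {α β : Fin m} {a b : ℤ} (h : ∀ k : ℕ, k < n →
    C.stringAt α a k = PauliString.one ∨ C.stringAt β b k = PauliString.one) :
    C.overlap n α a β b = 0 :=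
  Finset.sum_eq_zero fun k _ => by
    rcases h k k.2 with h | h
    · rw [h, PauliString.symp_one_left]
    · rw [h, PauliString.symp_one_right]

theorem overlap_add (n k : ℕ) (α β : Fin m) (a b : ℤ) :
    C.overlap (n + k) α a β b = C.overlap n α a β b + C.overlap k α (a - n) β (b - n) := by
  rw [overlap, Fin.sum_univ_add]
  congr 1
  refine Finset.sum_congr rfl fun i _ => ?_
  rw [← C.stringAt_add α (a - n) i n, ← C.stringAt_add β (b - n) i n]
  simp [add_comm]

theorem overlap_left (c d : C.Cut) (hn : C.maxRange ≤ n) :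
    C.overlap n c.1 (n - C.pos c) d.1 (n - C.pos d) = C.tMatrix c d := by
  have hc := (C.pos_lt c).trans_le ((C.P_le_maxRange c.1).trans hn)
  have hd := (C.pos_lt d).trans_le ((C.P_le_maxRange d.1).trans hn)
  have hc' := C.pos_lt c
  have hd' := C.pos_lt d
  -- The reflection `k ↦ n - 1 - k` counts cells leftwards from the bond, as `tMatrix` does.
  rw [overlap, Fin.sum_univ_eq_sum_range (fun k => (C.stringAt c.1 (n - C.pos c) (k : ℤ)).symp
    (C.stringAt d.1 (n - C.pos d) (k : ℤ))), ← Finset.sum_range_reflect, tMatrix]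
  symm
  apply Finset.sum_subset_zero_on_sdiff
  · intro k hk
    simp only [Finset.mem_range, lt_min_iff] at hk ⊢
    omega
  · intro k hk
    simp only [Finset.mem_sdiff, Finset.mem_range, lt_min_iff, not_and_or, not_lt] at hk
    rcases hk.2 with h | h
    · rw [C.stringAt_of_lt (by omega), PauliString.symp_one_left]
    · rw [C.stringAt_of_lt (α := d.1) (by omega), PauliString.symp_one_right]
  · intro k hk
    simp only [Finset.mem_range, lt_min_iff] at hk
    rw [C.stringAt_of_mem (j := C.pos c - 1 - k) (by omega) (by omega),
      C.stringAt_of_mem (j := C.pos d - 1 - k) (by omega) (by omega)]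

/-- For `2 * C.maxRange ≤ n` the pieces at the two ends have disjoint supports. -/
theorem overlap_left_right (c d : C.Cut) (hn : 2 * C.maxRange ≤ n) :
    C.overlap n c.1 (n - C.pos c) d.1 (-C.pos d) = 0 := by
  have hc := C.pos_lt c
  have hc' := C.P_le_maxRange c.1
  have hd' := C.P_le_maxRange d.1
  refine C.overlap_eq_zero fun k hk => ?_
  rcases lt_or_ge k C.maxRange with h | h
  · left; exact C.stringAt_of_lt (by omega)
  · right; exact C.stringAt_of_le (by omega)

end ChainOp

section Ring

variable (L : ℕ) [NeZero L]

/-- The labelling of the cells of a ring by `0, …, L - 1`, starting at the cell `s`. -/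
noncomputable def ringLabel (s : ZMod L) : ZMod L ≃ Fin L where
  toFun x := ⟨(x - s).val, ZMod.val_lt _⟩
  invFun k := s + (k : ℕ)
  left_inv x := by simp
  right_inv k := by
    ext
    simp [ZMod.val_natCast, Nat.mod_eq_of_lt k.2]

theorem val_add_eq_ite (x y : ZMod L) :
    (x + y).val = if x.val + y.val < L then x.val + y.val else x.val + y.val - L := by
  have hx := ZMod.val_lt x
  have hy := ZMod.val_lt y
  rw [ZMod.val_add]
  split_ifs with h
  · exact Nat.mod_eq_of_lt h
  · rw [Nat.mod_eq_sub_mod (by omega), Nat.mod_eq_of_lt (by omega)]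

theorem relabel_seg {α : Fin m} {a b : ℕ} {r s : ZMod L} {p : Fin L → PauliString q}
    (h : ∀ x : ZMod L, p (ringLabel L s x) =
      if a ≤ (x - r).val ∧ (x - r).val < b then C.o α (x - r).val else PauliString.one)
    (ψ : Hilb q L) :
    relabel q ℂ (ringLabel L s) (C.seg L α a b r ψ) =
      pauliOp p (relabel q ℂ (ringLabel L s) ψ) := by
  rw [← relabel_pauliOp, seg]
  simp only [h]

/-- Labelling from `r + 1` opens the ring at the bond: the left part becomes a term truncated by the
right end of the chain and, symmetrically, the right part one truncated by the left end. -/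
theorem relabel_leftOp (hL : C.maxRange ≤ L) (c : C.Cut) (r : ZMod L) (ψ : Hilb q L) :
    relabel q ℂ (ringLabel L (r + 1)) (C.leftOp L c r ψ) =
      C.chainOp L c.1 (L - C.pos c) (relabel q ℂ (ringLabel L (r + 1)) ψ) := by
  have hc := C.pos_lt c
  have hc' := (C.P_le_maxRange c.1).trans hL
  refine C.relabel_seg L (fun x => ?_) ψ
  have e : x - (r - (C.pos c : ZMod L) + 1) = (x - (r + 1)) + (C.pos c : ZMod L) := by ring
  have hv : (C.pos c : ZMod L).val = C.pos c := ZMod.val_cast_of_lt (by omega)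
  have hx := ZMod.val_lt (x - (r + 1))
  rw [e, val_add_eq_ite, hv]
  simp only [ringLabel, Equiv.coe_fn_mk]
  generalize (x - (r + 1)).val = k at hx
  by_cases h : k + C.pos c < L
  · rw [if_pos h, if_neg (by omega), C.stringAt_of_lt (by omega)]
  · rw [if_neg h, if_pos (by omega),
      C.stringAt_of_mem (j := k + C.pos c - L) (by omega) (by omega)]

theorem relabel_rightOp (hL : C.maxRange ≤ L) (c : C.Cut) (r : ZMod L) (ψ : Hilb q L) :
    relabel q ℂ (ringLabel L (r + 1)) (C.rightOp L c r ψ) =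
      C.chainOp L c.1 (-C.pos c) (relabel q ℂ (ringLabel L (r + 1)) ψ) := by
  have hc := C.pos_lt c
  have hc' := (C.P_le_maxRange c.1).trans hL
  refine C.relabel_seg L (fun x => ?_) ψ
  have e : x - (r - (C.pos c : ZMod L) + 1) = (x - (r + 1)) + (C.pos c : ZMod L) := by ring
  have hv : (C.pos c : ZMod L).val = C.pos c := ZMod.val_cast_of_lt (by omega)
  have hx := ZMod.val_lt (x - (r + 1))
  rw [e, val_add_eq_ite, hv]
  simp only [ringLabel, Equiv.coe_fn_mk]
  generalize (x - (r + 1)).val = k at hx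
  by_cases h : k + C.pos c < L
  · rw [if_pos h]
    by_cases h' : k + C.pos c < C.P c.1
    · rw [if_pos (by omega), C.stringAt_of_mem (by omega) h']
    · rw [if_neg (by omega), C.stringAt_of_le (by omega)]
  · rw [if_neg h, if_neg (by omega), C.stringAt_of_le (by omega)]

/-- A term wrapping around the seam shows up as two truncated terms, starting at `r` and at `r - L`;
if it does not wrap around, the second one is trivial. -/
theorem relabel_term (hL : C.maxRange ≤ L) (α : Fin m) (r : ZMod L) (ψ : Hilb q L) :
    relabel q ℂ (ringLabel L 0) (C.term L α r ψ) =
      C.chainOp L α r.val (C.chainOp L α (r.val - L) (relabel q ℂ (ringLabel L 0) ψ)) := by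
  have hα := (C.P_le_maxRange α).trans hL
  have hr := ZMod.val_lt r
  rw [← Module.End.mul_apply]
  refine (C.relabel_seg L (p := fun k => if (k : ℕ) < r.val then C.stringAt α (r.val - L) k else
    C.stringAt α r.val k) (fun x => ?_) ψ).trans ?_
  · have hx := ZMod.val_lt x
    have hv : (x - r).val = if r.val ≤ x.val then x.val - r.val else x.val + L - r.val := by
      have h1 := val_add_eq_ite L (x - r) r
      have h2 := ZMod.val_lt (x - r)
      rw [sub_add_cancel] at h1
      split_ifs at h1 ⊢ <;> omega
    simp only [ringLabel, Equiv.coe_fn_mk, sub_zero]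
    rw [hv]
    generalize x.val = k at hx
    generalize r.val = ρ at hr
    by_cases h : k < ρ
    · rw [if_pos h, if_neg (show ¬ρ ≤ k by omega)]
      by_cases h' : k + L - ρ < C.P α
      · rw [if_pos ⟨Nat.zero_le _, h'⟩, C.stringAt_of_mem (by omega) h']
      · rw [if_neg fun hh => h' hh.2, C.stringAt_of_le (by omega)]
    · rw [if_neg h, if_pos (show ρ ≤ k by omega)]
      by_cases h' : k - ρ < C.P α
      · rw [if_pos ⟨Nat.zero_le _, h'⟩, C.stringAt_of_mem (by omega) h']
      · rw [if_neg fun hh => h' hh.2, C.stringAt_of_le (by omega)]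
  · congr 1
    symm
    refine pauliOp_mul_of_disjoint fun k => ?_
    by_cases h : (k : ℕ) < r.val
    · left
      exact ⟨C.stringAt_of_lt (by omega), if_pos h⟩
    · right
      exact ⟨C.stringAt_of_le (by omega), if_neg h⟩

/-- The stabilizer condition on a ring of `n` cells labelled by `0, …, n - 1`. -/
def RingFixed (n : ℕ) (φ : (Fin n → Spin q) → ℂ) : Prop :=
  ∀ (α : Fin m) (a : ℕ), a < n → C.chainOp n α a (C.chainOp n α (a - n) φ) = φ

theorem isGroundState_iff (hL : C.maxRange ≤ L) (ψ : Hilb q L) :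
    C.IsGroundState L ψ ↔ relabel q ℂ (ringLabel L 0) ψ ≠ 0 ∧
      C.RingFixed L (relabel q ℂ (ringLabel L 0) ψ) := by
  rw [IsGroundState, (relabel q ℂ (ringLabel L 0)).map_ne_zero_iff]
  refine and_congr_right fun _ => ⟨fun h α a ha => ?_, fun h α r => ?_⟩
  · have := C.relabel_term L hL α (a : ZMod L) ψ
    rw [h, ZMod.val_cast_of_lt ha] at this
    exact this.symm
  · apply (relabel q ℂ (ringLabel L 0)).injective
    rw [C.relabel_term L hL, h α r.val (ZMod.val_lt r)]

/-- There is exactly one state, up to scalars, satisfying the stabilizer condition. -/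
def UniqueFixed (n : ℕ) : Prop :=
  ∃ ψ : (Fin n → Spin q) → ℂ, ψ ≠ 0 ∧ C.RingFixed n ψ ∧
    ∀ φ, C.RingFixed n φ → ∃ z : ℂ, φ = z • ψ

/-- Every stabilized state has energy `-(L * m)`, and so does the ground state; hence all of them
lie in the one-dimensional eigenspace. -/
theorem HasUniqueGroundState.uniqueFixed {C : Code q m} {L : ℕ} [NeZero L] (hL : C.maxRange ≤ L)
    (h : C.HasUniqueGroundState L) : C.UniqueFixed L := by
  obtain ⟨E, -, h1, h2⟩ := h
  obtain ⟨⟨ψ, hψE⟩, hψ0, hψ⟩ := finrank_eq_one_iff'.1 h1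
  have hψ0' : ψ ≠ 0 := fun h => hψ0 (Subtype.ext h)
  have hgs : C.IsGroundState L ψ := ⟨hψ0', h2 ψ hψE⟩
  have henergy : ∀ φ : Hilb q L, (∀ α r, C.term L α r φ = φ) →
      C.hamiltonian L φ = (-(L * m : ℂ)) • φ := by
    intro φ hφ
    simp only [hamiltonian, LinearMap.neg_apply, LinearMap.sum_apply, hφ]
    simp [← Nat.cast_smul_eq_nsmul ℂ, smul_smul]
  have hE : (E : ℂ) = -(L * m : ℂ) := by
    have e1 := henergy ψ hgs.2
    rw [Module.End.mem_eigenspace_iff.1 hψE] at e1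
    exact smul_left_injective ℂ hψ0' e1
  refine ⟨relabel q ℂ (ringLabel L 0) ψ, ((C.isGroundState_iff L hL ψ).1 hgs).1,
    ((C.isGroundState_iff L hL ψ).1 hgs).2, fun φ hφ => ?_⟩
  by_cases hφ0 : φ = 0
  · exact ⟨0, by simp [hφ0]⟩
  obtain ⟨φ', rfl⟩ := (relabel q ℂ (ringLabel L 0)).surjective φ
  have hg := (C.isGroundState_iff L hL φ').2 ⟨hφ0, hφ⟩
  obtain ⟨z, hz⟩ := hψ ⟨φ', Module.End.mem_eigenspace_iff.2 (by rw [henergy φ' hg.2, hE])⟩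
  refine ⟨z, ?_⟩
  rw [← map_smul]
  exact congrArg _ (congrArg Subtype.val hz).symm

/-- In the bulk of a chain the terms commute with all (truncated) terms. -/
theorem overlap_eq_zero_of_bulk {C : Code q m}
    (hcomm : ∀ᶠ L : ℕ in atTop, ∀ [NeZero L], C.Commuting L)
    {n : ℕ} {α : Fin m} {a : ℤ} (ha : 0 ≤ a) (han : a + C.P α ≤ n) (β : Fin m) (b : ℤ) :
    C.overlap n α a β b = 0 := by
  obtain ⟨L₀, hL₀⟩ := eventually_atTop.1 hcomm
  have hβ := C.P_le_maxRange β
  have hα := C.P_le_maxRange α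
  by_cases hb : b + C.P β ≤ 0 ∨ n ≤ b
  · refine C.overlap_eq_zero fun k hk => Or.inr ?_
    rcases hb with hb | hb
    · exact C.stringAt_of_le (by omega)
    · exact C.stringAt_of_lt (by omega)
  push Not at hb
  set M := C.maxRange with hM
  -- Padding the chain by at least `M` cells on both sides completes the truncated terms without
  -- wrapping, in a ring long enough for the terms to commute.
  have hLpos : NeZero (M + n + (M + L₀ + 1)) := ⟨by omega⟩
  have hc := hL₀ (M + n + (M + L₀ + 1)) (by omega) α β ((a + M).toNat : ℕ) ((b + M).toNat : ℕ)
  set L := M + n + (M + L₀ + 1) with hL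
  have key : ∀ (γ : Fin m) (d : ℤ), 0 ≤ d + M → d + M + C.P γ ≤ L → ∀ ψ : Hilb q L,
      relabel q ℂ (ringLabel L 0) (C.term L γ ((d + M).toNat : ℕ) ψ) =
        C.chainOp L γ (d + M) (relabel q ℂ (ringLabel L 0) ψ) := by
    intro γ d h1 h2 ψ
    have hγ := C.P_pos γ
    have e : (((d + M).toNat : ℕ) : ZMod L).val = (d + M).toNat := ZMod.val_cast_of_lt (by omega)
    rw [C.relabel_term L (by omega), e, Int.toNat_of_nonneg h1,
      C.chainOp_of_add_le (a := d + M - L) (by omega), Module.End.one_apply]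
  have hc' : Commute (C.chainOp L α (a + M) : Module.End ℂ ((Fin L → Spin q) → ℂ))
      (C.chainOp L β (b + M)) := by
    refine LinearMap.ext fun φ => ?_
    obtain ⟨ψ, rfl⟩ := (relabel q ℂ (ringLabel L 0)).surjective φ
    rw [Module.End.mul_apply, Module.End.mul_apply, ← key β b (by omega) (by omega),
      ← key α a (by omega) (by omega), ← key α a (by omega) (by omega),
      ← key β b (by omega) (by omega), ← Module.End.mul_apply, ← Module.End.mul_apply, hc.eq]
  have h0 : C.overlap L α (a + M) β (b + M) = 0 := sum_symp_eq_zero_of_commute hc'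
  -- The term of type `α` lives in the middle `n` cells, so the padding contributes nothing.
  rw [hL, C.overlap_add, C.overlap_add] at h0
  rw [C.overlap_eq_zero (n := M) fun k hk => Or.inl (C.stringAt_of_lt (by omega)),
    C.overlap_eq_zero (n := M + L₀ + 1) fun k hk => Or.inl (C.stringAt_of_le (by push_cast; omega)),
    add_zero, zero_add] at h0
  simpa using h0

/-- Two complete terms across the middle bond of `n + n` cells commute, so their overlaps on the two
sides of the bond agree modulo 2. -/
theorem overlap_right {C : Code q m} (hcomm : ∀ᶠ L : ℕ in atTop, ∀ [NeZero L], C.Commuting L)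
    {n : ℕ} (c d : C.Cut) (hn : C.maxRange ≤ n) :
    C.overlap n c.1 (-C.pos c) d.1 (-C.pos d) = C.tMatrix c d := by
  have hc := C.pos_lt c
  have hc' := C.P_le_maxRange c.1
  have h := overlap_eq_zero_of_bulk hcomm (n := n + n) (α := c.1) (a := n - C.pos c)
    (by omega) (by push_cast; omega) d.1 (n - C.pos d)
  rw [C.overlap_add, C.overlap_left c d hn, sub_sub_cancel_left, sub_sub_cancel_left] at h
  exact (CharTwo.add_eq_zero.1 h).symm

theorem tMatrix_comm (c d : C.Cut) : C.tMatrix c d = C.tMatrix d c := by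
  rw [← C.overlap_left c d le_rfl, ← C.overlap_left d c le_rfl, overlap_comm]

theorem tMatrix_self (c : C.Cut) : C.tMatrix c c = 0 :=
  Finset.sum_eq_zero fun _ _ => PauliString.symp_self _

theorem cliffordRel_chainOp_left {n : ℕ} (hn : C.maxRange ≤ n) :
    CliffordRel C.tMatrix fun c : C.Cut =>
      (C.chainOp n c.1 (n - C.pos c) : Module.End ℂ ((Fin n → Spin q) → ℂ)) :=
  (cliffordRel_iff _ _).2 fun c d => by rw [chainOp_comm, C.overlap_left c d hn]

theorem cliffordRel_chainOp_right {C : Code q m}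
    (hcomm : ∀ᶠ L : ℕ in atTop, ∀ [NeZero L], C.Commuting L) {n : ℕ} (hn : C.maxRange ≤ n) :
    CliffordRel C.tMatrix fun c : C.Cut =>
      (C.chainOp n c.1 (-C.pos c) : Module.End ℂ ((Fin n → Spin q) → ℂ)) :=
  (cliffordRel_iff _ _).2 fun c d => by rw [chainOp_comm, overlap_right hcomm c d hn]

theorem cliffordRel_leftOp (hL : C.maxRange ≤ L) (r : ZMod L) :
    CliffordRel C.tMatrix fun c => C.leftOp L c r := by
  refine (cliffordRel_iff _ _).2 fun c d => LinearMap.ext fun ψ => ?_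
  apply (relabel q ℂ (ringLabel L (r + 1))).injective
  have := (cliffordRel_iff _ _).1 (C.cliffordRel_chainOp_left hL) c d
  simp only [Module.End.mul_apply, LinearMap.smul_apply, map_smul, C.relabel_leftOp L hL]
  exact congrArg (fun A => A (relabel q ℂ (ringLabel L (r + 1)) ψ)) this

theorem cliffordRel_rightOp {C : Code q m} {L : ℕ} [NeZero L]
    (hcomm : ∀ᶠ L : ℕ in atTop, ∀ [NeZero L], C.Commuting L) (hL : C.maxRange ≤ L) (r : ZMod L) :
    CliffordRel C.tMatrix fun c => C.rightOp L c r := by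
  refine (cliffordRel_iff _ _).2 fun c d => LinearMap.ext fun ψ => ?_
  apply (relabel q ℂ (ringLabel L (r + 1))).injective
  have := (cliffordRel_iff _ _).1 (cliffordRel_chainOp_right hcomm hL) c d
  simp only [Module.End.mul_apply, LinearMap.smul_apply, map_smul, C.relabel_rightOp L hL]
  exact congrArg (fun A => A (relabel q ℂ (ringLabel L (r + 1)) ψ)) this

end Ring

end Code

end StabMPS

/-! ### Families of matrices on which truncated terms act by virtual operators -/

namespace StabMPS

/-- The concatenation of two families of matrices indexed by configurations of consecutive
intervals. -/
noncomputable def cat {q D n k N : ℕ} (h : n + k = N)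
    (Φ : (Fin n → Spin q) → Matrix (Fin D) (Fin D) ℂ)
    (Ψ : (Fin k → Spin q) → Matrix (Fin D) (Fin D) ℂ) (g : Fin N → Spin q) :
    Matrix (Fin D) (Fin D) ℂ :=
  Φ (fun i => g ⟨i, by omega⟩) * Ψ (fun i => g ⟨n + i, by omega⟩)

namespace Code

variable {q m : ℕ} (C : Code q m)

theorem chainOp_cat {D n k N : ℕ} (h : n + k = N)
    (Φ : (Fin n → Spin q) → Matrix (Fin D) (Fin D) ℂ)
    (Ψ : (Fin k → Spin q) → Matrix (Fin D) (Fin D) ℂ) (α : Fin m) (a : ℤ) :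
    C.chainOp N α a (cat h Φ Ψ) = cat h (C.chainOp n α a Φ) (C.chainOp k α (a - n) Ψ) := by
  subst h
  have e : ∀ i : Fin k, C.stringAt α (a - n) (i : ℤ) = C.stringAt α a ((n + i : ℕ) : ℤ) := by
    intro i
    rw [← C.stringAt_add α (a - n) i n]
    simp [add_comm]
  funext g
  simp only [cat, chainOp, pauliOp_apply, Fin.prod_univ_add, smul_mul_smul_comm, e]
  rfl

/-- The cut of a term of type `α` at position `p`. -/
theorem exists_cut {α : Fin m} {p : ℤ} (h0 : 0 < p) (h1 : p < C.P α) :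
    ∃ c : C.Cut, c.1 = α ∧ (C.pos c : ℤ) = p :=
  ⟨⟨α, ⟨(p - 1).toNat, by omega⟩⟩, rfl, by simp only [pos]; omega⟩

/-- The position of a term relative to an interval of `n` cells: outside of it, inside of it, cut at
the left end, or cut at the right end. -/
theorem position_cases (n : ℕ) (α : Fin m) (a : ℤ) :
    (a + C.P α ≤ 0 ∨ n ≤ a) ∨ (0 ≤ a ∧ a + C.P α ≤ n) ∨
      (∃ c : C.Cut, c.1 = α ∧ a = -C.pos c) ∨ ∃ c : C.Cut, c.1 = α ∧ a = n - C.pos c := by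
  have hα := C.P_le_maxRange α
  by_cases h1 : a + C.P α ≤ 0 ∨ n ≤ a
  · exact Or.inl h1
  by_cases h2 : 0 ≤ a ∧ a + C.P α ≤ n
  · exact Or.inr (Or.inl h2)
  right; right
  by_cases h3 : a < 0
  · left
    obtain ⟨c, hc, hp⟩ := C.exists_cut (α := α) (p := -a) (by omega) (by omega)
    exact ⟨c, hc, by omega⟩
  · right
    obtain ⟨c, hc, hp⟩ := C.exists_cut (α := α) (p := n - a) (by omega) (by omega)
    exact ⟨c, hc, by omega⟩

section Virtual

variable {D : ℕ}

/-- The virtual operator at the position `p` of a term of type `α`, which is trivial if the bond at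
the position `p` does not cut the term. -/
noncomputable def virt (U : C.Cut → Matrix (Fin D) (Fin D) ℂ) (α : Fin m) (p : ℤ) :
    Matrix (Fin D) (Fin D) ℂ :=
  if h : 0 < p ∧ p < C.P α then U ⟨α, ⟨(p - 1).toNat, by omega⟩⟩ else 1

variable {C} {U : C.Cut → Matrix (Fin D) (Fin D) ℂ}

theorem virt_of_nonpos {α : Fin m} {p : ℤ} (h : p ≤ 0) : C.virt U α p = 1 := by
  rw [virt, dif_neg]; omega

theorem virt_of_le {α : Fin m} {p : ℤ} (h : C.P α ≤ p) : C.virt U α p = 1 := by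
  rw [virt, dif_neg]; omega

theorem virt_pos (c : C.Cut) : C.virt U c.1 (C.pos c) = U c := by
  have h := C.pos_lt c
  have h0 := C.pos_pos c
  rw [virt, dif_pos (by omega)]
  congr 1
  rcases c with ⟨α, i⟩
  simp only [pos, Sigma.mk.injEq, heq_eq_eq, true_and]
  ext
  simp

theorem virt_mul_self (hU : ∀ c, U c * U c = 1) (α : Fin m) (p : ℤ) :
    C.virt U α p * C.virt U α p = 1 := by
  rw [virt]
  split_ifs with h
  · exact hU _
  · exact one_mul 1

variable (C U) in
/-- The (truncated) terms of the Hamiltonian act on the physical indices of `Φ` as the virtual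
operators at the two ends. -/
def Good (n : ℕ) (Φ : (Fin n → Spin q) → Matrix (Fin D) (Fin D) ℂ) : Prop :=
  ∀ (α : Fin m) (a : ℤ), C.chainOp n α a Φ =
    fun g => C.virt U α (-a) * Φ g * C.virt U α (n - a)

/-- Since `C.maxRange ≤ n`, a term cut at one end does not reach beyond the other, so at most one of
the two virtual operators is nontrivial. -/
theorem good_of_cuts {n : ℕ} (hn : C.maxRange ≤ n)
    {Φ : (Fin n → Spin q) → Matrix (Fin D) (Fin D) ℂ}
    (hbulk : ∀ (α : Fin m) (a : ℤ), 0 ≤ a → a + C.P α ≤ n → C.chainOp n α a Φ = Φ)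
    (hleft : ∀ c : C.Cut, C.chainOp n c.1 (-C.pos c) Φ = fun g => U c * Φ g)
    (hright : ∀ c : C.Cut, C.chainOp n c.1 (n - C.pos c) Φ = fun g => Φ g * U c) :
    C.Good U n Φ := by
  intro α a
  have hα := C.P_le_maxRange α
  have hα0 := C.P_pos α
  rcases C.position_cases n α a with (h | h) | ⟨h, h'⟩ | ⟨c, rfl, rfl⟩ | ⟨c, rfl, rfl⟩
  · rw [C.chainOp_of_add_le h, virt_of_le (by omega), virt_of_le (by omega)]
    simp
  · rw [C.chainOp_of_le h, virt_of_nonpos (by omega), virt_of_nonpos (by omega)]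
    simp
  · rw [hbulk α a h h', virt_of_nonpos (by omega), virt_of_le (by omega)]
    simp
  · rw [hleft, neg_neg, virt_pos, virt_of_le (by omega)]
    simp
  · have := C.pos_lt c
    rw [hright, sub_sub_cancel, virt_pos, virt_of_nonpos (by omega)]
    simp

namespace Good

theorem bulk {n : ℕ} {Φ : (Fin n → Spin q) → Matrix (Fin D) (Fin D) ℂ} (h : C.Good U n Φ)
    (α : Fin m) (a : ℤ) (ha : 0 ≤ a) (ha' : a + C.P α ≤ n) : C.chainOp n α a Φ = Φ := by
  rw [h α a, virt_of_nonpos (by omega), virt_of_le (by omega)]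
  simp

theorem left {n : ℕ} {Φ : (Fin n → Spin q) → Matrix (Fin D) (Fin D) ℂ} (h : C.Good U n Φ)
    (c : C.Cut) (hn : C.P c.1 ≤ n + C.pos c) : C.chainOp n c.1 (-C.pos c) Φ = fun g => U c * Φ g := by
  rw [h, neg_neg, virt_pos, virt_of_le (by omega)]
  simp

theorem right {n : ℕ} {Φ : (Fin n → Spin q) → Matrix (Fin D) (Fin D) ℂ} (h : C.Good U n Φ)
    (c : C.Cut) (hn : C.pos c ≤ n) :
    C.chainOp n c.1 (n - C.pos c) Φ = fun g => Φ g * U c := by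
  rw [h, sub_sub_cancel, virt_pos, virt_of_nonpos (by omega)]
  simp

theorem smul {n : ℕ} {Φ : (Fin n → Spin q) → Matrix (Fin D) (Fin D) ℂ} (h : C.Good U n Φ)
    (z : ℂ) : C.Good U n (z • Φ) := by
  intro α a
  rw [map_smul, h α a]
  funext g
  simp

theorem sub {n : ℕ} {Φ Ψ : (Fin n → Spin q) → Matrix (Fin D) (Fin D) ℂ} (h : C.Good U n Φ)
    (h' : C.Good U n Ψ) : C.Good U n (Φ - Ψ) := by
  intro α a
  rw [map_sub, h α a, h' α a]
  funext g
  simp [mul_sub, sub_mul]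

/-- A term across the junction produces the same virtual operator from both sides, and `U c * U c =
1` removes the pair. -/
theorem cat (hU : ∀ c, U c * U c = 1) {n k N : ℕ} (hN : n + k = N)
    {Φ : (Fin n → Spin q) → Matrix (Fin D) (Fin D) ℂ}
    {Ψ : (Fin k → Spin q) → Matrix (Fin D) (Fin D) ℂ} (h : C.Good U n Φ) (h' : C.Good U k Ψ) :
    C.Good U N (StabMPS.cat hN Φ Ψ) := by
  intro α a
  rw [C.chainOp_cat, h α a, h' α (a - n)]
  funext g
  have e : -(a - n : ℤ) = n - a := by ring
  have e' : (k : ℤ) - (a - n) = N - a := by rw [← hN]; push_cast; ring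
  simp only [StabMPS.cat, e, e']
  calc _ = C.virt U α (-a) * Φ (fun i => g ⟨i, by omega⟩) *
        (C.virt U α (n - a) * C.virt U α (n - a)) * Ψ (fun i => g ⟨n + i, by omega⟩) *
          C.virt U α (N - a) := by simp only [mul_assoc]
    _ = _ := by rw [virt_mul_self hU]; simp only [mul_assoc, mul_one]

/-- A term across the seam produces `U c` at both ends; cyclicity of the trace brings them together
and they cancel. -/
theorem ringFixed_trace (hU : ∀ c, U c * U c = 1) {n : ℕ} (hn : C.maxRange ≤ n)
    {Φ : (Fin n → Spin q) → Matrix (Fin D) (Fin D) ℂ} (h : C.Good U n Φ) :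
    C.RingFixed n fun g => (Φ g).trace := by
  intro α a ha
  have hα := C.P_le_maxRange α
  rw [chainOp, chainOp, pauliOp_trace, pauliOp_trace]
  have e1 : pauliOp (fun k : Fin n => C.stringAt α (a - n) (k : ℤ)) Φ =
      fun g => C.virt U α (n - a) * Φ g := by
    have := h α (a - n)
    rw [virt_of_le (p := n - (a - n)) (by omega), show -((a : ℤ) - n) = n - a by ring] at this
    simp only [mul_one] at this
    exact this
  have e2 : pauliOp (fun k : Fin n => C.stringAt α a (k : ℤ)) Φ =
      fun g => Φ g * C.virt U α (n - a) := by
    have := h α a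
    rw [virt_of_nonpos (p := -(a : ℤ)) (by omega)] at this
    simp only [one_mul] at this
    exact this
  rw [e1, pauliOp_mul_left, e2]
  funext g
  rw [Matrix.trace_mul_comm, mul_assoc, virt_mul_self hU, mul_one]

end Good

end Virtual

/-- The algebra homomorphism from the free algebra on the cuts to the operators on `n` cells, given
by the action of the cut terms at the right end. -/
noncomputable def evalRight (n : ℕ) :
    FreeAlgebra ℂ C.Cut →ₐ[ℂ] Module.End ℂ ((Fin n → Spin q) → ℂ) :=
  FreeAlgebra.lift ℂ fun c : C.Cut => C.chainOp n c.1 (n - C.pos c)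

theorem evalRight_ι (n : ℕ) (c : C.Cut) :
    C.evalRight n (FreeAlgebra.ι ℂ c) = C.chainOp n c.1 (n - C.pos c) :=
  FreeAlgebra.lift_ι_apply _ _

theorem evalRight_commute {n : ℕ} {A : Module.End ℂ ((Fin n → Spin q) → ℂ)}
    (h : ∀ c : C.Cut, Commute A (C.chainOp n c.1 (n - C.pos c))) (x : FreeAlgebra ℂ C.Cut) :
    Commute A (C.evalRight n x) := by
  induction x using FreeAlgebra.induction with
  | grade0 r => rw [AlgHom.commutes]; exact Algebra.commute_algebraMap_right r A
  | grade1 c => rw [evalRight_ι]; exact h c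
  | mul a b ha hb => rw [map_mul]; exact ha.mul_right hb
  | add a b ha hb => rw [map_add]; exact ha.add_right hb

section Trace

variable {D : ℕ} {C} {U : C.Cut → Matrix (Fin D) (Fin D) ℂ}

theorem lift_surjective (hU : Algebra.adjoin ℂ (Set.range U) = ⊤) :
    Function.Surjective (FreeAlgebra.lift ℂ U) := by
  rw [← AlgHom.range_eq_top, ← hU, Algebra.adjoin_range_eq_range_freeAlgebra_lift]

/-- A physical operator inserts its `U c` directly behind `Φ`, in front of earlier insertions, so
the order of products is preserved. The arbitrary `Y` carries the induction. -/
theorem Good.evalRight_trace {n : ℕ} (hn : C.maxRange ≤ n)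
    {Φ : (Fin n → Spin q) → Matrix (Fin D) (Fin D) ℂ} (h : C.Good U n Φ)
    (x : FreeAlgebra ℂ C.Cut) (Y : Matrix (Fin D) (Fin D) ℂ) :
    C.evalRight n x (fun g => (Φ g * Y).trace) =
      fun g => (Φ g * (FreeAlgebra.lift ℂ U x * Y)).trace := by
  induction x using FreeAlgebra.induction generalizing Y with
  | grade0 r =>
    rw [AlgHom.commutes, AlgHom.commutes]
    funext g
    simp [Algebra.algebraMap_eq_smul_one]
  | grade1 c =>
    have hc := (C.pos_lt c).le.trans ((C.P_le_maxRange c.1).trans hn)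
    rw [evalRight_ι, chainOp, pauliOp_trace_mul]
    have := h.right c hc
    rw [chainOp] at this
    simp only [this, FreeAlgebra.lift_ι_apply, mul_assoc]
  | mul a b ha hb => rw [map_mul, Module.End.mul_apply, hb, ha, map_mul, mul_assoc]
  | add a b ha hb =>
    rw [map_add, LinearMap.add_apply, ha, hb, map_add]
    funext g
    simp [add_mul, mul_add]

/-- Physical operators can insert any matrix `X` at the seam, so the trace state determines all `tr
(Φ g * X)`. -/
theorem Good.eq_zero_of_trace_eq_zero (hU : Algebra.adjoin ℂ (Set.range U) = ⊤) {n : ℕ}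
    (hn : C.maxRange ≤ n) {Φ : (Fin n → Spin q) → Matrix (Fin D) (Fin D) ℂ} (h : C.Good U n Φ)
    (h0 : ∀ g, (Φ g).trace = 0) : Φ = 0 := by
  funext g
  refine Matrix.ext_iff_trace_mul_right.2 fun X => ?_
  obtain ⟨x, rfl⟩ := lift_surjective hU X
  have := congrFun (h.evalRight_trace hn x 1) g
  simp only [mul_one] at this
  rw [← this, show (fun g => (Φ g).trace) = 0 from funext h0]
  simp

/-- Multiplication by `U c` on either side is a Pauli operator on the physical indices, which
permutes and rescales the values of `Φ`. Their span is thus a nonzero two-sided ideal of a simple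
algebra. -/
theorem Good.span_eq_top (hU : Algebra.adjoin ℂ (Set.range U) = ⊤) {n : ℕ}
    (hn : C.maxRange ≤ n) {Φ : (Fin n → Spin q) → Matrix (Fin D) (Fin D) ℂ} (h : C.Good U n Φ)
    (h0 : Φ ≠ 0) : Submodule.span ℂ (Set.range Φ) = ⊤ := by
  classical
  set J := Submodule.span ℂ (Set.range Φ) with hJ
  have hop : ∀ (p : Fin n → PauliString q) g, pauliOp p Φ g ∈ J := fun p g =>
    Submodule.smul_mem _ _ (Submodule.subset_span ⟨_, rfl⟩)
  have hgen : ∀ x : Matrix (Fin D) (Fin D) ℂ, ∀ y ∈ J, x * y ∈ J ∧ y * x ∈ J := by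
    intro x
    have hx : x ∈ Algebra.adjoin ℂ (Set.range U) := hU ▸ Algebra.mem_top
    induction hx using Algebra.adjoin_induction with
    | mem x hx =>
      obtain ⟨c, rfl⟩ := hx
      have hc := (C.P_le_maxRange c.1).trans hn
      have hc' := C.pos_lt c
      intro y hy
      induction hy using Submodule.span_induction with
      | mem y hy =>
        obtain ⟨g, rfl⟩ := hy
        have h1 := congrFun (h.left c (by omega)) g
        have h2 := congrFun (h.right c (by omega)) g
        rw [← h1, ← h2]
        exact ⟨hop _ g, hop _ g⟩
      | zero => simp
      | add x y _ _ hx hy =>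
        rw [mul_add, add_mul]; exact ⟨add_mem hx.1 hy.1, add_mem hx.2 hy.2⟩
      | smul c x _ hx =>
        rw [mul_smul_comm, smul_mul_assoc]
        exact ⟨Submodule.smul_mem _ _ hx.1, Submodule.smul_mem _ _ hx.2⟩
    | algebraMap c =>
      intro y hy
      rw [← Algebra.commutes, ← Algebra.smul_def]
      exact ⟨Submodule.smul_mem _ _ hy, Submodule.smul_mem _ _ hy⟩
    | add a b _ _ ha hb =>
      intro y hy
      rw [add_mul, mul_add]
      exact ⟨add_mem (ha y hy).1 (hb y hy).1, add_mem (ha y hy).2 (hb y hy).2⟩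
    | mul a b _ _ ha hb =>
      intro y hy
      rw [mul_assoc, ← mul_assoc y]
      exact ⟨(ha _ (hb y hy).1).1, (hb _ (ha y hy).2).2⟩
  obtain ⟨g, hg⟩ := Function.ne_iff.1 h0
  obtain ⟨i, j, hij⟩ : ∃ i j, Φ g i j ≠ 0 := by
    by_contra! hcon
    exact hg (Matrix.ext hcon)
  have hsingle : ∀ a b, Matrix.single a b (1 : ℂ) ∈ J := by
    intro a b
    have h1 : Matrix.single a i (1 : ℂ) * Φ g * Matrix.single j b 1 = Φ g i j • Matrix.single a b 1 := by
      simp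
    have h2 : Matrix.single a i (1 : ℂ) * Φ g * Matrix.single j b 1 ∈ J :=
      (hgen _ _ (hgen _ _ (Submodule.subset_span ⟨g, rfl⟩)).1).2
    rw [h1] at h2
    exact (Submodule.smul_mem_iff _ hij).1 h2
  refine eq_top_iff.2 fun X _ => ?_
  rw [Matrix.matrix_eq_sum_single X]
  refine Submodule.sum_mem _ fun a _ => Submodule.sum_mem _ fun b _ => ?_
  have := Submodule.smul_mem J (X a b) (hsingle a b)
  simpa using this

/-- Good families of matrices are unique up to scalars. -/
theorem Good.exists_eq_smul (hUU : ∀ c, U c * U c = 1) (hU : Algebra.adjoin ℂ (Set.range U) = ⊤)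
    {n : ℕ} (hn : C.maxRange ≤ n) (huniq : C.UniqueFixed n)
    {Φ Ψ : (Fin n → Spin q) → Matrix (Fin D) (Fin D) ℂ} (h : C.Good U n Φ) (h' : C.Good U n Ψ)
    (h0 : Φ ≠ 0) : ∃ z : ℂ, Ψ = z • Φ := by
  obtain ⟨ψ, -, -, hψ⟩ := huniq
  obtain ⟨y, hy⟩ := hψ _ (h.ringFixed_trace hUU hn)
  obtain ⟨z, hz⟩ := hψ _ (h'.ringFixed_trace hUU hn)
  have hy0 : y ≠ 0 := by
    rintro rfl
    exact h0 (h.eq_zero_of_trace_eq_zero hU hn fun g => by simpa using congrFun hy g)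
  -- The good family `Ψ - (z / y) • Φ` has vanishing trace.
  refine ⟨z / y, sub_eq_zero.1 ((h'.sub (h.smul (z / y))).eq_zero_of_trace_eq_zero hU hn fun g => ?_)⟩
  have h1 := congrFun hy g
  have h2 := congrFun hz g
  simp only [Pi.smul_apply, smul_eq_mul] at h1 h2
  simp only [Pi.sub_apply, Pi.smul_apply, Matrix.trace_sub, Matrix.trace_smul, h1, h2, smul_eq_mul]
  field_simp
  ring

/-- The elements of the free algebra annihilating the trace of a good family are those vanishing on
the virtual operators. -/
theorem Good.evalRight_eq_zero_iff (hU : Algebra.adjoin ℂ (Set.range U) = ⊤) {n : ℕ}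
    (hn : C.maxRange ≤ n) {Φ : (Fin n → Spin q) → Matrix (Fin D) (Fin D) ℂ} (h : C.Good U n Φ)
    (h0 : Φ ≠ 0) (x : FreeAlgebra ℂ C.Cut) :
    C.evalRight n x (fun g => (Φ g).trace) = 0 ↔ FreeAlgebra.lift ℂ U x = 0 := by
  have key := h.evalRight_trace hn x 1
  simp only [mul_one] at key
  rw [key]
  refine ⟨fun hx => Matrix.ext_iff_trace_mul_left.2 fun X => ?_, fun hx => ?_⟩
  · have hX : X ∈ Submodule.span ℂ (Set.range Φ) := h.span_eq_top hU hn h0 ▸ Submodule.mem_top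
    rw [mul_zero, Matrix.trace_zero]
    induction hX using Submodule.span_induction with
    | mem y hy => obtain ⟨g, rfl⟩ := hy; exact congrFun hx g
    | zero => simp
    | add x y _ _ hx hy => rw [add_mul, Matrix.trace_add, hx, hy, add_zero]
    | smul c x _ hx => rw [smul_mul_assoc, Matrix.trace_smul, hx, smul_zero]
  · funext g; simp [hx]

end Trace

end Code

end StabMPS

/-! ### From the unique ground state to irreducible virtual operators -/

namespace StabMPS

theorem PauliString.star_phase {q : ℕ} (p : PauliString q) (g : Spin q) :
    star (p.phase g) = p.phase (g + p.x) := by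
  have h1 := p.phase_mul_phase g
  have h2 : star (p.phase g) * p.phase g = 1 := by
    rw [Complex.star_def, ← Complex.normSq_eq_conj_mul_self, Complex.normSq_eq_norm_sq, p.norm_phase]
    norm_num
  exact mul_right_cancel₀ (p.phase_ne_zero g) (h2.trans h1.symm)

section Shift

variable {q : ℕ} {κ : Type}

theorem shift_shift (p : κ → PauliString q) (g : κ → Spin q) :
    (fun k => g k + (p k).x + (p k).x) = g := by
  funext k i
  simp only [Pi.add_apply]
  rw [add_assoc, CharTwo.add_self_eq_zero, add_zero]

/-- The permutation of the configurations underlying a Pauli operator. -/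
def shift (p : κ → PauliString q) : (κ → Spin q) ≃ (κ → Spin q) where
  toFun g := fun k => g k + (p k).x
  invFun g := fun k => g k + (p k).x
  left_inv g := shift_shift p g
  right_inv g := shift_shift p g

theorem shift_apply (p : κ → PauliString q) (g : κ → Spin q) :
    shift p g = fun k => g k + (p k).x := rfl

end Shift

section Orthogonal

variable {q : ℕ} {κ : Type} [Fintype κ]

theorem sum_star_pauliOp_mul (p : κ → PauliString q) (F G : (κ → Spin q) → ℂ) [DecidableEq κ] :
    ∑ g, star (pauliOp p F g) * G g = ∑ g, star (F g) * pauliOp p G g := by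
  rw [← (shift p).sum_comp fun g => star (F g) * pauliOp p G g]
  refine Finset.sum_congr rfl fun g _ => ?_
  have h := fun k => congrFun (shift_shift p g) k
  simp only [shift_apply, pauliOp_apply, smul_eq_mul, star_mul', star_prod, PauliString.star_phase, h]
  ring

/-- Every subspace has a complement that is invariant under all the Pauli operators that preserve
the subspace. -/
theorem exists_invariant_complement (W : Submodule ℂ ((κ → Spin q) → ℂ)) :
    ∃ W' : Submodule ℂ ((κ → Spin q) → ℂ), (∀ φ, ∃ w ∈ W, ∃ w' ∈ W', φ = w + w') ∧
      (∀ φ ∈ W, φ ∈ W' → φ = 0) ∧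
      ∀ p : κ → PauliString q, (∀ w ∈ W, pauliOp p w ∈ W) → ∀ w ∈ W', pauliOp p w ∈ W' := by
  classical
  let e := WithLp.linearEquiv 2 ℂ ((κ → Spin q) → ℂ)
  let K : Submodule ℂ (EuclideanSpace ℂ (κ → Spin q)) := W.comap e.toLinearMap
  have hinner : ∀ x y : EuclideanSpace ℂ (κ → Spin q),
      inner ℂ x y = ∑ g, star (e x g) * e y g := by
    intro x y
    rw [PiLp.inner_apply]
    exact Finset.sum_congr rfl fun g _ => by simp [e, mul_comm]
  -- The orthogonal complement works because Pauli operators are self-adjoint.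
  refine ⟨Kᗮ.comap e.symm.toLinearMap, fun φ => ?_, fun φ h h' => ?_, fun p hp w hw => ?_⟩
  · obtain ⟨y, hy, z, hz, hyz⟩ := K.exists_add_mem_mem_orthogonal (e.symm φ)
    refine ⟨e y, hy, e z, ?_, ?_⟩
    · simpa using hz
    · rw [← map_add, ← hyz, LinearEquiv.apply_symm_apply]
  · have h1 : e.symm φ ∈ K := by simpa [K] using h
    have := Submodule.inner_right_of_mem_orthogonal h1 h'
    have h2 : e.symm φ = 0 := inner_self_eq_zero.1 this
    simpa using h2
  · change _ ∈ Kᗮ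
    rw [Submodule.mem_orthogonal]
    intro u hu
    have h3 : e.symm (pauliOp p (e u)) ∈ K := by simpa [K] using hp _ hu
    have h4 : inner ℂ (e.symm (pauliOp p (e u))) (e.symm w) = 0 :=
      Submodule.inner_right_of_mem_orthogonal h3 hw
    rw [hinner] at h4 ⊢
    simp only [LinearEquiv.apply_symm_apply] at h4
    rw [sum_star_pauliOp_mul] at h4
    simpa using h4

end Orthogonal

namespace Code

variable {q m : ℕ} {C : Code q m}

theorem RingFixed.bulk {n : ℕ} {ψ : (Fin n → Spin q) → ℂ} (h : C.RingFixed n ψ) (α : Fin m)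
    (a : ℤ) (ha : 0 ≤ a) (ha' : a + C.P α ≤ n) : C.chainOp n α a ψ = ψ := by
  have hα := C.P_pos α
  obtain ⟨b, rfl⟩ := Int.eq_ofNat_of_zero_le ha
  have := h α b (by omega)
  rwa [C.chainOp_of_add_le (a := b - n) (by omega), Module.End.one_apply] at this

/-- The two pieces of the term across the seam are involutions whose product fixes `ψ`. -/
theorem RingFixed.left_eq_right {n : ℕ} (hn : C.maxRange ≤ n) {ψ : (Fin n → Spin q) → ℂ}
    (h : C.RingFixed n ψ) (c : C.Cut) :
    C.chainOp n c.1 (-C.pos c) ψ = C.chainOp n c.1 (n - C.pos c) ψ := by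
  have hc := C.pos_lt c
  have hc0 := C.pos_pos c
  have hc' := C.P_le_maxRange c.1
  have := h c.1 (n - C.pos c) (by omega)
  rw [Nat.cast_sub (by omega), sub_sub_cancel_left] at this
  calc _ = C.chainOp n c.1 (n - C.pos c) (C.chainOp n c.1 (n - C.pos c)
        (C.chainOp n c.1 (-C.pos c) ψ)) := by rw [chainOp_chainOp]
    _ = _ := by rw [this]

theorem bulk_commute (hcomm : ∀ᶠ L : ℕ in atTop, ∀ [NeZero L], C.Commuting L)
    {n : ℕ} {α : Fin m} {a : ℤ} (ha : 0 ≤ a) (han : a + C.P α ≤ n) (β : Fin m) (b : ℤ) :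
    Commute (C.chainOp n α a : Module.End ℂ ((Fin n → Spin q) → ℂ)) (C.chainOp n β b) :=
  C.chainOp_commute (overlap_eq_zero_of_bulk hcomm ha han β b)

/-- A ground state annihilated by all relations between the virtual operators is the trace of a good
family of matrices. -/
theorem exists_good_of_relations
    (hcomm : ∀ᶠ L : ℕ in atTop, ∀ [NeZero L], C.Commuting L)
    {D n : ℕ} (hn : 2 * C.maxRange ≤ n)
    {U : C.Cut → Matrix (Fin D) (Fin D) ℂ}
    (hU : Algebra.adjoin ℂ (Set.range U) = ⊤) {ψ : (Fin n → Spin q) → ℂ} (hψ : C.RingFixed n ψ)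
    (hrel : ∀ x, FreeAlgebra.lift ℂ U x = 0 → C.evalRight n x ψ = 0) :
    ∃ Φ, C.Good U n Φ ∧ ∀ g, (Φ g).trace = ψ g := by
  classical
  have hsurj := lift_surjective hU
  let s := Function.surjInv hsurj
  have hs : ∀ X, FreeAlgebra.lift ℂ U (s X) = X := Function.surjInv_eq hsurj
  -- By `hrel`, the action of a matrix on `ψ` does not depend on the chosen preimage in the free
  -- algebra.
  have hind : ∀ x y, FreeAlgebra.lift ℂ U x = FreeAlgebra.lift ℂ U y →
      C.evalRight n x ψ = C.evalRight n y ψ := by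
    intro x y hxy
    rw [← sub_eq_zero, ← LinearMap.sub_apply, ← map_sub]
    exact hrel _ (by rw [map_sub, hxy, sub_self])
  let f : Matrix (Fin D) (Fin D) ℂ →ₗ[ℂ] ((Fin n → Spin q) → ℂ) :=
    { toFun := fun X => C.evalRight n (s X) ψ
      map_add' := fun X Y => by
        rw [← LinearMap.add_apply, ← map_add]
        exact hind _ _ (by rw [map_add, hs, hs, hs])
      map_smul' := fun z X => by
        rw [RingHom.id_apply, ← LinearMap.smul_apply, ← map_smul]
        exact hind _ _ (by rw [map_smul, hs, hs]) }
  have hf : ∀ x, f (FreeAlgebra.lift ℂ U x) = C.evalRight n x ψ := fun x => hind _ _ (hs _)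
  -- `Φ` represents `f` under the pairing `tr (Φ g * X)`, which explains the swapped indices.
  let Φ : (Fin n → Spin q) → Matrix (Fin D) (Fin D) ℂ := fun g =>
    Matrix.of fun i j => f (Matrix.single j i 1) g
  have hΦ : ∀ X, (fun g => (Φ g * X).trace) = f X := by
    intro X
    funext g
    conv_rhs => rw [Matrix.matrix_eq_sum_single X]
    simp only [map_sum, Finset.sum_apply, Matrix.trace, Matrix.diag_apply, Matrix.mul_apply]
    rw [Finset.sum_comm]
    refine Finset.sum_congr rfl fun i _ => Finset.sum_congr rfl fun j _ => ?_
    have : Matrix.single i j (X i j) = X i j • Matrix.single i j (1 : ℂ) := by simp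
    rw [this, map_smul, Pi.smul_apply, smul_eq_mul, mul_comm]
    rfl
  have hext : ∀ (A : (Fin n → Spin q) → Matrix (Fin D) (Fin D) ℂ) (α : Fin m) (a : ℤ),
      (∀ x, C.chainOp n α a (C.evalRight n x ψ) =
        fun g => (A g * FreeAlgebra.lift ℂ U x).trace) → C.chainOp n α a Φ = A := by
    intro A α a h
    funext g
    refine Matrix.ext_iff_trace_mul_right.2 fun X => ?_
    obtain ⟨x, rfl⟩ := hsurj X
    have h1 := congrFun (pauliOp_trace_mul (fun k : Fin n => C.stringAt α a (k : ℤ)) Φ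
      (FreeAlgebra.lift ℂ U x)) g
    rw [hΦ, hf] at h1
    exact h1.symm.trans (congrFun (h x) g)
  refine ⟨Φ, good_of_cuts (by omega) (fun α a h1 h2 => hext _ _ _ fun x => ?_)
    (fun c => hext _ _ _ fun x => ?_) (fun c => hext _ _ _ fun x => ?_), fun g => ?_⟩
  · have := C.evalRight_commute (fun c => bulk_commute hcomm h1 h2 c.1 (n - C.pos c)) x
    rw [hΦ, hf, ← Module.End.mul_apply, this.eq, Module.End.mul_apply, hψ.bulk α a h1 h2]
  -- The left piece commutes past `x`, acts on `ψ` as the right piece, and cyclicity of the trace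
  -- carries the resulting `U c` to the front of `Φ`.
  · have := C.evalRight_commute (fun d => (C.chainOp_commute (C.overlap_left_right d c hn)).symm) x
    rw [← Module.End.mul_apply, this.eq, Module.End.mul_apply, hψ.left_eq_right (by omega),
      ← evalRight_ι, ← Module.End.mul_apply, ← map_mul, ← hf, ← hΦ, map_mul, FreeAlgebra.lift_ι_apply]
    funext g
    rw [← mul_assoc, Matrix.trace_mul_comm, ← mul_assoc]
  · rw [← evalRight_ι, ← Module.End.mul_apply, ← map_mul, ← hf, ← hΦ, map_mul,
      FreeAlgebra.lift_ι_apply]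
    simp only [mul_assoc]
  · have := congrFun (hΦ 1) g
    simp only [mul_one] at this
    rw [this, ← map_one (FreeAlgebra.lift ℂ U), hf, map_one, Module.End.one_apply]

/-- On a long ring with a unique ground state there are irreducible virtual operators whose
relations annihilate the ground state. -/
theorem exists_virtual_relations
    (hcomm : ∀ᶠ L : ℕ in atTop, ∀ [NeZero L], C.Commuting L)
    {n : ℕ} (hn : 2 * C.maxRange ≤ n) {ψ : (Fin n → Spin q) → ℂ}
    (hψ0 : ψ ≠ 0) (hψ : C.RingFixed n ψ) (huniq : ∀ φ, C.RingFixed n φ → ∃ z : ℂ, φ = z • ψ) :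
    ∃ (D : ℕ) (U : C.Cut → (Matrix (Fin D) (Fin D) ℂ)ˣ), IsIrreducible U ∧
      IsCliffordRep C.tMatrix U ∧ (∀ c, (U c : Matrix (Fin D) (Fin D) ℂ) * U c = 1) ∧
      ∀ x, FreeAlgebra.lift ℂ (fun c => (U c : Matrix (Fin D) (Fin D) ℂ)) x = 0 →
        C.evalRight n x ψ = 0 := by
  -- The module generated by `ψ` under the right-end operators.
  let W₀ : Submodule ℂ ((Fin n → Spin q) → ℂ) :=
    LinearMap.range ((LinearMap.applyₗ ψ).comp (C.evalRight n).toLinearMap)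
  have hW₀ : ∀ x, C.evalRight n x ψ ∈ W₀ := fun x => ⟨x, rfl⟩
  obtain ⟨D, U, j, hirr, hUU, hj, hjW, hjU⟩ := exists_irreducible_intertwiner
    (fun c : C.Cut => (C.chainOp n c.1 (n - C.pos c) : Module.End ℂ ((Fin n → Spin q) → ℂ)))
    (fun c => C.chainOp_mul_self _ _) W₀
    (fun h => hψ0 (by
      have := hW₀ 1
      rwa [h, Submodule.mem_bot, map_one, Module.End.one_apply] at this))
    (by
      rintro c _ ⟨x, rfl⟩
      refine ⟨FreeAlgebra.ι ℂ c * x, ?_⟩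
      simp only [LinearMap.comp_apply, AlgHom.toLinearMap_apply, map_mul, evalRight_ι]
      rfl)
  have hjx : ∀ x v, C.evalRight n x (j v) =
      j ((FreeAlgebra.lift ℂ (fun c => (U c : Matrix (Fin D) (Fin D) ℂ)) x).mulVec v) := by
    intro x
    induction x using FreeAlgebra.induction with
    | grade0 r =>
      intro v
      rw [AlgHom.commutes, AlgHom.commutes]
      simp [Algebra.algebraMap_eq_smul_one, Matrix.smul_mulVec]
    | grade1 c => intro v; rw [evalRight_ι, FreeAlgebra.lift_ι_apply]; exact hjU c v
    | mul a b ha hb =>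
      intro v
      rw [map_mul, Module.End.mul_apply, hb, ha, map_mul, Matrix.mulVec_mulVec]
    | add a b ha hb =>
      intro v
      rw [map_add, LinearMap.add_apply, ha, hb, map_add, Matrix.add_mulVec, map_add]
  refine ⟨D, U, hirr, ?_, hUU, ?_⟩
  · refine (cliffordRel_iff _ _).2 fun c d => Matrix.ext_of_mulVec_single fun i => hj ?_
    have := (cliffordRel_iff _ _).1 (C.cliffordRel_chainOp_left (n := n) (by omega)) c d
    have := congrArg (fun A => A (j (Pi.single i 1))) this
    simp only [Module.End.mul_apply, LinearMap.smul_apply, hjU] at this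
    rw [← Matrix.mulVec_mulVec, Matrix.smul_mulVec, ← Matrix.mulVec_mulVec, map_smul]
    exact this
  -- The bulk-fixed states on which every relation of `U` holds. Right-end operators preserve `W`
  -- because the relations form an ideal, left-end ones because they commute with the right end.
  let W : Submodule ℂ ((Fin n → Spin q) → ℂ) :=
    { carrier := {φ | (∀ (α : Fin m) (a : ℤ), 0 ≤ a → a + C.P α ≤ n → C.chainOp n α a φ = φ) ∧
        ∀ x, FreeAlgebra.lift ℂ (fun c => (U c : Matrix (Fin D) (Fin D) ℂ)) x = 0 →
          C.evalRight n x φ = 0}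
      add_mem' := fun h h' => ⟨fun α a h1 h2 => by rw [map_add, h.1 α a h1 h2, h'.1 α a h1 h2],
        fun x hx => by rw [map_add, h.2 x hx, h'.2 x hx, add_zero]⟩
      zero_mem' := by simp
      smul_mem' := fun z φ h => ⟨fun α a h1 h2 => by rw [map_smul, h.1 α a h1 h2],
        fun x hx => by rw [map_smul, h.2 x hx, smul_zero]⟩ }
  have hjmem : ∀ v, j v ∈ W := by
    refine fun v => ⟨fun α a h1 h2 => ?_, fun x hx => by rw [hjx, hx]; simp⟩
    obtain ⟨x, hx⟩ := hjW v
    have := C.evalRight_commute (fun c => bulk_commute hcomm h1 h2 c.1 (n - C.pos c)) x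
    rw [← hx]
    change C.chainOp n α a (C.evalRight n x ψ) = C.evalRight n x ψ
    rw [← Module.End.mul_apply, this.eq, Module.End.mul_apply, hψ.bulk α a h1 h2]
  have hWinv : ∀ (β : Fin m) (b : ℤ), ∀ φ ∈ W, C.chainOp n β b φ ∈ W := by
    intro β b φ hφ
    have hbulk : ∀ (α : Fin m) (a : ℤ), 0 ≤ a → a + C.P α ≤ n →
        C.chainOp n α a (C.chainOp n β b φ) = C.chainOp n β b φ := fun α a h1 h2 => by
      rw [← Module.End.mul_apply, (bulk_commute hcomm h1 h2 β b).eq, Module.End.mul_apply,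
        hφ.1 α a h1 h2]
    rcases C.position_cases n β b with (h | h) | ⟨h, h'⟩ | ⟨c, rfl, rfl⟩ | ⟨c, rfl, rfl⟩
    · rwa [C.chainOp_of_add_le h]
    · rwa [C.chainOp_of_le h]
    · rwa [hφ.1 β b h h']
    · refine ⟨hbulk, fun x hx => ?_⟩
      have := C.evalRight_commute
        (fun d => (C.chainOp_commute (C.overlap_left_right d c hn)).symm) x
      rw [← Module.End.mul_apply, ← this.eq, Module.End.mul_apply, hφ.2 x hx, map_zero]
    · refine ⟨hbulk, fun x hx => ?_⟩
      rw [← evalRight_ι, ← Module.End.mul_apply, ← map_mul]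
      exact hφ.2 _ (by rw [map_mul, hx, zero_mul])
  obtain ⟨W', hadd, hdisj, hinv⟩ := exists_invariant_complement W
  have hW'inv : ∀ (β : Fin m) (b : ℤ), ∀ φ ∈ W', C.chainOp n β b φ ∈ W' := fun β b =>
    hinv _ (hWinv β b)
  -- Ring terms preserve both summands, so the component `w` is itself stabilized and hence a
  -- multiple of `ψ`.
  obtain ⟨w, hw, w', hw', hww⟩ := hadd ψ
  have hwfix : C.RingFixed n w := by
    intro α a ha
    have h1 := hψ α a ha
    rw [hww, map_add, map_add] at h1
    have h2 : C.chainOp n α a (C.chainOp n α (a - n) w) - w =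
        w' - C.chainOp n α a (C.chainOp n α (a - n) w') := by
      rw [sub_eq_sub_iff_add_eq_add, h1, add_comm]
    refine sub_eq_zero.1 (hdisj _ (sub_mem (hWinv _ _ _ (hWinv _ _ _ hw)) hw) ?_)
    rw [h2]
    exact sub_mem hw' (hW'inv _ _ _ (hW'inv _ _ _ hw'))
  obtain ⟨z, hz⟩ := huniq w hwfix
  have hψW : ψ ∈ W := by
    -- If `w` vanished, the module generated by `ψ` would lie in `W'`, and the irreducible module in
    -- `W ∩ W' = 0`.
    by_cases hz0 : z = 0
    · exfalso
      have hψ' : ψ ∈ W' := by rwa [hww, hz, hz0, zero_smul, zero_add]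
      have hx : ∀ x, ∀ φ ∈ W', C.evalRight n x φ ∈ W' := by
        intro x
        induction x using FreeAlgebra.induction with
        | grade0 r =>
          intro φ hφ
          rw [AlgHom.commutes, Module.algebraMap_end_apply]
          exact W'.smul_mem r hφ
        | grade1 c => rw [evalRight_ι]; exact hW'inv _ _
        | mul a b ha hb => intro φ hφ; rw [map_mul]; exact ha _ (hb _ hφ)
        | add a b ha hb => intro φ hφ; rw [map_add]; exact add_mem (ha _ hφ) (hb _ hφ)
      have h0 : ∀ v, j v = 0 := fun v => hdisj _ (hjmem v) (by
        obtain ⟨x, hx'⟩ := hjW v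
        rw [← hx']
        exact hx x ψ hψ')
      have h1 : (fun _ => 1 : Fin D → ℂ) = 0 := hj (by rw [h0, map_zero])
      exact one_ne_zero (congrFun h1 ⟨0, hirr.1⟩)
    · have : ψ = z⁻¹ • w := by rw [hz, smul_smul, inv_mul_cancel₀ hz0, one_smul]
      rw [this]
      exact W.smul_mem _ hw
  exact hψW.2

end Code

end StabMPS

/-! ### From good families to a tensor independent of the length -/

namespace StabMPS

section Cat

variable {q D : ℕ}

theorem cat_assoc {n₁ n₂ n₃ n₁₂ n₂₃ N : ℕ} (h₁₂ : n₁ + n₂ = n₁₂) (h : n₁₂ + n₃ = N)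
    (h₂₃ : n₂ + n₃ = n₂₃) (h' : n₁ + n₂₃ = N)
    (A : (Fin n₁ → Spin q) → Matrix (Fin D) (Fin D) ℂ)
    (B : (Fin n₂ → Spin q) → Matrix (Fin D) (Fin D) ℂ)
    (E : (Fin n₃ → Spin q) → Matrix (Fin D) (Fin D) ℂ) :
    cat h (cat h₁₂ A B) E = cat h' A (cat h₂₃ B E) := by
  subst h₁₂ h₂₃ h
  funext g
  simp only [cat, mul_assoc, add_assoc]

theorem smul_cat {n k N : ℕ} (h : n + k = N) (z : ℂ)
    (A : (Fin n → Spin q) → Matrix (Fin D) (Fin D) ℂ)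
    (B : (Fin k → Spin q) → Matrix (Fin D) (Fin D) ℂ) :
    cat h (z • A) B = z • cat h A B := by
  funext g
  simp [cat]

theorem cat_smul {n k N : ℕ} (h : n + k = N) (z : ℂ)
    (A : (Fin n → Spin q) → Matrix (Fin D) (Fin D) ℂ)
    (B : (Fin k → Spin q) → Matrix (Fin D) (Fin D) ℂ) :
    cat h A (z • B) = z • cat h A B := by
  funext g
  simp [cat]

theorem cat_append {n k : ℕ} (A : (Fin n → Spin q) → Matrix (Fin D) (Fin D) ℂ)
    (B : (Fin k → Spin q) → Matrix (Fin D) (Fin D) ℂ) (g : Fin n → Spin q) (h : Fin k → Spin q) :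
    cat rfl A B (Fin.append g h) = A g * B h := by
  rw [cat]
  congr 2
  · funext i; exact Fin.append_left g h i
  · funext i; exact Fin.append_right g h i

theorem exists_sum_smul_eq_one {κ : Type} [Finite κ] {A : κ → Matrix (Fin D) (Fin D) ℂ}
    (h : Submodule.span ℂ (Set.range A) = ⊤) :
    ∃ (_ : Fintype κ) (a : κ → ℂ), ∑ g, a g • A g = 1 := by
  have := Fintype.ofFinite κ
  exact ⟨this, (Submodule.mem_span_range_iff_exists_fun ℂ).1 (h ▸ Submodule.mem_top)⟩

theorem cat_ne_zero {n k N : ℕ} (h : n + k = N)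
    {A : (Fin n → Spin q) → Matrix (Fin D) (Fin D) ℂ}
    {B : (Fin k → Spin q) → Matrix (Fin D) (Fin D) ℂ} (hA : A ≠ 0)
    (hB : Submodule.span ℂ (Set.range B) = ⊤) : cat h A B ≠ 0 := by
  subst h
  intro h0
  apply hA
  funext g
  obtain ⟨_, a, ha⟩ := exists_sum_smul_eq_one hB
  rw [← mul_one (A g), ← ha, Finset.mul_sum]
  refine Finset.sum_eq_zero fun u _ => ?_
  rw [mul_smul_comm, ← cat_append A B g u, h0]
  simp

end Cat

namespace Tensor

variable {q D : ℕ} (T : Tensor q D)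

theorem block_add {n k N : ℕ} (h : n + k = N) : T.block N = cat h (T.block n) (T.block k) := by
  subst h
  funext g
  have : (fun i => T (g i)) = Fin.append (fun i : Fin n => T (g ⟨i, by omega⟩))
      (fun i : Fin k => T (g ⟨n + i, by omega⟩)) := by
    rw [← Fin.append_castAdd_natAdd (f := fun i => T (g i))]
    rfl
  rw [block, this, List.ofFn_fin_append, List.prod_append]
  rfl

theorem block_zero (g : Fin 0 → Spin q) : T.block 0 g = 1 := by simp [block]

theorem block_one (g : Fin 1 → Spin q) : T.block 1 g = T (g 0) := by simp [block]

theorem relabel_mps (L : ℕ) [NeZero L] :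
    relabel q ℂ (Code.ringLabel L 0) (T.mps L) = fun g => (T.block L g).trace := by
  funext g
  rw [relabel_apply, mps, block]
  simp only [bind_pure_comp, List.map_eq_map, List.map_map]
  congr 2
  apply List.ext_getElem
  · simp
  · intro i h1 h2
    simp only [List.length_map, List.length_range] at h1
    simp only [List.getElem_map, List.getElem_range, List.getElem_ofFn, Function.comp_apply]
    congr 2
    ext
    simp [Code.ringLabel, ZMod.val_natCast, Nat.mod_eq_of_lt h1]

end Tensor

namespace Code

variable {q m : ℕ} {C : Code q m}

theorem eventually_uniqueFixed
    (huniq : ∀ᶠ L : ℕ in atTop, ∀ [NeZero L], C.HasUniqueGroundState L) :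
    ∀ᶠ n : ℕ in atTop, C.UniqueFixed n := by
  filter_upwards [huniq, eventually_ge_atTop C.maxRange, eventually_gt_atTop 0] with n h1 h2 h3
  have : NeZero n := ⟨h3.ne'⟩
  exact HasUniqueGroundState.uniqueFixed h2 h1

/-- Brings good families of different lengths to a common multiple. -/
theorem Good.exists_pow {D n : ℕ} (hn : C.maxRange ≤ n)
    {U : C.Cut → Matrix (Fin D) (Fin D) ℂ} (hUU : ∀ c, U c * U c = 1)
    (hU : Algebra.adjoin ℂ (Set.range U) = ⊤)
    {Φ : (Fin n → Spin q) → Matrix (Fin D) (Fin D) ℂ} (h : C.Good U n Φ) (h0 : Φ ≠ 0) (k : ℕ) :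
    ∃ Ψ, C.Good U ((k + 1) * n) Ψ ∧ Ψ ≠ 0 := by
  induction k with
  | zero => rw [zero_add, one_mul]; exact ⟨Φ, h, h0⟩
  | succ k ih =>
    obtain ⟨Ψ, hΨ, hΨ0⟩ := ih
    exact ⟨_, hΨ.cat hUU (Nat.succ_mul (k + 1) n).symm h,
      cat_ne_zero _ hΨ0 (h.span_eq_top hU hn h0)⟩

/-- The annihilator of the ground state does not mention `U`, so two irreducible choices with good
families of the same length have the same relations. -/
theorem Good.evalRight_eq_zero_iff_of_ringFixed {D n : ℕ} (hn : C.maxRange ≤ n)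
    {U : C.Cut → Matrix (Fin D) (Fin D) ℂ} (hUU : ∀ c, U c * U c = 1)
    (hU : Algebra.adjoin ℂ (Set.range U) = ⊤)
    {Φ : (Fin n → Spin q) → Matrix (Fin D) (Fin D) ℂ} (h : C.Good U n Φ) (h0 : Φ ≠ 0)
    {ψ : (Fin n → Spin q) → ℂ} (huniq : ∀ φ, C.RingFixed n φ → ∃ z : ℂ, φ = z • ψ)
    (x : FreeAlgebra ℂ C.Cut) : C.evalRight n x ψ = 0 ↔ FreeAlgebra.lift ℂ U x = 0 := by
  obtain ⟨z, hz⟩ := huniq _ (h.ringFixed_trace hUU hn)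
  have hz0 : z ≠ 0 := by
    rintro rfl
    exact h0 (h.eq_zero_of_trace_eq_zero hU hn fun g => by simpa using congrFun hz g)
  rw [← h.evalRight_eq_zero_iff hU hn h0 x, hz, map_smul, smul_eq_zero, or_iff_right hz0]

/-- There are irreducible virtual operators with good families of matrices on all long chains. -/
theorem exists_good_family (hcomm : ∀ᶠ L : ℕ in atTop, ∀ [NeZero L], C.Commuting L)
    (huniq : ∀ᶠ L : ℕ in atTop, ∀ [NeZero L], C.HasUniqueGroundState L) :
    ∃ (D : ℕ) (U : C.Cut → (Matrix (Fin D) (Fin D) ℂ)ˣ), IsIrreducible U ∧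
      IsCliffordRep C.tMatrix U ∧ (∀ c, (U c : Matrix (Fin D) (Fin D) ℂ) * U c = 1) ∧
      ∀ᶠ n : ℕ in atTop, ∃ Φ, C.Good (fun c => (U c : Matrix (Fin D) (Fin D) ℂ)) n Φ ∧ Φ ≠ 0 := by
  obtain ⟨n₀, hn₀⟩ := eventually_atTop.1 ((eventually_uniqueFixed huniq).and
    ((eventually_ge_atTop (2 * C.maxRange)).and (eventually_gt_atTop 0)))
  have key : ∀ n, n₀ ≤ n → ∃ (D : ℕ) (U : C.Cut → (Matrix (Fin D) (Fin D) ℂ)ˣ), IsIrreducible U ∧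
      IsCliffordRep C.tMatrix U ∧ (∀ c, (U c : Matrix (Fin D) (Fin D) ℂ) * U c = 1) ∧
      (∀ ψ, C.RingFixed n ψ → ∀ x,
        FreeAlgebra.lift ℂ (fun c => (U c : Matrix (Fin D) (Fin D) ℂ)) x = 0 →
        C.evalRight n x ψ = 0) ∧
      ∃ Φ, C.Good (fun c => (U c : Matrix (Fin D) (Fin D) ℂ)) n Φ ∧ Φ ≠ 0 := by
    intro n hn
    obtain ⟨⟨ψ, hψ0, hψ, hun⟩, h2, -⟩ := hn₀ n hn
    obtain ⟨D, U, hirr, hcl, hUU, hrel⟩ := exists_virtual_relations hcomm h2 hψ0 hψ hun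
    refine ⟨D, U, hirr, hcl, hUU, fun φ hφ x hx => ?_, ?_⟩
    · obtain ⟨z, rfl⟩ := hun φ hφ
      rw [map_smul, hrel x hx, smul_zero]
    obtain ⟨Φ, hΦ, htr⟩ := exists_good_of_relations hcomm h2 hirr.adjoin_eq_top hψ hrel
    refine ⟨Φ, hΦ, ?_⟩
    rintro rfl
    exact hψ0 (funext fun g => by rw [← htr g]; simp)
  -- `U` is fixed at length `n₀`; another length `n` comes with its own `U'`, to be compared with
  -- `U`.
  obtain ⟨D, U, hirr, hcl, hUU, -, Φ, hΦ, hΦ0⟩ := key n₀ le_rfl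
  refine ⟨D, U, hirr, hcl, hUU, eventually_atTop.2 ⟨n₀, fun n hn => ?_⟩⟩
  obtain ⟨D', U', hirr', -, hUU', hrel', Φ', hΦ', hΦ0'⟩ := key n hn
  obtain ⟨⟨ψ, hψ0, hψ, hun⟩, h2, h3⟩ := hn₀ n hn
  obtain ⟨-, h4, h5⟩ := hn₀ n₀ le_rfl
  obtain ⟨⟨ψN, -, -, hunN⟩, h6, -⟩ := hn₀ (n * n₀) (Nat.le_mul_of_pos_left n₀ h3)
  have hpow := hΦ.exists_pow (by omega) hUU hirr.adjoin_eq_top hΦ0 (n - 1)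
  have hpow' := hΦ'.exists_pow (by omega) hUU' hirr'.adjoin_eq_top hΦ0' (n₀ - 1)
  rw [Nat.sub_add_cancel h3] at hpow
  rw [Nat.sub_add_cancel h5, mul_comm] at hpow'
  obtain ⟨Ψ, hΨ, hΨ0⟩ := hpow
  obtain ⟨Ψ', hΨ', hΨ0'⟩ := hpow'
  -- The relations of `U` and `U'` coincide with the annihilator of the ground state at the common
  -- length `n * n₀`.
  have hrel : ∀ x, FreeAlgebra.lift ℂ (fun c => (U c : Matrix (Fin D) (Fin D) ℂ)) x = 0 →
      C.evalRight n x ψ = 0 := fun x hx => hrel' ψ hψ x <| by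
    rwa [← hΨ'.evalRight_eq_zero_iff_of_ringFixed (by omega) hUU' hirr'.adjoin_eq_top hΨ0' hunN,
      hΨ.evalRight_eq_zero_iff_of_ringFixed (by omega) hUU hirr.adjoin_eq_top hΨ0 hunN]
  obtain ⟨Ξ, hΞ, htr⟩ := exists_good_of_relations hcomm h2 hirr.adjoin_eq_top hψ hrel
  refine ⟨Ξ, hΞ, ?_⟩
  rintro rfl
  exact hψ0 (funext fun g => by rw [← htr g]; simp)

section Extension

variable {D : ℕ} {U : C.Cut → Matrix (Fin D) (Fin D) ℂ}

/-- If adding one site on the right is the same, up to a scalar, as adding it on the left, then it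
preserves goodness. -/
theorem Good.extend {N : ℕ} (hN : C.maxRange ≤ N)
    {Ψ : (Fin N → Spin q) → Matrix (Fin D) (Fin D) ℂ} (h : C.Good U N Ψ)
    {S : (Fin 1 → Spin q) → Matrix (Fin D) (Fin D) ℂ} {z : ℂ}
    (hS : StabMPS.cat rfl Ψ S = z • StabMPS.cat (Nat.add_comm 1 N) S Ψ) :
    C.Good U (N + 1) (StabMPS.cat rfl Ψ S) := by
  refine good_of_cuts (by omega) (fun α a h1 h2 => ?_) (fun c => ?_) fun c => ?_
  · have hα := C.P_le_maxRange α
    by_cases h3 : a + C.P α ≤ N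
    · rw [C.chainOp_cat, h.bulk α a h1 h3, C.chainOp_of_add_le (a := a - N) (by omega),
        Module.End.one_apply]
    -- A term reaching the last cell misses the first one, as `C.maxRange ≤ N`; `hS` moves the new
    -- site to the left, which puts the term in the bulk of `Ψ`.
    · push_cast at h2
      rw [hS, map_smul, C.chainOp_cat, C.chainOp_of_le (a := a) (by push_cast; omega),
        Module.End.one_apply, h.bulk α (a - (1 : ℕ)) (by push_cast; omega) (by push_cast; omega)]
  · have hc := C.P_le_maxRange c.1
    rw [C.chainOp_cat, h.left c (by omega), C.chainOp_of_add_le (a := -C.pos c - N) (by omega),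
      Module.End.one_apply]
    funext g
    simp only [StabMPS.cat, mul_assoc]
  · have hc := C.P_le_maxRange c.1
    have hc' := C.pos_lt c
    rw [hS, map_smul, C.chainOp_cat, C.chainOp_of_le (a := (N + 1 : ℕ) - C.pos c)
      (by push_cast; omega), Module.End.one_apply,
      show ((N + 1 : ℕ) : ℤ) - C.pos c - (1 : ℕ) = N - C.pos c by push_cast; ring,
      h.right c (by omega)]
    funext g
    simp only [StabMPS.cat, Pi.smul_apply, smul_mul_assoc, mul_assoc]

/-- For blocks, adding a site on the left or on the right gives the same family, so `Good.extend`
applies with `z = 1`. -/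
theorem good_block_of_good {T : Tensor q D} {n : ℕ} (hn : C.maxRange ≤ n)
    (h : C.Good U n (T.block n)) {N : ℕ} (hN : n ≤ N) : C.Good U N (T.block N) := by
  induction N, hN using Nat.le_induction with
  | base => exact h
  | succ N hN ih =>
    rw [T.block_add (n := N) (k := 1) rfl]
    refine ih.extend (by omega) (z := 1) ?_
    rw [one_smul, ← T.block_add, ← T.block_add]

/-- Good families of matrices on `n` and `n + 1` cells yield a tensor whose blocks are good. -/
theorem exists_tensor_of_good (hD : 0 < D) (hUU : ∀ c, U c * U c = 1)
    (hU : Algebra.adjoin ℂ (Set.range U) = ⊤) {n : ℕ} (hn : C.maxRange ≤ n)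
    (huniq : C.UniqueFixed (n + (n + 1)))
    {Φ : (Fin n → Spin q) → Matrix (Fin D) (Fin D) ℂ} (hΦ : C.Good U n Φ) (hΦ0 : Φ ≠ 0)
    {Ψ : (Fin (n + 1) → Spin q) → Matrix (Fin D) (Fin D) ℂ} (hΨ : C.Good U (n + 1) Ψ)
    (hΨ0 : Ψ ≠ 0) :
    ∃ T : Tensor q D, ∀ N, n ≤ N → C.Good U N (T.block N) ∧ T.block N ≠ 0 := by
  have : Nonempty (Fin D) := ⟨⟨0, hD⟩⟩
  have hΦs := hΦ.span_eq_top hU hn hΦ0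
  have hΨs := hΨ.span_eq_top hU (by omega) hΨ0
  obtain ⟨_, a, ha⟩ := exists_sum_smul_eq_one hΦs
  obtain ⟨_, b, hb⟩ := exists_sum_smul_eq_one hΨs
  have hlen : (n + 1) + n = n + (n + 1) := by omega
  -- `Φ Ψ` and `Ψ Φ` are both good on `2 n + 1` cells, hence proportional.
  obtain ⟨z, hz⟩ := (hΨ.cat hUU hlen hΦ).exists_eq_smul hUU hU (by omega) huniq
    (hΦ.cat hUU rfl hΨ) (cat_ne_zero hlen hΨ0 hΦs)
  have hex : ∀ (g : Fin n → Spin q) (x : Spin q) (h : Fin n → Spin q),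
      Φ g * Ψ (Fin.cons x h) = z • (Ψ (Fin.snoc g x) * Φ h) := by
    intro g x h
    have h1 := congrFun hz (Fin.append g (Fin.cons x h))
    rw [cat_append] at h1
    rw [h1, Pi.smul_apply, StabMPS.cat]
    congr 3
    · funext i
      refine Fin.lastCases ?_ (fun i => ?_) i
      · rw [Fin.snoc_last]
        exact (Fin.append_right g (Fin.cons x h : Fin (n + 1) → Spin q) 0).trans (Fin.cons_zero _ _)
      · rw [Fin.snoc_castSucc]
        exact Fin.append_left g _ i
    · funext i
      have e : (⟨n + 1 + i, by omega⟩ : Fin (n + (n + 1))) = Fin.natAdd n i.succ := by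
        ext; simp; omega
      rw [e, Fin.append_right, Fin.cons_succ]
  -- Summing `hex` against `∑ g, a g • Φ g = 1` peels the first site off `Ψ`; `T x` is the factor
  -- that appears.
  let T : Tensor q D := fun x => z • ∑ g, a g • Ψ (Fin.snoc g x)
  have hA : ∀ (x : Spin q) (h : Fin n → Spin q), Ψ (Fin.cons x h) = T x * Φ h := by
    intro x h
    calc Ψ (Fin.cons x h) = ∑ g, a g • (Φ g * Ψ (Fin.cons x h)) := by
          conv_lhs => rw [← one_mul (Ψ (Fin.cons x h)), ← ha, Finset.sum_mul]
          simp only [smul_mul_assoc]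
      _ = _ := by
          simp only [hex, T, smul_mul_assoc, Finset.sum_mul, Finset.smul_sum]
          exact Finset.sum_congr rfl fun g _ => smul_comm _ _ _
  have hB : ∀ (g : Fin n → Spin q) (x : Spin q), Φ g * T x = z • Ψ (Fin.snoc g x) := by
    intro g x
    calc Φ g * T x = ∑ h, a h • (Φ g * (T x * Φ h)) := by
          conv_lhs => rw [← mul_one (Φ g * T x), ← ha, Finset.mul_sum]
          simp only [mul_smul_comm, mul_assoc]
      _ = ∑ h, a h • (z • (Ψ (Fin.snoc g x) * Φ h)) := by simp only [← hA, hex]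
      _ = z • (Ψ (Fin.snoc g x) * ∑ h, a h • Φ h) := by
          rw [Finset.mul_sum, Finset.smul_sum]
          exact Finset.sum_congr rfl fun h _ => by rw [mul_smul_comm, smul_comm]
      _ = _ := by rw [ha, mul_one]
  have hswap : StabMPS.cat rfl Φ (T.block 1) = z • StabMPS.cat (Nat.add_comm 1 n) (T.block 1) Φ := by
    funext w
    have h1 : StabMPS.cat rfl Φ (T.block 1) w = z • Ψ w := by
      rw [StabMPS.cat, T.block_one]
      refine (hB _ _).trans ?_
      congr 2
      exact Fin.snoc_init_self w
    have h2 : StabMPS.cat (Nat.add_comm 1 n) (T.block 1) Φ w = Ψ w := by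
      rw [StabMPS.cat, T.block_one]
      refine (hA _ _).symm.trans ?_
      congr 1
      refine Eq.trans ?_ (Fin.cons_self_tail w)
      congr 1
      funext i
      simp only [Fin.tail]
      congr 1
      ext
      simp [add_comm]
    rw [h1, Pi.smul_apply, h2]
  -- `Φ` extended by `k` sites on the right
  have hext : ∀ k, C.Good U (n + k) (StabMPS.cat rfl Φ (T.block k)) ∧
      StabMPS.cat rfl (StabMPS.cat rfl Φ (T.block k)) (T.block 1) =
        z • StabMPS.cat (Nat.add_comm 1 (n + k)) (T.block 1) (StabMPS.cat rfl Φ (T.block k)) ∧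
      StabMPS.cat rfl Φ (T.block k) = z ^ k • StabMPS.cat (Nat.add_comm k n) (T.block k) Φ := by
    intro k
    induction k with
    | zero =>
      have e : StabMPS.cat (Nat.add_zero n) Φ (T.block 0) = Φ := by
        funext g
        rw [StabMPS.cat, T.block_zero, mul_one]
      have e' : StabMPS.cat (Nat.zero_add n) (T.block 0) Φ = Φ := by
        funext g
        rw [StabMPS.cat, T.block_zero, one_mul]
        congr 1
        funext i
        simp
      refine ⟨?_, ?_, ?_⟩
      · exact e.symm ▸ hΦ
      · exact e.symm ▸ hswap
      · rw [pow_zero, one_smul]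
        exact e.trans e'.symm
    | succ k ih =>
      obtain ⟨h1, h2, h3⟩ := ih
      have e : StabMPS.cat rfl Φ (T.block (k + 1)) =
          StabMPS.cat rfl (StabMPS.cat rfl Φ (T.block k)) (T.block 1) := by
        rw [T.block_add (n := k) (k := 1) rfl]
        exact (cat_assoc rfl rfl rfl rfl _ _ _).symm
      have e2 : StabMPS.cat rfl Φ (T.block (k + 1)) = z • StabMPS.cat (Nat.add_comm 1 (n + k))
          (T.block 1) (StabMPS.cat rfl Φ (T.block k)) := e.trans h2
      refine ⟨?_, ?_, ?_⟩
      · rw [e]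
        exact h1.extend (by omega) h2
      · have e3 : StabMPS.cat (rfl : n + (k + 1) + 1 = n + (k + 1) + 1)
            (StabMPS.cat rfl Φ (T.block (k + 1))) (T.block 1) =
            z • StabMPS.cat (Nat.add_comm 1 (n + k + 1)) (T.block 1)
              (StabMPS.cat rfl (StabMPS.cat rfl Φ (T.block k)) (T.block 1)) := by
          rw [e2, smul_cat]
          congr 1
          exact cat_assoc _ _ _ _ _ _ _
        rw [e3, e]
      · rw [e2, h3, cat_smul, smul_smul, ← pow_succ', T.block_add (Nat.add_comm 1 k)]
        congr 1
        exact (cat_assoc _ _ _ _ _ _ _).symm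
  have hne : ∀ k, T.block k ≠ 0 := by
    intro k
    induction k with
    | zero =>
      intro h
      have := congrFun h 0
      rw [T.block_zero] at this
      exact one_ne_zero this
    | succ k ih =>
      intro h
      apply ih
      funext g
      have h1 : ∀ x, T.block k g * T x = 0 := by
        intro x
        have := cat_append (T.block k) (T.block 1) g (fun _ => x)
        rw [← T.block_add, h, T.block_one] at this
        exact this.symm
      -- `T.block k g` kills every `T x`, hence every value of `Ψ`, and these combine to `1`.
      rw [← mul_one (T.block k g), ← hb, Finset.mul_sum]
      refine Finset.sum_eq_zero fun w _ => ?_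
      rw [mul_smul_comm, ← Fin.cons_self_tail w, hA, ← mul_assoc, h1]
      simp
  have hcomm : ∀ g h, Φ g * T.block n h = z ^ n • (T.block n g * Φ h) := by
    intro g h
    have h1 := congrFun (hext n).2.2 (Fin.append g h)
    rwa [cat_append, Pi.smul_apply, cat_append] at h1
  -- `M` compares the block of length `n` with `Φ`. It commutes with all matrices up to the factor
  -- `z ^ n * z ^ n`, which the matrix `1` shows to be 1; so `M` is a scalar.
  set M := ∑ g, a g • T.block n g with hM
  have hM1 : ∀ h, T.block n h = z ^ n • (M * Φ h) := by
    intro h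
    calc T.block n h = ∑ g, a g • (Φ g * T.block n h) := by
          conv_lhs => rw [← one_mul (T.block n h), ← ha, Finset.sum_mul]
          simp only [smul_mul_assoc]
      _ = _ := by
          simp only [hcomm, hM, Finset.sum_mul, Finset.smul_sum, smul_mul_assoc]
          exact Finset.sum_congr rfl fun g _ => smul_comm _ _ _
  have hM2 : ∀ g, Φ g * M = z ^ n • T.block n g := by
    intro g
    calc Φ g * M = ∑ h, a h • (Φ g * T.block n h) := by
          simp only [hM, Finset.mul_sum, mul_smul_comm]
      _ = z ^ n • (T.block n g * ∑ h, a h • Φ h) := by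
          simp only [hcomm, Finset.mul_sum, Finset.smul_sum, mul_smul_comm]
          exact Finset.sum_congr rfl fun g _ => smul_comm _ _ _
      _ = _ := by rw [ha, mul_one]
  have hM0 : M ≠ 0 := by
    intro h
    apply hne n
    funext g
    rw [hM1, h]
    simp
  have hM3 : ∀ X, X * M = (z ^ n * z ^ n) • (M * X) := by
    intro X
    have hX : X ∈ Submodule.span ℂ (Set.range Φ) := hΦs ▸ Submodule.mem_top
    induction hX using Submodule.span_induction with
    | mem y hy => obtain ⟨g, rfl⟩ := hy; rw [hM2, hM1, smul_smul]
    | zero => simp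
    | add x y _ _ hx hy => rw [add_mul, hx, hy, mul_add, smul_add]
    | smul c x _ hx => rw [smul_mul_assoc, hx, mul_smul_comm, smul_comm]
  have hz1 : z ^ n * z ^ n = 1 := by
    have h1 := hM3 1
    rw [one_mul, mul_one] at h1
    have h2 : (1 : ℂ) • M = (z ^ n * z ^ n) • M := by rw [one_smul]; exact h1
    exact (smul_left_injective ℂ hM0 h2).symm
  obtain ⟨μ, hμ⟩ := exists_eq_smul_one_of_commute hU M fun c => by
    have := hM3 (U c)
    rwa [hz1, one_smul] at this
  have hblock : T.block n = (z ^ n * μ) • Φ := by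
    funext g
    rw [hM1, hμ, smul_mul_assoc, one_mul, smul_smul, Pi.smul_apply]
  exact ⟨T, fun N hN => ⟨good_block_of_good hn (hblock ▸ hΦ.smul _) hN, hne N⟩⟩

/-- A tensor with good nonzero blocks generates the ground states. -/
theorem generates_of_good (hUU : ∀ c, U c * U c = 1) (hU : Algebra.adjoin ℂ (Set.range U) = ⊤)
    {T : Tensor q D} (h : ∀ᶠ N in atTop, C.Good U N (T.block N) ∧ T.block N ≠ 0) :
    T.Generates C := by
  filter_upwards [h, eventually_ge_atTop C.maxRange] with L h1 h2
  intro hL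
  rw [C.isGroundState_iff L h2, T.relabel_mps]
  refine ⟨fun h0 => h1.2 (h1.1.eq_zero_of_trace_eq_zero hU h2 (congrFun h0)),
    h1.1.ringFixed_trace hUU h2⟩

end Extension

theorem exists_generates (hcomm : ∀ᶠ L : ℕ in atTop, ∀ [NeZero L], C.Commuting L)
    (huniq : ∀ᶠ L : ℕ in atTop, ∀ [NeZero L], C.HasUniqueGroundState L) :
    ∃ (D : ℕ) (U : C.Cut → (Matrix (Fin D) (Fin D) ℂ)ˣ), IsIrreducible U ∧
      IsCliffordRep C.tMatrix U ∧ ∃ T : Tensor q D, T.Generates C := by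
  obtain ⟨D, U, hirr, hcl, hUU, hfam⟩ := exists_good_family hcomm huniq
  obtain ⟨n, hn⟩ := eventually_atTop.1
    ((hfam.and (eventually_uniqueFixed huniq)).and (eventually_ge_atTop C.maxRange))
  obtain ⟨⟨⟨Φ, hΦ, hΦ0⟩, -⟩, hn'⟩ := hn n le_rfl
  obtain ⟨⟨⟨Ψ, hΨ, hΨ0⟩, -⟩, -⟩ := hn (n + 1) (by omega)
  obtain ⟨⟨-, hun⟩, -⟩ := hn (n + (n + 1)) (by omega)
  obtain ⟨T, hT⟩ := exists_tensor_of_good hirr.1 hUU hirr.adjoin_eq_top hn' hun hΦ hΦ0 hΨ hΨ0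
  exact ⟨D, U, hirr, hcl, T, generates_of_good hUU hirr.adjoin_eq_top
    (eventually_atTop.2 ⟨n, hT⟩)⟩

end Code

end StabMPS

/-! ### Schmidt rank and the lower bound on the bond dimension -/

namespace StabMPS

theorem two_pow_rank_mul_self_le {ι : Type} [Fintype ι] (t : Matrix ι ι (ZMod 2)) :
    2 ^ t.rank * 2 ^ t.rank ≤ 2 ^ (Matrix.fromBlocks t 0 0 t).rank := by
  rw [← card_range_mulVecLin, ← card_range_mulVecLin, ← Nat.card_prod]
  have hmem : ∀ x : LinearMap.range t.mulVecLin × LinearMap.range t.mulVecLin,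
      Sum.elim (x.1 : ι → ZMod 2) (x.2 : ι → ZMod 2) ∈
        LinearMap.range (Matrix.fromBlocks t 0 0 t).mulVecLin := by
    rintro ⟨⟨_, v, rfl⟩, ⟨_, w, rfl⟩⟩
    exact ⟨Sum.elim v w, by simp [Matrix.fromBlocks_mulVec]⟩
  refine Nat.card_le_card_of_injective (fun x => (⟨_, hmem x⟩ :
    LinearMap.range (Matrix.fromBlocks t 0 0 t).mulVecLin)) fun x y hxy => ?_
  have h := congrArg Subtype.val hxy
  exact Prod.ext (Subtype.ext (funext fun i => congrFun h (Sum.inl i)))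
    (Subtype.ext (funext fun i => congrFun h (Sum.inr i)))

section Slices

variable {q n k : ℕ}

/-- The span of the states of the first `n` cells obtained by fixing the configuration of the last
`k` cells. -/
def sliceSpan (ψ : (Fin (n + k) → Spin q) → ℂ) : Submodule ℂ ((Fin n → Spin q) → ℂ) :=
  Submodule.span ℂ (Set.range fun (h : Fin k → Spin q) (g : Fin n → Spin q) => ψ (Fin.append g h))

/-- As `p` fixes `ψ`, its action on the first cells can be traded for its action on the last ones,
which only changes the fixed configuration and adds a phase. -/
theorem pauliOp_mem_sliceSpan {ψ : (Fin (n + k) → Spin q) → ℂ} {p : Fin (n + k) → PauliString q}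
    (hp : pauliOp p ψ = ψ) {φ : (Fin n → Spin q) → ℂ} (hφ : φ ∈ sliceSpan ψ) :
    pauliOp (fun i => p (Fin.castAdd k i)) φ ∈ sliceSpan ψ := by
  induction hφ using Submodule.span_induction with
  | mem y hy =>
    obtain ⟨h₀, rfl⟩ := hy
    set p' : Fin k → PauliString q := fun i => p (Fin.natAdd n i) with hp'
    set h : Fin k → Spin q := shift p' h₀ with hh
    set z : ℂ := ∏ i, (p' i).phase (h i + (p' i).x) with hz
    have hz0 : z ≠ 0 := Finset.prod_ne_zero_iff.2 fun i _ => (p' i).phase_ne_zero _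
    have key : z • pauliOp (fun i => p (Fin.castAdd k i))
        (fun g : Fin n → Spin q => ψ (Fin.append g h₀)) = fun g => ψ (Fin.append g h) := by
      funext g
      have h1 := congrFun hp (Fin.append g h)
      rw [pauliOp_apply, Fin.prod_univ_add] at h1
      simp only [Fin.append_left, Fin.append_right] at h1
      have h2 : (fun i => Fin.append g h i + (p i).x) =
          Fin.append (fun i => g i + (p (Fin.castAdd k i)).x) h₀ := by
        funext i
        refine Fin.addCases (fun i => ?_) (fun i => ?_) i
        · simp only [Fin.append_left]
        · simp only [Fin.append_right]
          exact congrFun (shift_shift p' h₀) i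
      rw [h2] at h1
      rw [← h1, Pi.smul_apply, pauliOp_apply, smul_smul, mul_comm]
    rw [← Submodule.smul_mem_iff _ hz0, key]
    exact Submodule.subset_span ⟨h, rfl⟩
  | zero => rw [map_zero]; exact zero_mem _
  | add x y _ _ hx hy => rw [map_add]; exact add_mem hx hy
  | smul c x _ hx => rw [map_smul]; exact Submodule.smul_mem _ _ hx

theorem sliceSpan_ne_bot {ψ : (Fin (n + k) → Spin q) → ℂ} (h : ψ ≠ 0) : sliceSpan ψ ≠ ⊥ := by
  intro h0
  apply h
  funext w
  have h1 : (fun g : Fin n → Spin q => ψ (Fin.append g fun i => w (Fin.natAdd n i))) ∈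
      sliceSpan ψ := Submodule.subset_span ⟨_, rfl⟩
  rw [h0, Submodule.mem_bot] at h1
  have h2 := congrFun h1 fun i => w (Fin.castAdd k i)
  rwa [Fin.append_castAdd_natAdd] at h2

end Slices

namespace Code

variable {q m : ℕ} {C : Code q m}

/-- The Schmidt rank of a ground state across the two ends of an interval is at least
`2 ^ rank t`. -/
theorem two_pow_rank_le_finrank_sliceSpan
    (hcomm : ∀ᶠ L : ℕ in atTop, ∀ [NeZero L], C.Commuting L) {n k : ℕ}
    (hn : 2 * C.maxRange ≤ n) (hk : C.maxRange ≤ k) {ψ : (Fin (n + k) → Spin q) → ℂ}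
    (hψ0 : ψ ≠ 0) (hψ : C.RingFixed (n + k) ψ) :
    2 ^ C.tMatrix.rank ≤ Module.finrank ℂ (sliceSpan ψ) := by
  have hright : ∀ c : C.Cut, ∀ φ ∈ sliceSpan ψ, C.chainOp n c.1 (n - C.pos c) φ ∈ sliceSpan ψ := by
    intro c φ hφ
    have hc := C.P_le_maxRange c.1
    have hc' := C.pos_lt c
    exact pauliOp_mem_sliceSpan (hψ.bulk c.1 (n - C.pos c) (by omega) (by push_cast; omega)) hφ
  have hleft : ∀ c : C.Cut, ∀ φ ∈ sliceSpan ψ, C.chainOp n c.1 (-C.pos c) φ ∈ sliceSpan ψ := by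
    intro c φ hφ
    have hc := C.P_le_maxRange c.1
    have hc' := C.pos_lt c
    have hc0 := C.pos_pos c
    have h1 := hψ c.1 (n + k - C.pos c) (by omega)
    rw [Nat.cast_sub (by omega), sub_sub_cancel_left, ← Module.End.mul_apply] at h1
    -- The term across the seam as a single string; on the first `n` cells it is the left-end piece.
    let p : Fin (n + k) → PauliString q := fun i =>
      if (i : ℕ) < n then C.stringAt c.1 (-C.pos c) i else
        C.stringAt c.1 (((n + k : ℕ) : ℤ) - C.pos c) i
    have h2 : pauliOp p ψ = ψ := by
      refine Eq.trans ?_ h1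
      congr 1
      symm
      refine pauliOp_mul_of_disjoint fun i => ?_
      by_cases hi : (i : ℕ) < n
      · left
        exact ⟨C.stringAt_of_lt (by push_cast; omega), if_pos hi⟩
      · right
        exact ⟨C.stringAt_of_le (by omega), if_neg hi⟩
    have h3 := pauliOp_mem_sliceSpan h2 hφ
    have h4 : (fun i : Fin n => p (Fin.castAdd k i)) =
        fun i : Fin n => C.stringAt c.1 (-C.pos c) (i : ℤ) := by
      funext i
      exact if_pos i.2
    rwa [h4] at h3
  let A : C.Cut ⊕ C.Cut → Module.End ℂ (sliceSpan ψ) := Sum.elim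
    (fun c => (C.chainOp n c.1 (n - C.pos c)).restrict (hright c))
    (fun c => (C.chainOp n c.1 (-C.pos c)).restrict (hleft c))
  have hcoe : ∀ i φ, (A i φ : (Fin n → Spin q) → ℂ) = Sum.elim
      (fun c => C.chainOp n c.1 (n - C.pos c)) (fun c : C.Cut => C.chainOp n c.1 (-C.pos c)) i φ := by
    rintro (i | i) φ <;> rfl
  have hA : ∀ i, A i * A i = 1 := by
    intro i
    refine LinearMap.ext fun φ => Subtype.ext ?_
    rw [Module.End.mul_apply, hcoe, hcoe]
    rcases i with c | c <;> exact C.chainOp_chainOp _ _ _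
  have hrel : CliffordRel (Matrix.fromBlocks C.tMatrix 0 0 C.tMatrix) A := by
    refine (cliffordRel_iff _ _).2 fun i j => LinearMap.ext fun φ => Subtype.ext ?_
    have hlr : ∀ c d : C.Cut, Commute
        (C.chainOp n c.1 (n - C.pos c) : Module.End ℂ ((Fin n → Spin q) → ℂ))
        (C.chainOp n d.1 (-C.pos d)) := fun c d => C.chainOp_commute (C.overlap_left_right c d hn)
    rw [Module.End.mul_apply, LinearMap.smul_apply, Module.End.mul_apply, Submodule.coe_smul,
      hcoe, hcoe, hcoe, hcoe]
    rcases i with c | c <;> rcases j with d | d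
    · exact congrArg (fun A => A (φ : (Fin n → Spin q) → ℂ)) ((cliffordRel_iff _ _).1
        (C.cliffordRel_chainOp_left (n := n) (by omega)) c d)
    · simp only [Matrix.fromBlocks_apply₁₂, Matrix.zero_apply, sgn_zero, one_smul]
      exact congrArg (fun A => A (φ : (Fin n → Spin q) → ℂ)) (hlr c d).eq
    · simp only [Matrix.fromBlocks_apply₂₁, Matrix.zero_apply, sgn_zero, one_smul]
      exact congrArg (fun A => A (φ : (Fin n → Spin q) → ℂ)) (hlr d c).symm.eq
    · exact congrArg (fun A => A (φ : (Fin n → Spin q) → ℂ)) ((cliffordRel_iff _ _).1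
        (cliffordRel_chainOp_right hcomm (n := n) (by omega)) c d)
  have : Nontrivial (sliceSpan ψ) := Submodule.nontrivial_iff_ne_bot.2 (sliceSpan_ne_bot hψ0)
  -- For `End (sliceSpan ψ)` and `t ⊕ t` the counting bound gives `(2 ^ rank t) ^ 2 ≤ dim ^ 2`.
  have h1 := two_pow_rank_le_finrank hrel fun i => IsUnit.of_mul_eq_one _ (hA i)
  rw [Module.finrank_linearMap] at h1
  exact Nat.mul_self_le_mul_self_iff.1 ((two_pow_rank_mul_self_le C.tMatrix).trans h1)

/-- The blocks of a tensor generating the ground state of a long ring span a space of dimension at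
least `2 ^ rank t`. -/
theorem two_pow_rank_le_finrank_span_block
    (hcomm : ∀ᶠ L : ℕ in atTop, ∀ [NeZero L], C.Commuting L) {n k D : ℕ}
    (hn : 2 * C.maxRange ≤ n) (hk : C.maxRange ≤ k) [NeZero (n + k)] {T : Tensor q D}
    (h : C.IsGroundState (n + k) (T.mps (n + k))) :
    2 ^ C.tMatrix.rank ≤ Module.finrank ℂ (Submodule.span ℂ (Set.range (T.block n))) := by
  rw [C.isGroundState_iff _ (by omega), T.relabel_mps] at h
  refine (two_pow_rank_le_finrank_sliceSpan hcomm hn hk h.1 h.2).trans ?_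
  set S := Submodule.span ℂ (Set.range (T.block n))
  -- A slice is the functional `X ↦ tr (X * T.block k u)` evaluated on the blocks.
  let ρ : Module.Dual ℂ S →ₗ[ℂ] ((Fin n → Spin q) → ℂ) :=
    { toFun := fun f g => f ⟨T.block n g, Submodule.subset_span ⟨g, rfl⟩⟩
      map_add' := fun _ _ => rfl
      map_smul' := fun _ _ => rfl }
  have hle : sliceSpan (n := n) (k := k) (fun g => (T.block (n + k) g).trace) ≤
      LinearMap.range ρ := by
    refine Submodule.span_le.2 ?_
    rintro _ ⟨u, rfl⟩
    refine ⟨(Matrix.traceLinearMap (Fin D) ℂ ℂ ∘ₗ LinearMap.mulRight ℂ (T.block k u)) ∘ₗ S.subtype, ?_⟩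
    funext g
    change _ = (T.block (n + k) (Fin.append g u)).trace
    rw [T.block_add (n := n) (k := k) rfl, cat_append]
    rfl
  exact (Submodule.finrank_mono hle).trans ((LinearMap.finrank_range_le ρ).trans
    (Subspace.dual_finrank_eq (K := ℂ)).le)

/-- The bond dimension of a tensor generating the ground state of a long ring is at least
`2 ^ (rank t / 2)`. -/
theorem two_pow_le_of_isGroundState (hcomm : ∀ᶠ L : ℕ in atTop, ∀ [NeZero L], C.Commuting L)
    (heven : Even C.tMatrix.rank) {L D : ℕ} (hL : 3 * C.maxRange ≤ L) [NeZero L] {T : Tensor q D}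
    (h : C.IsGroundState L (T.mps L)) : 2 ^ (C.tMatrix.rank / 2) ≤ D := by
  -- An interval of `2 * C.maxRange` cells keeps its two ends apart; the remaining cells hold the
  -- outer pieces.
  obtain ⟨k, rfl⟩ : ∃ k, L = 2 * C.maxRange + k := ⟨L - 2 * C.maxRange, by omega⟩
  have h1 := (two_pow_rank_le_finrank_span_block hcomm le_rfl (by omega) h).trans
    (Submodule.finrank_le _)
  rw [Module.finrank_matrix] at h1
  obtain ⟨r, hr⟩ := heven
  rw [hr] at h1 ⊢
  rw [show (r + r) / 2 = r by omega]
  rw [pow_add] at h1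
  exact Nat.mul_self_le_mul_self_iff.1 (by simpa using h1)

/-- At the minimal bond dimension the lower bound `2 ^ rank t` is the dimension of the whole matrix
algebra. -/
theorem span_block_eq_top (hcomm : ∀ᶠ L : ℕ in atTop, ∀ [NeZero L], C.Commuting L)
    (heven : Even C.tMatrix.rank) {T : Tensor q (2 ^ (C.tMatrix.rank / 2))} (h : T.Generates C)
    {n : ℕ} (hn : 2 * C.maxRange ≤ n) : Submodule.span ℂ (Set.range (T.block n)) = ⊤ := by
  obtain ⟨L₀, hL₀⟩ := eventually_atTop.1 h
  have : NeZero (n + (C.maxRange + L₀ + 1)) := ⟨by omega⟩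
  have h1 := two_pow_rank_le_finrank_span_block hcomm hn (by omega)
    (hL₀ (n + (C.maxRange + L₀ + 1)) (by omega))
  refine Submodule.eq_top_of_finrank_eq (le_antisymm (Submodule.finrank_le _) ?_)
  refine le_trans (le_of_eq ?_) h1
  obtain ⟨r, hr⟩ := heven
  rw [Module.finrank_matrix]
  simp only [Fintype.card_fin, Module.finrank_self, mul_one, hr]
  rw [show (r + r) / 2 = r by omega, pow_add]

end Code

end StabMPS

/-! ### Invariance under adjoints for canonical tensors -/

namespace StabMPS

/-- If `∑ g, B g * A g = 1 = ∑ g, A g * B g` for the adjoints `B g` of the operators `A g`, then the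
subspaces invariant under the `A g` are invariant under the `B g`. -/
theorem adjoint_mem_of_forall_mem {E κ : Type*} [NormedAddCommGroup E] [InnerProductSpace ℂ E]
    [FiniteDimensional ℂ E] [Fintype κ] {A B : κ → E →ₗ[ℂ] E}
    (hadj : ∀ g x y, inner ℂ (A g x) y = inner ℂ x (B g y))
    (hBA : ∀ x, ∑ g, B g (A g x) = x) (hAB : ∀ x, ∑ g, A g (B g x) = x)
    {W : Submodule ℂ E} (hW : ∀ g, ∀ w ∈ W, A g w ∈ W) (g : κ) {w : E} (hw : w ∈ W) :
    B g w ∈ W := by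
  let e := stdOrthonormalBasis ℂ W
  have hadj' : ∀ g x y, inner ℂ x (A g y) = inner ℂ (B g x) y := fun g x y => by
    rw [← inner_conj_symm, hadj, inner_conj_symm]
  have hproj : ∀ x : E, ∑ i, ‖inner ℂ (e i : E) x‖ ^ 2 = ‖W.orthogonalProjectionOnto x‖ ^ 2 := by
    intro x
    rw [← e.sum_sq_norm_inner_right]
    refine Finset.sum_congr rfl fun i _ => ?_
    rw [Submodule.inner_orthogonalProjectionOnto_eq_of_mem_left]
  have hle : ∀ x : E, ‖W.orthogonalProjectionOnto x‖ ^ 2 ≤ ‖x‖ ^ 2 := fun x =>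
    pow_le_pow_left₀ (norm_nonneg _) (W.norm_orthogonalProjectionOnto_apply_le x) 2
  have hA1 : ∀ x : E, ∑ g, ‖A g x‖ ^ 2 = ‖x‖ ^ 2 := by
    intro x
    simp only [norm_sq_eq_re_inner (𝕜 := ℂ), hadj]
    rw [← map_sum, ← inner_sum, hBA]
  have hB1 : ∀ x : E, ∑ g, ‖B g x‖ ^ 2 = ‖x‖ ^ 2 := by
    intro x
    simp only [norm_sq_eq_re_inner (𝕜 := ℂ), ← hadj']
    rw [← map_sum, ← inner_sum, hAB]
  -- The compressions of `A g` and `B g` to `W` are adjoint and have equal Hilbert–Schmidt norms;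
  -- for `A g` the projection loses nothing.
  have hsum : ∑ i, ∑ g, ‖W.orthogonalProjectionOnto (B g (e i))‖ ^ 2 = ∑ i, ∑ g, ‖B g (e i)‖ ^ 2 := by
    have h1 : ∑ i, ∑ g, ‖W.orthogonalProjectionOnto (B g (e i))‖ ^ 2 =
        ∑ i, ∑ g, ‖W.orthogonalProjectionOnto (A g (e i))‖ ^ 2 := by
      simp only [← hproj]
      rw [Finset.sum_comm, Finset.sum_comm (s := Finset.univ) (t := Finset.univ)
        (f := fun i g => ∑ j, ‖inner ℂ (e j : E) (A g (e i))‖ ^ 2)]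
      refine Finset.sum_congr rfl fun g _ => ?_
      rw [Finset.sum_comm]
      refine Finset.sum_congr rfl fun i _ => Finset.sum_congr rfl fun j _ => ?_
      rw [hadj', norm_inner_symm]
    rw [h1]
    refine Finset.sum_congr rfl fun i _ => ?_
    rw [hB1, ← hA1]
    refine Finset.sum_congr rfl fun g _ => ?_
    rw [W.norm_orthogonalProjectionOnto_apply (hW g _ (e i).2)]
  -- Projections do not increase norms, so equal sums force equality term by term.
  have hmem : ∀ i, B g (e i) ∈ W := by
    intro i
    have h2 := (Finset.sum_eq_sum_iff_of_le fun i _ => Finset.sum_le_sum fun g _ =>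
      hle (B g (e i))).1 hsum i (Finset.mem_univ i)
    have h3 := (Finset.sum_eq_sum_iff_of_le fun g _ => hle (B g (e i))).1 h2 g (Finset.mem_univ g)
    have h4 : ‖W.orthogonalProjectionOnto (B g (e i))‖ = ‖B g (e i)‖ :=
      (sq_eq_sq₀ (norm_nonneg _) (norm_nonneg _)).1 h3
    exact (W.mem_iff_norm_starProjection _).2 h4
  have hw' : w = ∑ i, e.toBasis.repr ⟨w, hw⟩ i • (e i : E) := by
    have := congrArg W.subtype (e.toBasis.sum_repr ⟨w, hw⟩)
    simpa using this.symm
  rw [hw', map_sum]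
  refine W.sum_mem fun i _ => ?_
  rw [map_smul]
  exact W.smul_mem _ (hmem i)

namespace Tensor

variable {q D : ℕ} {T : Tensor q D}

/-- Left multiplications by `T g` and its conjugate transpose are adjoint for the Hilbert–Schmidt
product. -/
theorem IsCanonical.conjTranspose_mul_mem (hT : T.IsCanonical)
    {J : Submodule ℂ (Matrix (Fin D) (Fin D) ℂ)} (hJ : ∀ g, ∀ w ∈ J, T g * w ∈ J) (g : Spin q)
    {w : Matrix (Fin D) (Fin D) ℂ} (hw : w ∈ J) : (T g).conjTranspose * w ∈ J := by
  let f : Matrix (Fin D) (Fin D) ℂ ≃ₗ[ℂ] EuclideanSpace ℂ (Fin D × Fin D) :=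
    (LinearEquiv.curry ℂ ℂ (Fin D) (Fin D)).symm ≪≫ₗ (WithLp.linearEquiv 2 ℂ (Fin D × Fin D → ℂ)).symm
  have hinner : ∀ x y, inner ℂ (f x) (f y) = (x.conjTranspose * y).trace := by
    intro x y
    rw [PiLp.inner_apply, Fintype.sum_prod_type, Finset.sum_comm]
    simp only [Matrix.trace, Matrix.diag, Matrix.mul_apply, Matrix.conjTranspose_apply]
    refine Finset.sum_congr rfl fun i _ => Finset.sum_congr rfl fun j _ => ?_
    rw [RCLike.inner_apply, mul_comm]
    rfl
  let A : Spin q → EuclideanSpace ℂ (Fin D × Fin D) →ₗ[ℂ] EuclideanSpace ℂ (Fin D × Fin D) :=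
    fun g => f.toLinearMap ∘ₗ LinearMap.mulLeft ℂ (T g) ∘ₗ f.symm.toLinearMap
  let B : Spin q → EuclideanSpace ℂ (Fin D × Fin D) →ₗ[ℂ] EuclideanSpace ℂ (Fin D × Fin D) :=
    fun g => f.toLinearMap ∘ₗ LinearMap.mulLeft ℂ (T g).conjTranspose ∘ₗ f.symm.toLinearMap
  have hA : ∀ g x, A g (f x) = f (T g * x) := fun g x => by simp [A]
  have hB : ∀ g x, B g (f x) = f ((T g).conjTranspose * x) := fun g x => by simp [B]
  have key := adjoint_mem_of_forall_mem (A := A) (B := B) (W := J.map f.toLinearMap) ?_ ?_ ?_ ?_ g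
    (Submodule.mem_map_of_mem hw)
  · rw [LinearEquiv.coe_coe, hB] at key
    obtain ⟨y, hy, hy'⟩ := key
    rwa [← f.injective hy']
  · intro g x y
    obtain ⟨x, rfl⟩ := f.surjective x
    obtain ⟨y, rfl⟩ := f.surjective y
    rw [hA, hB, hinner, hinner, Matrix.conjTranspose_mul, mul_assoc]
  · intro x
    obtain ⟨x, rfl⟩ := f.surjective x
    simp only [hA, hB]
    rw [← map_sum]
    simp only [← mul_assoc]
    rw [← Finset.sum_mul, hT.2, one_mul]
  · intro x
    obtain ⟨x, rfl⟩ := f.surjective x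
    simp only [hA, hB]
    rw [← map_sum]
    simp only [← mul_assoc]
    rw [← Finset.sum_mul, hT.1, one_mul]
  · rintro g _ ⟨x, hx, rfl⟩
    rw [LinearEquiv.coe_coe, hA]
    exact Submodule.mem_map_of_mem (f := f.toLinearMap) (hJ g x hx)

end Tensor

end StabMPS

/-! ### Existence, uniqueness and relations of the virtual operators -/

namespace StabMPS

section Inverses

variable {D : ℕ} {κ κ' : Type} [Fintype κ] [Fintype κ']

/-- The family of matrices `A` has a left inverse. -/
def HasLeftInverse (A : κ → Matrix (Fin D) (Fin D) ℂ) : Prop :=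
  ∃ X : κ → Matrix (Fin D) (Fin D) ℂ, ∑ g, X g * A g = 1

/-- The family of matrices `A` has a right inverse. -/
def HasRightInverse (A : κ → Matrix (Fin D) (Fin D) ℂ) : Prop :=
  ∃ Y : κ → Matrix (Fin D) (Fin D) ℂ, ∑ g, A g * Y g = 1

theorem HasLeftInverse.cancel {A : κ → Matrix (Fin D) (Fin D) ℂ} (hA : HasLeftInverse A)
    {U V : Matrix (Fin D) (Fin D) ℂ} (h : ∀ g, A g * U = A g * V) : U = V := by
  obtain ⟨X, hX⟩ := hA
  rw [← one_mul U, ← one_mul V, ← hX, Finset.sum_mul, Finset.sum_mul]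
  exact Finset.sum_congr rfl fun g _ => by rw [mul_assoc, h, mul_assoc]

/-- Cancelling `A` on the left and `B` on the right produces two candidates `V` and `W` with `V * W
= 1`. -/
theorem exists_unit_of_mul_eq_mul {A A' : κ → Matrix (Fin D) (Fin D) ℂ}
    {B B' : κ' → Matrix (Fin D) (Fin D) ℂ} (hA : HasLeftInverse A) (hB : HasRightInverse B)
    (h : ∀ g k, A' g * B' k = A g * B k) :
    ∃ U : (Matrix (Fin D) (Fin D) ℂ)ˣ, (∀ g, A' g = A g * (U : Matrix (Fin D) (Fin D) ℂ)) ∧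
      ∀ k, B' k = ((U⁻¹ : (Matrix (Fin D) (Fin D) ℂ)ˣ) : Matrix (Fin D) (Fin D) ℂ) * B k := by
  obtain ⟨X, hX⟩ := hA
  obtain ⟨Y, hY⟩ := hB
  set V := ∑ g, X g * A' g with hV
  set W := ∑ k, B' k * Y k with hW
  have hVB : ∀ k, V * B' k = B k := fun k => by
    rw [hV, Finset.sum_mul]
    simp only [mul_assoc, h]
    simp only [← mul_assoc]
    rw [← Finset.sum_mul, hX, one_mul]
  have hAW : ∀ g, A' g * W = A g := fun g => by
    rw [hW, Finset.mul_sum]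
    simp only [← mul_assoc, h]
    simp only [mul_assoc]
    rw [← Finset.mul_sum, hY, mul_one]
  have hVW : V * W = 1 := by
    rw [hV, Finset.sum_mul]
    simp only [mul_assoc, hAW, hX]
  have hWV : W * V = 1 := mul_eq_one_comm.1 hVW
  refine ⟨⟨V, W, hVW, hWV⟩, fun g => ?_, fun k => ?_⟩
  · change A' g = A g * V
    rw [← hAW, mul_assoc, hWV, mul_one]
  · change B' k = W * B k
    rw [← hVB, ← mul_assoc, hWV, one_mul]

end Inverses

namespace Tensor

variable {q D : ℕ} {T : Tensor q D}

theorem block_cons (T : Tensor q D) {n : ℕ} (x : Spin q) (h : Fin n → Spin q) :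
    T.block (n + 1) (Fin.cons x h) = T x * T.block n h := by
  simp [block, List.ofFn_succ]

theorem sum_cons {M : Type} [AddCommMonoid M] {n : ℕ} (f : (Fin (n + 1) → Spin q) → M) :
    ∑ g, f g = ∑ h : Fin n → Spin q, ∑ x : Spin q, f (Fin.cons x h) := by
  rw [← (Fin.consEquiv fun _ : Fin (n + 1) => Spin q).sum_comp, Fintype.sum_prod_type,
    Finset.sum_comm]
  rfl

theorem hasLeftInverse_block (hT : HasLeftInverse T) (n : ℕ) : HasLeftInverse (T.block n) := by
  obtain ⟨X, hX⟩ := hT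
  induction n with
  | zero => exact ⟨fun _ => 1, by simp [block_zero]⟩
  | succ n ih =>
    obtain ⟨Z, hZ⟩ := ih
    refine ⟨fun g => Z (Fin.tail g) * X (g 0), ?_⟩
    rw [sum_cons, ← hZ]
    refine Finset.sum_congr rfl fun h _ => ?_
    simp only [block_cons, Fin.tail_cons, Fin.cons_zero, mul_assoc]
    simp only [← mul_assoc (X _)]
    rw [← Finset.mul_sum, ← Finset.sum_mul, hX, one_mul]

theorem hasRightInverse_block (hT : HasRightInverse T) (n : ℕ) : HasRightInverse (T.block n) := by
  obtain ⟨Y, hY⟩ := hT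
  induction n with
  | zero => exact ⟨fun _ => 1, by simp [block_zero]⟩
  | succ n ih =>
    obtain ⟨Z, hZ⟩ := ih
    refine ⟨fun g => Z (Fin.tail g) * Y (g 0), ?_⟩
    rw [sum_cons, Finset.sum_comm, ← hY]
    refine Finset.sum_congr rfl fun x _ => ?_
    simp only [block_cons, Fin.tail_cons, Fin.cons_zero, mul_assoc]
    simp only [← mul_assoc (T.block n _)]
    rw [← Finset.mul_sum, ← Finset.sum_mul, hZ, one_mul]

theorem IsCanonical.sum_conjTranspose_block_mul (hT : T.IsCanonical) (n : ℕ) :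
    ∑ g, (T.block n g).conjTranspose * T.block n g = 1 := by
  induction n with
  | zero => simp [block_zero]
  | succ n ih =>
    rw [sum_cons, ← ih]
    refine Finset.sum_congr rfl fun h _ => ?_
    simp only [block_cons, Matrix.conjTranspose_mul, mul_assoc]
    simp only [← mul_assoc (T _).conjTranspose]
    rw [← Finset.mul_sum, ← Finset.sum_mul, hT.2, one_mul]

theorem IsCanonical.conjTranspose_block_mul_mem (hT : T.IsCanonical)
    {J : Submodule ℂ (Matrix (Fin D) (Fin D) ℂ)} (hJ : ∀ g, ∀ w ∈ J, T g * w ∈ J) {n : ℕ}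
    (g : Fin n → Spin q) {w : Matrix (Fin D) (Fin D) ℂ} (hw : w ∈ J) :
    (T.block n g).conjTranspose * w ∈ J := by
  induction n generalizing w with
  | zero => simpa [block_zero] using hw
  | succ n ih =>
    rw [← Fin.cons_self_tail g, block_cons, Matrix.conjTranspose_mul, mul_assoc]
    exact ih _ (hT.conjTranspose_mul_mem hJ _ hw)

-- The span `J` of the long blocks is stable under the adjoint matrices. Hence it contains `1 = ∑
-- (T.block k₀ g)† * T.block k₀ g` and then `F†`, so `tr (F * F†) = 0`.
open scoped ComplexOrder in
theorem IsCanonical.eq_zero_of_trace_mul_block (hT : T.IsCanonical) {n k₀ : ℕ}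
    {F : Matrix (Fin D) (Fin D) ℂ} (hF : F ∈ Submodule.span ℂ (Set.range (T.block n)))
    (h : ∀ k, k₀ ≤ k → ∀ g, (F * T.block k g).trace = 0) : F = 0 := by
  let J : Submodule ℂ (Matrix (Fin D) (Fin D) ℂ) :=
    Submodule.span ℂ {X | ∃ k, k₀ ≤ k ∧ ∃ g, X = T.block k g}
  have hJ : ∀ g, ∀ w ∈ J, T g * w ∈ J := by
    intro g w hw
    have : J ≤ J.comap (LinearMap.mulLeft ℂ (T g)) := by
      refine Submodule.span_le.2 ?_
      rintro _ ⟨k, hk, u, rfl⟩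
      exact Submodule.subset_span ⟨k + 1, by omega, Fin.cons g u, (T.block_cons g u).symm⟩
    exact this hw
  have h1 : (1 : Matrix (Fin D) (Fin D) ℂ) ∈ J := by
    rw [← hT.sum_conjTranspose_block_mul k₀]
    exact J.sum_mem fun g _ => hT.conjTranspose_block_mul_mem hJ g
      (Submodule.subset_span ⟨k₀, le_rfl, g, rfl⟩)
  have hJ0 : ∀ w ∈ J, (F * w).trace = 0 := by
    intro w hw
    have : J ≤ LinearMap.ker (Matrix.traceLinearMap (Fin D) ℂ ℂ ∘ₗ LinearMap.mulLeft ℂ F) := by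
      refine Submodule.span_le.2 ?_
      rintro _ ⟨k, hk, u, rfl⟩
      exact h k hk u
    exact this hw
  have hFJ : F.conjTranspose ∈ J := by
    obtain ⟨a, ha⟩ := (Submodule.mem_span_range_iff_exists_fun ℂ).1 hF
    rw [← ha, Matrix.conjTranspose_sum]
    refine J.sum_mem fun g _ => ?_
    rw [Matrix.conjTranspose_smul]
    refine J.smul_mem _ ?_
    have := hT.conjTranspose_block_mul_mem hJ g h1
    rwa [mul_one] at this
  exact Matrix.trace_mul_conjTranspose_self_eq_zero_iff.1 (hJ0 _ hFJ)

end Tensor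

namespace Code

variable {q m D : ℕ} {C : Code q m} {T : Tensor q D}

/-- The terms of the Hamiltonian fix the products of the MPS matrices. -/
def LocallyFixed (C : Code q m) (T : Tensor q D) : Prop :=
  ∀ α, C.chainOp (C.P α) α 0 (T.block (C.P α)) = T.block (C.P α)

/-- On a ring of `P α + k` cells the term starting at the first cell acts on the first block only.
-/
theorem exists_trace_sub_mul_block_eq_zero (h : T.Generates C) :
    ∃ k₀, ∀ k, k₀ ≤ k → ∀ α g u,
      ((C.chainOp (C.P α) α 0 (T.block (C.P α)) g - T.block (C.P α) g) * T.block k u).trace = 0 := by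
  obtain ⟨L₀, hL₀⟩ := eventually_atTop.1 h
  refine ⟨L₀ + C.maxRange, fun k hk α g u => ?_⟩
  have hα := C.P_pos α
  have : NeZero (C.P α + k) := ⟨by omega⟩
  have h1 := hL₀ (C.P α + k) (by omega)
  rw [C.isGroundState_iff _ (by omega), T.relabel_mps] at h1
  have h2 := congrFun (h1.2.bulk α 0 le_rfl (by push_cast; omega)) (Fin.append g u)
  have h3 : C.chainOp (C.P α + k) α 0 (fun g => (T.block (C.P α + k) g).trace) =
      fun g => (C.chainOp (C.P α + k) α 0 (T.block (C.P α + k)) g).trace := pauliOp_trace _ _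
  rw [h3, T.block_add (n := C.P α) (k := k) rfl, C.chainOp_cat,
    C.chainOp_of_add_le (a := 0 - C.P α) (by omega), Module.End.one_apply] at h2
  simp only [cat_append] at h2
  rw [sub_mul, Matrix.trace_sub, h2, sub_self]

theorem chainOp_apply_mem_span {n : ℕ} (α : Fin m) (a : ℤ)
    (F : (Fin n → Spin q) → Matrix (Fin D) (Fin D) ℂ) (g : Fin n → Spin q) :
    C.chainOp n α a F g ∈ Submodule.span ℂ (Set.range F) := by
  rw [chainOp, pauliOp_apply]
  exact Submodule.smul_mem _ _ (Submodule.subset_span ⟨_, rfl⟩)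

theorem locallyFixed_of_hasCanonicalForm (h : T.Generates C) (hT : T.HasCanonicalForm) :
    C.LocallyFixed T := by
  obtain ⟨z, S, T', hz, hT', hTT'⟩ := hT
  obtain ⟨k₀, hk₀⟩ := exists_trace_sub_mul_block_eq_zero h
  have hblock : ∀ n, T.block n = fun g => z ^ n • ((S : Matrix (Fin D) (Fin D) ℂ) * T'.block n g *
        ((S⁻¹ : (Matrix (Fin D) (Fin D) ℂ)ˣ) : Matrix (Fin D) (Fin D) ℂ)) := by
    intro n
    funext g
    induction n with
    | zero => simp [Tensor.block_zero]
    | succ n ih =>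
      rw [← Fin.cons_self_tail g, Tensor.block_cons, Tensor.block_cons, ih, hTT', pow_succ',
        smul_mul_smul_comm]
      congr 1
      simp only [mul_assoc, Units.inv_mul_cancel_left]
  intro α
  let f : Matrix (Fin D) (Fin D) ℂ →ₗ[ℂ] Matrix (Fin D) (Fin D) ℂ :=
    z ^ C.P α • (LinearMap.mulRight ℂ
      ((S⁻¹ : (Matrix (Fin D) (Fin D) ℂ)ˣ) : Matrix (Fin D) (Fin D) ℂ) ∘ₗ
      LinearMap.mulLeft ℂ (S : Matrix (Fin D) (Fin D) ℂ))
  have hb : T.block (C.P α) = fun g => f (T'.block (C.P α) g) := hblock _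
  have hf : C.chainOp (C.P α) α 0 (T.block (C.P α)) =
      fun g => f (C.chainOp (C.P α) α 0 (T'.block (C.P α)) g) := by
    rw [hb]; exact pauliOp_map _ f _
  rw [hf, hb]
  funext g
  congr 1
  rw [← sub_eq_zero]
  refine hT'.eq_zero_of_trace_mul_block (n := C.P α) (k₀ := k₀) ?_ fun k hk u => ?_
  · exact Submodule.sub_mem _ (C.chainOp_apply_mem_span α 0 _ g) (Submodule.subset_span ⟨g, rfl⟩)
  · have h1 := hk₀ k hk α g u
    rw [hf, hb, hblock] at h1
    simp only [← map_sub] at h1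
    set F := C.chainOp (C.P α) α 0 (T'.block (C.P α)) g - T'.block (C.P α) g
    have h2 : f F * z ^ k • ((S : Matrix (Fin D) (Fin D) ℂ) * T'.block k u *
        ((S⁻¹ : (Matrix (Fin D) (Fin D) ℂ)ˣ) : Matrix (Fin D) (Fin D) ℂ)) =
        (z ^ C.P α * z ^ k) • ((S : Matrix (Fin D) (Fin D) ℂ) * (F * T'.block k u) *
        ((S⁻¹ : (Matrix (Fin D) (Fin D) ℂ)ˣ) : Matrix (Fin D) (Fin D) ℂ)) := by
      change (z ^ C.P α • ((S : Matrix (Fin D) (Fin D) ℂ) * F *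
        ((S⁻¹ : (Matrix (Fin D) (Fin D) ℂ)ˣ) : Matrix (Fin D) (Fin D) ℂ))) * _ = _
      rw [smul_mul_smul_comm]
      simp only [mul_assoc, Units.inv_mul_cancel_left]
    rw [h2, Matrix.trace_smul, Matrix.trace_mul_comm, Units.inv_mul_cancel_left, smul_eq_zero] at h1
    exact h1.resolve_left (mul_ne_zero (pow_ne_zero _ hz) (pow_ne_zero _ hz))

/-- The adjoints of the canonical matrices, conjugated by `S` and rescaled, are inverses on both
sides. -/
theorem hasInverses_of_hasCanonicalForm (hT : T.HasCanonicalForm) :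
    HasLeftInverse T ∧ HasRightInverse T := by
  obtain ⟨z, S, T', hz, hT', hTT'⟩ := hT
  constructor
  · refine ⟨fun g => z⁻¹ • ((S : Matrix (Fin D) (Fin D) ℂ) * (T' g).conjTranspose *
        ((S⁻¹ : (Matrix (Fin D) (Fin D) ℂ)ˣ) : Matrix (Fin D) (Fin D) ℂ)), ?_⟩
    simp only [hTT', smul_mul_smul_comm, inv_mul_cancel₀ hz, one_smul, mul_assoc,
      Units.inv_mul_cancel_left]
    simp only [← mul_assoc (T' _).conjTranspose]
    rw [← Finset.mul_sum, ← Finset.sum_mul, hT'.2, one_mul, Units.mul_inv]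
  · refine ⟨fun g => z⁻¹ • ((S : Matrix (Fin D) (Fin D) ℂ) * (T' g).conjTranspose *
        ((S⁻¹ : (Matrix (Fin D) (Fin D) ℂ)ˣ) : Matrix (Fin D) (Fin D) ℂ)), ?_⟩
    simp only [hTT', smul_mul_smul_comm, mul_inv_cancel₀ hz, one_smul, mul_assoc,
      Units.inv_mul_cancel_left]
    simp only [← mul_assoc (T' _)]
    rw [← Finset.mul_sum, ← Finset.sum_mul, hT'.1, one_mul, Units.mul_inv]

theorem isVirtual_iff (U : C.Cut → (Matrix (Fin D) (Fin D) ℂ)ˣ) : T.IsVirtual C U ↔ ∀ c : C.Cut,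
    (∀ g, C.chainOp (C.pos c) c.1 0 (T.block (C.pos c)) g =
      T.block (C.pos c) g * (U c : Matrix (Fin D) (Fin D) ℂ)) ∧
    (∀ g, C.chainOp (C.P c.1 - C.pos c) c.1 (-C.pos c) (T.block (C.P c.1 - C.pos c)) g =
      (((U c)⁻¹ : (Matrix (Fin D) (Fin D) ℂ)ˣ) : Matrix (Fin D) (Fin D) ℂ) *
        T.block (C.P c.1 - C.pos c) g) := by
  refine forall_congr' fun c => ?_
  have hc := C.pos_lt c
  have h1 : (fun k : Fin (C.pos c) => C.o c.1 k) =
      fun k : Fin (C.pos c) => C.stringAt c.1 0 (k : ℤ) := by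
    funext k
    exact (C.stringAt_of_mem (by simp) (by omega)).symm
  have h2 : (fun k : Fin (C.P c.1 - C.pos c) => C.o c.1 (C.pos c + k)) =
      fun k : Fin (C.P c.1 - C.pos c) => C.stringAt c.1 (-C.pos c) (k : ℤ) := by
    funext k
    exact (C.stringAt_of_mem (by push_cast; ring) (by omega)).symm
  rw [h1, h2]
  rfl

/-- Cut the identity `LocallyFixed` at the bond: the two transformed blocks have the same products
as the original ones. -/
theorem exists_isVirtual (hfix : C.LocallyFixed T) (hl : HasLeftInverse T)
    (hr : HasRightInverse T) : ∃ U, T.IsVirtual C U := by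
  have key : ∀ c : C.Cut, ∃ U : (Matrix (Fin D) (Fin D) ℂ)ˣ,
      (∀ g, C.chainOp (C.pos c) c.1 0 (T.block (C.pos c)) g =
        T.block (C.pos c) g * (U : Matrix (Fin D) (Fin D) ℂ)) ∧
      (∀ g, C.chainOp (C.P c.1 - C.pos c) c.1 (-C.pos c) (T.block (C.P c.1 - C.pos c)) g =
        ((U⁻¹ : (Matrix (Fin D) (Fin D) ℂ)ˣ) : Matrix (Fin D) (Fin D) ℂ) *
          T.block (C.P c.1 - C.pos c) g) := by
    intro c
    have hc := C.pos_lt c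
    have hsplit : C.pos c + (C.P c.1 - C.pos c) = C.P c.1 := by omega
    refine exists_unit_of_mul_eq_mul (Tensor.hasLeftInverse_block hl _)
      (Tensor.hasRightInverse_block hr _) fun g k => ?_
    have h1 := hfix c.1
    rw [T.block_add hsplit, C.chainOp_cat, zero_sub] at h1
    have h2 := congrFun h1 fun i => Fin.append g k (i.cast hsplit.symm)
    simp only [StabMPS.cat] at h2
    have e1 : (fun i : Fin (C.pos c) => Fin.append g k (Fin.cast hsplit.symm ⟨i, by omega⟩)) = g := by
      funext i; exact Fin.append_left g k i
    have e2 : (fun i : Fin (C.P c.1 - C.pos c) =>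
        Fin.append g k (Fin.cast hsplit.symm ⟨C.pos c + i, by omega⟩)) = k := by
      funext i; exact Fin.append_right g k i
    rwa [e1, e2] at h2
  choose U hU using key
  exact ⟨U, (isVirtual_iff U).2 hU⟩

theorem _root_.StabMPS.Tensor.IsVirtual.unique (hl : HasLeftInverse T) {U V : C.Cut → (Matrix (Fin D) (Fin D) ℂ)ˣ}
    (hU : T.IsVirtual C U) (hV : T.IsVirtual C V) : U = V := by
  funext c
  exact Units.ext ((Tensor.hasLeftInverse_block hl _).cancel fun g =>
    ((hU c).1 g).symm.trans ((hV c).1 g))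

/-- The cut Pauli string is an involution, and the block cancels on the left. -/
theorem _root_.StabMPS.Tensor.IsVirtual.mul_self (hl : HasLeftInverse T) {U : C.Cut → (Matrix (Fin D) (Fin D) ℂ)ˣ}
    (hU : T.IsVirtual C U) (c : C.Cut) : (U c : Matrix (Fin D) (Fin D) ℂ) * U c = 1 := by
  refine (Tensor.hasLeftInverse_block hl (C.pos c)).cancel fun g => ?_
  have h1 := ((isVirtual_iff U).1 hU c).1
  have h2 := C.chainOp_chainOp c.1 0 (T.block (C.pos c))
  rw [funext h1] at h2
  have h3 : C.chainOp (C.pos c) c.1 0 (fun g => T.block (C.pos c) g *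
      (U c : Matrix (Fin D) (Fin D) ℂ)) = fun g => C.chainOp (C.pos c) c.1 0 (T.block (C.pos c)) g *
      (U c : Matrix (Fin D) (Fin D) ℂ) := pauliOp_mul_right _ _ _
  rw [h3, funext h1] at h2
  rw [← mul_assoc, mul_one]
  exact congrFun h2 g

theorem _root_.StabMPS.Tensor.IsVirtual.right {U : C.Cut → (Matrix (Fin D) (Fin D) ℂ)ˣ} (hU : T.IsVirtual C U) {n : ℕ}
    (hn : C.maxRange ≤ n) (c : C.Cut) : C.chainOp n c.1 (n - C.pos c) (T.block n) =
      fun g => T.block n g * (U c : Matrix (Fin D) (Fin D) ℂ) := by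
  have hc := C.pos_lt c
  have hc' := C.P_le_maxRange c.1
  rw [T.block_add (n := n - C.pos c) (k := C.pos c) (N := n) (by omega), C.chainOp_cat,
    C.chainOp_of_le (n := n - C.pos c) (by omega), Module.End.one_apply,
    show (n : ℤ) - C.pos c - ((n - C.pos c : ℕ) : ℤ) = 0 by omega,
    funext ((isVirtual_iff U).1 hU c).1]
  funext g
  simp only [StabMPS.cat, mul_assoc]

theorem _root_.StabMPS.Tensor.IsVirtual.left {U : C.Cut → (Matrix (Fin D) (Fin D) ℂ)ˣ} (hU : T.IsVirtual C U) {n : ℕ}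
    (hn : C.maxRange ≤ n) (c : C.Cut) : C.chainOp n c.1 (-C.pos c) (T.block n) =
      fun g => (((U c)⁻¹ : (Matrix (Fin D) (Fin D) ℂ)ˣ) : Matrix (Fin D) (Fin D) ℂ) *
        T.block n g := by
  have hc := C.pos_lt c
  have hc' := C.P_le_maxRange c.1
  rw [T.block_add (n := C.P c.1 - C.pos c) (k := n - (C.P c.1 - C.pos c)) (N := n) (by omega),
    C.chainOp_cat, C.chainOp_of_add_le (n := n - (C.P c.1 - C.pos c)) (by omega),
    Module.End.one_apply, funext ((isVirtual_iff U).1 hU c).2]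
  funext g
  simp only [StabMPS.cat, mul_assoc]

/-- A later physical operator inserts its `U c` to the left of the earlier one, so the signs of the
physical commutation carry over without reversing products. -/
theorem _root_.StabMPS.Tensor.IsVirtual.isCliffordRep (hl : HasLeftInverse T)
    {U : C.Cut → (Matrix (Fin D) (Fin D) ℂ)ˣ} (hU : T.IsVirtual C U) :
    IsCliffordRep C.tMatrix U := by
  refine (cliffordRel_iff _ _).2 fun c d => ?_
  have key : ∀ c d, C.chainOp C.maxRange c.1 (C.maxRange - C.pos c)
      (C.chainOp C.maxRange d.1 (C.maxRange - C.pos d) (T.block C.maxRange)) =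
      fun g => T.block C.maxRange g * ((U c : Matrix (Fin D) (Fin D) ℂ) * U d) := by
    intro c d
    rw [Tensor.IsVirtual.right hU le_rfl d]
    refine (pauliOp_mul_right _ _ _).trans ?_
    funext g
    rw [← mul_assoc]
    exact congrArg (· * (U d : Matrix (Fin D) (Fin D) ℂ)) (congrFun (Tensor.IsVirtual.right hU le_rfl c) g)
  refine (Tensor.hasLeftInverse_block hl C.maxRange).cancel fun g => ?_
  rw [mul_smul_comm, ← congrFun (key c d) g, ← congrFun (key d c) g, ← C.overlap_left c d le_rfl]
  exact congrFun (congrArg (fun A => A (T.block C.maxRange)) (C.chainOp_comm (n := C.maxRange)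
    (V := Matrix (Fin D) (Fin D) ℂ) c.1 d.1 (C.maxRange - C.pos c) (C.maxRange - C.pos d))) g

end Code

end StabMPS

/-! ### Canonical form at the minimal bond dimension -/

namespace StabMPS

section PauliSums

variable {q D : ℕ} {κ : Type} [Fintype κ]

theorem star_prod_phase_mul (p : κ → PauliString q) (g : κ → Spin q) :
    star (∏ k, (p k).phase (g k)) * ∏ k, (p k).phase (g k) = 1 := by
  rw [Complex.star_def, ← Complex.normSq_eq_conj_mul_self, Complex.normSq_eq_norm_sq, norm_prod]
  simp [PauliString.norm_phase]

/-- Pauli operators permute configurations with phases of modulus one. -/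
theorem sum_pauliOp_mul_conjTranspose [DecidableEq κ] (p : κ → PauliString q)
    (F : (κ → Spin q) → Matrix (Fin D) (Fin D) ℂ) :
    ∑ g, pauliOp p F g * (pauliOp p F g).conjTranspose = ∑ g, F g * (F g).conjTranspose := by
  rw [← (shift p).sum_comp fun g => F g * (F g).conjTranspose]
  refine Finset.sum_congr rfl fun g _ => ?_
  rw [pauliOp_apply, Matrix.conjTranspose_smul, smul_mul_smul_comm, mul_comm (∏ k, _),
    star_prod_phase_mul p fun k => g k + (p k).x, one_smul, shift_apply]

theorem sum_conjTranspose_pauliOp_mul [DecidableEq κ] (p : κ → PauliString q)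
    (F : (κ → Spin q) → Matrix (Fin D) (Fin D) ℂ) :
    ∑ g, (pauliOp p F g).conjTranspose * pauliOp p F g = ∑ g, (F g).conjTranspose * F g := by
  rw [← (shift p).sum_comp fun g => (F g).conjTranspose * F g]
  refine Finset.sum_congr rfl fun g _ => ?_
  rw [pauliOp_apply, Matrix.conjTranspose_smul, smul_mul_smul_comm,
    star_prod_phase_mul p fun k => g k + (p k).x, one_smul, shift_apply]

end PauliSums

open scoped ComplexOrder

/-- A null vector is killed by every `(A g)†`, hence by the adjoint of `∑ A g * Y g = 1`. -/
theorem HasRightInverse.posDef {D : ℕ} {κ : Type} [Fintype κ] {A : κ → Matrix (Fin D) (Fin D) ℂ}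
    (hA : HasRightInverse A) : (∑ g, A g * (A g).conjTranspose).PosDef := by
  refine Matrix.PosDef.of_dotProduct_mulVec_pos ?_ fun x hx => ?_
  · exact (Matrix.posSemidef_sum _ fun g _ => Matrix.posSemidef_self_mul_conjTranspose _).1
  · have h1 : star x ⬝ᵥ (∑ g, A g * (A g).conjTranspose).mulVec x =
        ∑ g, star ((A g).conjTranspose.mulVec x) ⬝ᵥ ((A g).conjTranspose.mulVec x) := by
      rw [Matrix.sum_mulVec, dotProduct_sum]
      refine Finset.sum_congr rfl fun g _ => ?_
      rw [Matrix.star_mulVec, Matrix.conjTranspose_conjTranspose, ← Matrix.dotProduct_mulVec,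
        Matrix.mulVec_mulVec]
    rw [h1]
    refine Finset.sum_pos' (fun g _ => dotProduct_star_self_nonneg _) ?_
    by_contra! h
    obtain ⟨Y, hY⟩ := hA
    apply hx
    have h2 : ∀ g, (A g).conjTranspose.mulVec x = 0 := fun g => by
      by_contra h3
      exact h g (Finset.mem_univ g) (Matrix.dotProduct_star_self_pos_iff.2 h3)
    have h4 := congrArg Matrix.conjTranspose hY
    rw [Matrix.conjTranspose_sum, Matrix.conjTranspose_one] at h4
    rw [← Matrix.one_mulVec x, ← h4, Matrix.sum_mulVec]
    refine Finset.sum_eq_zero fun g _ => ?_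
    rw [Matrix.conjTranspose_mul, ← Matrix.mulVec_mulVec, h2, Matrix.mulVec_zero]

theorem exists_eq_mul_conjTranspose_of_posDef {D : ℕ} {Q : Matrix (Fin D) (Fin D) ℂ}
    (hQ : Q.PosDef) : ∃ S : (Matrix (Fin D) (Fin D) ℂ)ˣ,
      Q = (S : Matrix (Fin D) (Fin D) ℂ) * (S : Matrix (Fin D) (Fin D) ℂ).conjTranspose := by
  open scoped MatrixOrder Matrix.Norms.L2Operator in
  obtain ⟨S, hS, h⟩ := CStarAlgebra.isStrictlyPositive_iff_eq_star_mul_self.1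
    (Matrix.isStrictlyPositive_iff_posDef.2 hQ)
  exact ⟨hS.star.unit, by simpa [Matrix.star_eq_conjTranspose] using h⟩

/-- Fixed points of the transfer operator and its adjoint that are inverse to each other yield a
canonical form. -/
theorem Tensor.hasCanonicalForm_of_fixed {q D : ℕ} {T : Tensor q D} {Q : Matrix (Fin D) (Fin D) ℂ}
    (hQ : Q.PosDef) {ν : ℂ} (hν : 0 < ν) (h1 : ∑ g, T g * Q * (T g).conjTranspose = ν • Q)
    (h2 : ∑ g, (T g).conjTranspose * Q⁻¹ * T g = ν • Q⁻¹) : T.HasCanonicalForm := by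
  obtain ⟨S, hS⟩ := exists_eq_mul_conjTranspose_of_posDef hQ
  obtain ⟨hre, him⟩ := Complex.pos_iff.1 hν
  set z : ℂ := ((Real.sqrt ν.re : ℝ) : ℂ) with hz
  have hz0 : z ≠ 0 := Complex.ofReal_ne_zero.2 (Real.sqrt_ne_zero'.2 hre)
  have hzz : star z = z := Complex.conj_ofReal _
  have hz2 : z * z = ν := by
    rw [hz, ← Complex.ofReal_mul, Real.mul_self_sqrt hre.le]
    exact Complex.ext rfl him
  set A : Matrix (Fin D) (Fin D) ℂ := (S : Matrix (Fin D) (Fin D) ℂ) with hA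
  set B : Matrix (Fin D) (Fin D) ℂ :=
    ((S⁻¹ : (Matrix (Fin D) (Fin D) ℂ)ˣ) : Matrix (Fin D) (Fin D) ℂ) with hB
  have hAB : A * B = 1 := S.mul_inv
  have hBA : B * A = 1 := S.inv_mul
  have hAB' : B.conjTranspose * A.conjTranspose = 1 := by
    rw [← Matrix.conjTranspose_mul, hAB, Matrix.conjTranspose_one]
  have hBA' : A.conjTranspose * B.conjTranspose = 1 := by
    rw [← Matrix.conjTranspose_mul, hBA, Matrix.conjTranspose_one]
  have hQi : Q⁻¹ = B.conjTranspose * B := Matrix.inv_eq_right_inv <| by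
    rw [hS, mul_assoc, ← mul_assoc A.conjTranspose, hBA', one_mul, hAB]
  have hν0 : ν ≠ 0 := hν.ne'
  have hzi : z⁻¹ * z⁻¹ = ν⁻¹ := by rw [← mul_inv, hz2]
  -- With `Q = S * S†`, conjugation by `S` turns both fixed points into `1`; `z = √ν` normalizes.
  refine ⟨z, S, fun g => z⁻¹ • (B * T g * A), hz0, ⟨?_, ?_⟩, fun g => ?_⟩
  · calc ∑ g, (z⁻¹ • (B * T g * A)) * (z⁻¹ • (B * T g * A)).conjTranspose
        = ν⁻¹ • (B * (∑ g, T g * Q * (T g).conjTranspose) * B.conjTranspose) := by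
          rw [Finset.mul_sum, Finset.sum_mul, Finset.smul_sum]
          refine Finset.sum_congr rfl fun g _ => ?_
          rw [Matrix.conjTranspose_smul, smul_mul_smul_comm, star_inv₀, hzz, hzi, hS]
          simp only [Matrix.conjTranspose_mul, mul_assoc]
      _ = 1 := by
          rw [h1, mul_smul_comm, smul_mul_assoc, smul_smul, inv_mul_cancel₀ hν0, one_smul, hS,
            ← mul_assoc, hBA, one_mul, hBA']
  · calc ∑ g, (z⁻¹ • (B * T g * A)).conjTranspose * (z⁻¹ • (B * T g * A))
        = ν⁻¹ • (A.conjTranspose * (∑ g, (T g).conjTranspose * Q⁻¹ * T g) * A) := by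
          rw [Finset.mul_sum, Finset.sum_mul, Finset.smul_sum]
          refine Finset.sum_congr rfl fun g _ => ?_
          rw [Matrix.conjTranspose_smul, smul_mul_smul_comm, star_inv₀, hzz, hzi, hQi]
          simp only [Matrix.conjTranspose_mul, mul_assoc]
      _ = 1 := by
          rw [h2, mul_smul_comm, smul_mul_assoc, smul_smul, inv_mul_cancel₀ hν0, one_smul, hQi,
            ← mul_assoc, hBA', one_mul, hBA]
  · rw [mul_smul_comm, smul_mul_assoc, smul_smul, mul_inv_cancel₀ hz0, one_smul]
    change T g = A * (B * T g * A) * B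
    simp only [mul_assoc, hAB, mul_one]
    rw [← mul_assoc, hAB, one_mul]

/-- A representation of the dimension of the irreducible ones is irreducible. -/
theorem IsCliffordRep.isIrreducible {ι : Type} [Fintype ι] {D : ℕ} {t : Matrix ι ι (ZMod 2)}
    {U : ι → (Matrix (Fin D) (Fin D) ℂ)ˣ} (hU : IsCliffordRep t U) (hD : D ^ 2 = 2 ^ t.rank) :
    IsIrreducible U := by
  have hD0 : 0 < D := by
    rcases Nat.eq_zero_or_pos D with rfl | h
    · exact absurd hD.symm (by simp)
    · exact h
  refine ⟨hD0, fun W hW => or_iff_not_imp_left.2 fun hne => ?_⟩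
  have : Nontrivial W := Submodule.nontrivial_iff_ne_bot.2 hne
  let A : ι → Module.End ℂ W := fun i =>
    (Matrix.mulVecLin (U i : Matrix (Fin D) (Fin D) ℂ)).restrict (hW i)
  have hA : ∀ i (w : W), (A i w : Fin D → ℂ) = (U i : Matrix (Fin D) (Fin D) ℂ).mulVec w :=
    fun i w => rfl
  have hrel : CliffordRel t A := by
    refine (cliffordRel_iff _ _).2 fun i j => LinearMap.ext fun w => Subtype.ext ?_
    have h1 := (cliffordRel_iff _ _).1 hU i j
    rw [LinearMap.smul_apply, Submodule.coe_smul, Module.End.mul_apply, Module.End.mul_apply,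
      hA, hA, hA, hA, Matrix.mulVec_mulVec, h1, Matrix.smul_mulVec, Matrix.mulVec_mulVec]
  have hunit : ∀ i, IsUnit (A i) := by
    intro i
    refine (LinearMap.isUnit_iff_ker_eq_bot _).2 (LinearMap.ker_eq_bot'.2 fun w hw => ?_)
    apply Subtype.ext
    have h1 := congrArg Subtype.val hw
    rw [hA] at h1
    have h2 := congrArg
      (((U i)⁻¹ : (Matrix (Fin D) (Fin D) ℂ)ˣ) : Matrix (Fin D) (Fin D) ℂ).mulVec h1
    simpa [Matrix.mulVec_mulVec] using h2
  -- The counting bound in `End W` reads `D ^ 2 ≤ (dim W) ^ 2`.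
  have h1 := two_pow_rank_le_finrank hrel hunit
  rw [Module.finrank_linearMap, ← hD, ← pow_two] at h1
  have h2 := (Nat.pow_le_pow_iff_left two_ne_zero).1 h1
  refine Submodule.eq_top_of_finrank_eq (le_antisymm (Submodule.finrank_le _) ?_)
  simpa using h2

namespace Tensor

variable {q D : ℕ} {T : Tensor q D}

theorem block_snoc (T : Tensor q D) {n : ℕ} (h : Fin n → Spin q) (x : Spin q) :
    T.block (n + 1) (Fin.snoc h x) = T.block n h * T x := by
  rw [T.block_add (n := n) (k := 1) rfl, cat, block_one]
  congr 2
  · funext i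
    exact Fin.snoc_castSucc (α := fun _ => Spin q) x h i
  · exact Fin.snoc_last (α := fun _ => Spin q) x h

theorem sum_snoc {M : Type} [AddCommMonoid M] {n : ℕ} (f : (Fin (n + 1) → Spin q) → M) :
    ∑ g, f g = ∑ x : Spin q, ∑ h : Fin n → Spin q, f (Fin.snoc h x) := by
  rw [← (Fin.snocEquiv fun _ : Fin (n + 1) => Spin q).sum_comp, Fintype.sum_prod_type]
  rfl

/-- In an expansion of `1` in blocks, split off the last matrix for the left inverse and the first
for the right one. -/
theorem hasInverses_of_span_eq_top {n : ℕ}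
    (h : Submodule.span ℂ (Set.range (T.block (n + 1))) = ⊤) :
    HasLeftInverse T ∧ HasRightInverse T := by
  obtain ⟨a, ha⟩ := (Submodule.mem_span_range_iff_exists_fun ℂ).1
    (h ▸ Submodule.mem_top : (1 : Matrix (Fin D) (Fin D) ℂ) ∈ _)
  constructor
  · refine ⟨fun x => ∑ h, a (Fin.snoc h x) • T.block n h, ?_⟩
    rw [← ha, sum_snoc]
    simp only [Finset.sum_mul, block_snoc, smul_mul_assoc]
  · refine ⟨fun x => ∑ h, a (Fin.cons x h) • T.block n h, ?_⟩
    rw [← ha, sum_cons, Finset.sum_comm]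
    simp only [Finset.mul_sum, block_cons, mul_smul_comm]

/-- The image of the identity under the `n`-th power of the transfer operator. -/
noncomputable def gramRight (T : Tensor q D) (n : ℕ) : Matrix (Fin D) (Fin D) ℂ :=
  ∑ g, T.block n g * (T.block n g).conjTranspose

/-- The image of the identity under the `n`-th power of the adjoint transfer operator. -/
noncomputable def gramLeft (T : Tensor q D) (n : ℕ) : Matrix (Fin D) (Fin D) ℂ :=
  ∑ g, (T.block n g).conjTranspose * T.block n g

theorem gramRight_succ (T : Tensor q D) (n : ℕ) :
    T.gramRight (n + 1) = ∑ x, T x * T.gramRight n * (T x).conjTranspose := by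
  rw [gramRight, sum_cons, Finset.sum_comm]
  refine Finset.sum_congr rfl fun x _ => ?_
  simp only [gramRight, block_cons, Matrix.conjTranspose_mul, Finset.mul_sum, Finset.sum_mul, mul_assoc]

theorem gramLeft_succ (T : Tensor q D) (n : ℕ) :
    T.gramLeft (n + 1) = ∑ x, (T x).conjTranspose * T.gramLeft n * T x := by
  rw [gramLeft, sum_snoc]
  refine Finset.sum_congr rfl fun x _ => ?_
  simp only [gramLeft, block_snoc, Matrix.conjTranspose_mul, Finset.mul_sum, Finset.sum_mul, mul_assoc]

end Tensor

namespace Code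

variable {q m D : ℕ} {C : Code q m} {T : Tensor q D}

/-- Long blocks span all matrices, so trace orthogonality to them means vanishing. -/
theorem locallyFixed_of_span_eq_top (h : T.Generates C)
    (hspan : ∀ᶠ n : ℕ in atTop, Submodule.span ℂ (Set.range (T.block n)) = ⊤) :
    C.LocallyFixed T := by
  obtain ⟨k₀, hk₀⟩ := exists_trace_sub_mul_block_eq_zero h
  obtain ⟨k, hk, hk'⟩ := (hspan.and (eventually_ge_atTop k₀)).exists
  intro α
  funext g
  rw [← sub_eq_zero, ← Matrix.trace_mul_conjTranspose_self_eq_zero_iff]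
  set F := C.chainOp (C.P α) α 0 (T.block (C.P α)) g - T.block (C.P α) g
  have : (⊤ : Submodule ℂ (Matrix (Fin D) (Fin D) ℂ)) ≤
      LinearMap.ker (Matrix.traceLinearMap (Fin D) ℂ ℂ ∘ₗ LinearMap.mulLeft ℂ F) := by
    rw [← hk, Submodule.span_le]
    rintro _ ⟨u, rfl⟩
    exact hk₀ k hk' α g u
  exact this Submodule.mem_top

/-- The left-end piece multiplies the blocks by `U⁻¹ = U` but leaves their Gram sum unchanged. -/
theorem _root_.StabMPS.Tensor.IsVirtual.mul_gramRight (hl : HasLeftInverse T)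
    {U : C.Cut → (Matrix (Fin D) (Fin D) ℂ)ˣ} (hU : T.IsVirtual C U) {n : ℕ}
    (hn : C.maxRange ≤ n) (c : C.Cut) :
    (U c : Matrix (Fin D) (Fin D) ℂ) * T.gramRight n =
      T.gramRight n * (U c : Matrix (Fin D) (Fin D) ℂ).conjTranspose := by
  have h1 : ∑ g, C.chainOp n c.1 (-C.pos c) (T.block n) g *
      (C.chainOp n c.1 (-C.pos c) (T.block n) g).conjTranspose = T.gramRight n :=
    sum_pauliOp_mul_conjTranspose _ _
  have h2 : (((U c)⁻¹ : (Matrix (Fin D) (Fin D) ℂ)ˣ) : Matrix (Fin D) (Fin D) ℂ) * T.gramRight n *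
      (((U c)⁻¹ : (Matrix (Fin D) (Fin D) ℂ)ˣ) : Matrix (Fin D) (Fin D) ℂ).conjTranspose =
      T.gramRight n := by
    conv_rhs => rw [← h1, Tensor.IsVirtual.left hU hn c]
    simp only [Tensor.gramRight, Matrix.conjTranspose_mul, Finset.mul_sum, Finset.sum_mul, mul_assoc]
  have h3 : (((U c)⁻¹ : (Matrix (Fin D) (Fin D) ℂ)ˣ) : Matrix (Fin D) (Fin D) ℂ).conjTranspose *
      (U c : Matrix (Fin D) (Fin D) ℂ).conjTranspose = 1 := by
    rw [← Matrix.conjTranspose_mul, Units.mul_inv, Matrix.conjTranspose_one]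
  have h4 : (((U c)⁻¹ : (Matrix (Fin D) (Fin D) ℂ)ˣ) : Matrix (Fin D) (Fin D) ℂ) = U c :=
    Units.inv_eq_of_mul_eq_one_left (Tensor.IsVirtual.mul_self hl hU c)
  conv_rhs => rw [← h2, mul_assoc, h3, mul_one, h4]

theorem _root_.StabMPS.Tensor.IsVirtual.gramLeft_mul (hl : HasLeftInverse T)
    {U : C.Cut → (Matrix (Fin D) (Fin D) ℂ)ˣ} (hU : T.IsVirtual C U) {n : ℕ}
    (hn : C.maxRange ≤ n) (c : C.Cut) :
    T.gramLeft n * (U c : Matrix (Fin D) (Fin D) ℂ) =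
      (U c : Matrix (Fin D) (Fin D) ℂ).conjTranspose * T.gramLeft n := by
  have h1 : ∑ g, (C.chainOp n c.1 (n - C.pos c) (T.block n) g).conjTranspose *
      C.chainOp n c.1 (n - C.pos c) (T.block n) g = T.gramLeft n :=
    sum_conjTranspose_pauliOp_mul _ _
  have h2 : (U c : Matrix (Fin D) (Fin D) ℂ).conjTranspose * T.gramLeft n *
      (U c : Matrix (Fin D) (Fin D) ℂ) = T.gramLeft n := by
    conv_rhs => rw [← h1, Tensor.IsVirtual.right hU hn c]
    simp only [Tensor.gramLeft, Matrix.conjTranspose_mul, Finset.mul_sum, Finset.sum_mul, mul_assoc]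
  conv_lhs => rw [← h2, mul_assoc, Tensor.IsVirtual.mul_self hl hU c, mul_one]

/-- `Q` and `Q'` intertwine `U` and its adjoint, so `Q' * Q⁻¹` commutes with `U` and is a scalar by
Schur: `Q` is an eigenvector of the transfer operator. Likewise `R` and `R'` are multiples of `Q⁻¹`.
-/
theorem hasCanonicalForm_of_isIrreducible (hl : HasLeftInverse T) (hr : HasRightInverse T)
    {U : C.Cut → (Matrix (Fin D) (Fin D) ℂ)ˣ} (hU : T.IsVirtual C U) (hirr : IsIrreducible U) :
    T.HasCanonicalForm := by
  have : Nonempty (Fin D) := ⟨⟨0, hirr.1⟩⟩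
  have hschur : ∀ X : Matrix (Fin D) (Fin D) ℂ,
      (∀ c, (U c : Matrix (Fin D) (Fin D) ℂ) * X = X * U c) → ∃ z : ℂ, X = z • 1 :=
    fun X hX => exists_eq_smul_one_of_commute hirr.adjoin_eq_top X hX
  set n := C.maxRange
  set Q := T.gramRight n with hQ
  set Q' := T.gramRight (n + 1) with hQ'
  set R := T.gramLeft n with hR
  set R' := T.gramLeft (n + 1) with hR'
  have hQpos : Q.PosDef := (Tensor.hasRightInverse_block hr n).posDef
  have hQpos' : Q'.PosDef := (Tensor.hasRightInverse_block hr (n + 1)).posDef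
  have hUQ := Tensor.IsVirtual.mul_gramRight hl hU (le_refl n)
  have hUQ' := Tensor.IsVirtual.mul_gramRight hl hU (Nat.le_succ n)
  have hUR := Tensor.IsVirtual.gramLeft_mul hl hU (le_refl n)
  have hUR' := Tensor.IsVirtual.gramLeft_mul hl hU (Nat.le_succ n)
  have hdet : IsUnit Q.det := (Matrix.isUnit_iff_isUnit_det Q).1 hQpos.isUnit
  have hQi : Q * Q⁻¹ = 1 := Matrix.mul_nonsing_inv Q hdet
  have hQi' : Q⁻¹ * Q = 1 := Matrix.nonsing_inv_mul Q hdet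
  obtain ⟨ν, hν⟩ := hschur (Q' * Q⁻¹) fun c => by
    have h1 : (U c : Matrix (Fin D) (Fin D) ℂ).conjTranspose * Q⁻¹ = Q⁻¹ * U c := by
      calc _ = Q⁻¹ * (Q * (U c : Matrix (Fin D) (Fin D) ℂ).conjTranspose) * Q⁻¹ := by
            rw [← mul_assoc Q⁻¹, hQi', one_mul]
        _ = _ := by rw [← hUQ, mul_assoc, mul_assoc, hQi, mul_one]
    rw [← mul_assoc, hUQ', mul_assoc, h1, mul_assoc]
  obtain ⟨κ, hκ⟩ := hschur (Q * R) fun c => by rw [← mul_assoc, hUQ, mul_assoc, ← hUR, mul_assoc]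
  obtain ⟨κ', hκ'⟩ := hschur (Q * R') fun c => by
    rw [← mul_assoc, hUQ, mul_assoc, ← hUR', mul_assoc]
  have hQQ : Q' = ν • Q := by
    rw [← mul_one Q', ← hQi', ← mul_assoc, hν, smul_mul_assoc, one_mul]
  have hRQ : R = κ • Q⁻¹ := by
    rw [← one_mul R, ← hQi', mul_assoc, hκ, mul_smul_comm, mul_one]
  have hRQ' : R' = κ' • Q⁻¹ := by
    rw [← one_mul R', ← hQi', mul_assoc, hκ', mul_smul_comm, mul_one]
  have hν0 : 0 < ν := by
    have h1 := hQpos.trace_pos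
    have h2 := hQpos'.trace_pos
    rw [hQQ, Matrix.trace_smul, smul_eq_mul] at h2
    exact (pos_iff_pos_of_mul_pos h2).2 h1
  -- `Q` and `R` have the same trace, which is positive.
  have hκ0 : κ ≠ 0 := by
    rintro rfl
    rw [zero_smul] at hRQ
    suffices h1 : Q.trace = R.trace from
      hQpos.trace_pos.ne' (by rw [h1, hRQ, Matrix.trace_zero])
    rw [hQ, hR, Tensor.gramRight, Tensor.gramLeft, Matrix.trace_sum, Matrix.trace_sum]
    exact Finset.sum_congr rfl fun g _ => Matrix.trace_mul_comm _ _
  -- The trace pairs the transfer operator with its adjoint, so both have the eigenvalue `ν`.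
  have htr : κ' = ν * κ := by
    have h1 : (Q' * R).trace = (Q * R').trace := by
      rw [hQ', hR', Tensor.gramRight_succ, Tensor.gramLeft_succ, Finset.sum_mul, Finset.mul_sum,
        Matrix.trace_sum, Matrix.trace_sum]
      refine Finset.sum_congr rfl fun g _ => ?_
      rw [mul_assoc, mul_assoc, Matrix.trace_mul_comm]
      simp only [mul_assoc, hQ, hR]
    rw [hκ', hQQ, smul_mul_assoc, hκ, smul_smul, Matrix.trace_smul, Matrix.trace_smul] at h1
    have h2 : (1 : Matrix (Fin D) (Fin D) ℂ).trace ≠ 0 := by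
      rw [Matrix.trace_one]; simp [hirr.1.ne']
    exact (mul_right_cancel₀ h2 h1).symm
  refine Tensor.hasCanonicalForm_of_fixed hQpos hν0 ?_ ?_
  · rw [← hQQ, hQ', Tensor.gramRight_succ]
  · have h1 := Tensor.gramLeft_succ T n
    rw [← hR, ← hR', hRQ, hRQ', htr] at h1
    have h2 := congrArg (κ⁻¹ • ·) h1
    simp only [mul_smul_comm, smul_mul_assoc, ← Finset.smul_sum, smul_smul, inv_mul_cancel₀ hκ0,
      one_smul] at h2
    rw [← h2, mul_comm ν, ← mul_assoc, inv_mul_cancel₀ hκ0, one_mul]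

end Code

end StabMPS
-- The theorem
theorem mainTheorem5 {q m : ℕ} (C : StabMPS.Code q m)
    (hcomm : ∀ᶠ L : ℕ in Filter.atTop, ∀ [NeZero L], C.Commuting L)
    (huniq : ∀ᶠ L : ℕ in Filter.atTop, ∀ [NeZero L], C.HasUniqueGroundState L) :
    -- `𝐭` is antisymmetric with zero diagonal, and its rank over `𝔽₂` is even
    (C.tMatrix.transpose = -C.tMatrix ∧ (∀ c, C.tMatrix c c = 0) ∧ Even C.tMatrix.rank) ∧
    -- the physical cut operators at one bond satisfy the relations encoded by `𝐭`
    (∀ (L : ℕ) [NeZero L], (∀ α, C.P α ≤ L) → ∀ r : ZMod L,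
      StabMPS.CliffordRel C.tMatrix (fun c => C.leftOp L c r) ∧
      StabMPS.CliffordRel C.tMatrix (fun c => C.rightOp L c r)) ∧
    -- the virtual operators of an MPS of the ground state exist, are unique, and satisfy the same
    -- relations
    (∀ (D : ℕ) (T : StabMPS.Tensor q D), T.Generates C → T.HasCanonicalForm →
      (∃! U : C.Cut → (Matrix (Fin D) (Fin D) ℂ)ˣ, T.IsVirtual C U) ∧
      ∀ U : C.Cut → (Matrix (Fin D) (Fin D) ℂ)ˣ, T.IsVirtual C U →
        StabMPS.IsCliffordRep C.tMatrix U) ∧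
    -- the irreducible representations of these relations have dimension `2 ^ (rank 𝐭 / 2)`
    ((∃ U : C.Cut → (Matrix (Fin (2 ^ (C.tMatrix.rank / 2)))
        (Fin (2 ^ (C.tMatrix.rank / 2))) ℂ)ˣ,
        StabMPS.IsCliffordRep C.tMatrix U ∧ StabMPS.IsIrreducible U) ∧
      ∀ (D : ℕ) (U : C.Cut → (Matrix (Fin D) (Fin D) ℂ)ˣ),
        StabMPS.IsCliffordRep C.tMatrix U → StabMPS.IsIrreducible U →
        D = 2 ^ (C.tMatrix.rank / 2)) ∧
    -- this is the minimal bond dimension: it is attained by a tensor independent of the system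
    -- size, and no tensor of smaller bond dimension gives the ground state of a long chain
    (∃ T : StabMPS.Tensor q (2 ^ (C.tMatrix.rank / 2)), T.Generates C) ∧
    (∀ᶠ L : ℕ in Filter.atTop, ∀ [NeZero L], ∀ (D : ℕ) (T : StabMPS.Tensor q D),
      C.IsGroundState L (T.mps L) → 2 ^ (C.tMatrix.rank / 2) ≤ D) ∧
    -- every MPS of minimal bond dimension has a canonical form, and its virtual operators act
    -- irreducibly
    (∀ T : StabMPS.Tensor q (2 ^ (C.tMatrix.rank / 2)), T.Generates C →
      T.HasCanonicalForm ∧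
      ∀ U : C.Cut → (Matrix (Fin (2 ^ (C.tMatrix.rank / 2)))
        (Fin (2 ^ (C.tMatrix.rank / 2))) ℂ)ˣ, T.IsVirtual C U → StabMPS.IsIrreducible U) := by
  have hrange : ∀ L : ℕ, (∀ α, C.P α ≤ L) → C.maxRange ≤ L := fun L h => Finset.sup_le fun α _ => h α
  obtain ⟨D₀, U₀, hirr₀, hcl₀, T₀, hT₀⟩ := StabMPS.Code.exists_generates hcomm huniq
  -- The irreducible representation found on long rings forces the rank to be even.
  obtain ⟨heven, hD₀⟩ := StabMPS.even_and_eq_of_sq_eq_two_pow (hirr₀.sq_eq hcl₀)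
  have hsq : (2 ^ (C.tMatrix.rank / 2)) ^ 2 = 2 ^ C.tMatrix.rank := by
    rw [← pow_mul, Nat.div_mul_cancel heven.two_dvd]
  subst hD₀
  refine ⟨⟨?_, C.tMatrix_self, heven⟩, fun L _ hL r => ⟨C.cliffordRel_leftOp L (hrange L hL) r,
    StabMPS.Code.cliffordRel_rightOp hcomm (hrange L hL) r⟩, fun D T hT hform => ?_,
    ⟨⟨U₀, hcl₀, hirr₀⟩, fun D U hU hirr =>
      (StabMPS.even_and_eq_of_sq_eq_two_pow (hirr.sq_eq hU)).2⟩, ⟨T₀, hT₀⟩, ?_, fun T hT => ?_⟩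
  · ext c d
    rw [Matrix.transpose_apply, Matrix.neg_apply, ZMod.neg_eq_self_mod_two, C.tMatrix_comm]
  · obtain ⟨hl, hr⟩ := StabMPS.Code.hasInverses_of_hasCanonicalForm hform
    obtain ⟨U, hU⟩ := StabMPS.Code.exists_isVirtual
      (StabMPS.Code.locallyFixed_of_hasCanonicalForm hT hform) hl hr
    exact ⟨⟨U, hU, fun V hV => StabMPS.Tensor.IsVirtual.unique hl hV hU⟩,
      fun V hV => StabMPS.Tensor.IsVirtual.isCliffordRep hl hV⟩
  · filter_upwards [Filter.eventually_ge_atTop (3 * C.maxRange)] with L hL _ D T hT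
    exact StabMPS.Code.two_pow_le_of_isGroundState hcomm heven hL hT
  · have hspan : ∀ n, 2 * C.maxRange ≤ n → Submodule.span ℂ (Set.range (T.block n)) = ⊤ :=
      fun n hn => StabMPS.Code.span_block_eq_top hcomm heven hT hn
    -- The length must be positive for one matrix to be split off, hence the `+ 1`.
    obtain ⟨hl, hr⟩ := StabMPS.Tensor.hasInverses_of_span_eq_top
      (hspan (2 * C.maxRange + 1) (Nat.le_succ _))
    obtain ⟨U, hU⟩ := StabMPS.Code.exists_isVirtual (StabMPS.Code.locallyFixed_of_span_eq_top hT
      (Filter.eventually_atTop.2 ⟨_, hspan⟩)) hl hr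
    have hirr : ∀ V : C.Cut → (Matrix (Fin (2 ^ (C.tMatrix.rank / 2)))
        (Fin (2 ^ (C.tMatrix.rank / 2))) ℂ)ˣ, T.IsVirtual C V → StabMPS.IsIrreducible V :=
      fun V hV => (StabMPS.Tensor.IsVirtual.isCliffordRep hl hV).isIrreducible hsq
    exact ⟨StabMPS.Code.hasCanonicalForm_of_isIrreducible hl hr hU (hirr U hU), hirr⟩
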